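/- Let $\mathcal X,\mathcal Y$ be measurable spaces and $\mu,\nu$ probability measures on them. Let $X_1,X_2,\dots$ be i.i.d. with law $\mu$ and $Y_{i,j}$ $(i<j)$ be i.i.d. with law $\nu$, the two families being independent of each other, and put $Y_{j,i}=Y_{i,j}$. Write $[k]=\{1,\dots,k\}$ and $[k]_2=\{(i,j):1\le i<j\le k\}$. Let $f:\mathcal X^k\times\mathcal Y^{k(k-1)/2}\to\mathbb R$ be measurable and symmetric, i.e. the value $f(x_1,\dots,x_k;y_{1,2},\dots,y_{k-1,k})$ (with $y_{j,i}=y_{i,j}$) is unchanged under every permutation of the indices $1,\dots,k$. For $n\ge k$ let $$S_{n,k}(f)=\sum_{1\le\alpha(1)<\dots<\alpha(k)\le n} f\bigl(X_{\alpha(1)},\dots,X_{\alpha(k)};Y_{\alpha(1),\alpha(2)},\dots,Y_{\alpha(k-1),\alpha(k)}\bigr).$$ For $A\subset[k]$ and $B\subset[k]_2$ let $$f_{A,B}(x_A;y_B)=\sum_{A'\subset A,\;B'\subset B}(-1)^{|A|+|B|-|A'|-|B'|}\,\mathbb E\bigl\{f(X_{[k]};Y_{[k]_2})\mid X_{A'}=x_{A'},\,Y_{B'}=y_{B'}\bigr\},$$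 let $\sigma_{A,B}=\|f_{A,B}(X_A;Y_B)\|_2$, where $\|Z\|_p=(\mathbb E|Z|^p)^{1/p}$, let $G_{A,B}$ be the graph with edge set $B$ whose vertices are the elements of $A$ and the endpoints of the edges in $B$, and let $v_{A,B}$ be its number of vertices. Let $f_{(\ell)}=\sum_{v_{A,B}=\ell}f_{A,B}(X_A;Y_B)$. The principal degree of $f$ is $\min\{\ell>0: f_{(\ell)}\ne0\}$, where $f_{(\ell)}\neq 0$ means that $f_{(\ell)}$ is not almost surely zero. If $d$ is the principal degree of $f$, the graphs in $\mathcal G_{f,d}=\{G_{A,B}:\sigma_{A,B}\ne0,\ v_{A,B}=d\}$ are called the principal support graphs of $f$, and $\sigma_{\min}=\min\{\sigma_{A,B}:\sigma_{A,B}\ne 0,\ v_{A,B}=d\}$. **Theorem 2.2.** Assume that $\tau=\|f(X_{[k]};Y_{[k]_2})\|_4<\infty$, that $f$ is symmetric with principal degree $d$, where $2\le d\le k$, and that all graphs in $\mathcal G_{f,d}$ are connected. Then, for all $n\ge k$, $$\sup_{z\in\mathbb R}\left|\mathbb P\left[\frac{S_{n,k}(f)-\mathbb E\{S_{n,k}(f)\}}{\sqrt{\operatorname{Var}\{S_{n,k}(f)\}}}\le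 z\right]-\Phi(z)\right|\le C\,n^{-1/2},$$ where $\Phi$ is the standard normal distribution function and $C>0$ depends only on $k$, $d$, $\sigma_{\min}$ and $\tau$. -/

import Mathlib

open MeasureTheory ProbabilityTheory Finset
open scoped ENNReal

universe u v w

namespace GenUStat

/-- The unordered pairs `{i, j}`, `i ≠ j`, of elements of `V`. A family indexed by `Edge (Fin n)` is
a family `Y i j`, `i < j`, together with the convention `Y j i = Y i j`. -/
abbrev Edge (V : Type*) : Type _ := {e : Sym2 V // ¬ e.IsDiag}

/-- The image `{φ i, φ j}` of a pair `{i, j}` under an injective map `φ`. -/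
def Edge.map {V W : Type*} (φ : V ↪ W) (e : Edge V) : Edge W :=
  ⟨e.1.map φ, fun h => e.2 ((Sym2.isDiag_map φ.injective).1 h)⟩

/-- The arguments `(x, y)` of a kernel: `x i` for the vertices `i ∈ {1, …, k}` and `y e` for the pairs
`e` of vertices. -/
abbrev Args (𝒳 : Type u) (𝒴 : Type v) (k : ℕ) : Type (max u v) :=
  (Fin k → 𝒳) × (Edge (Fin k) → 𝒴)

/-- `f` is symmetric: its value is unchanged when the `k` indices are permuted, where `Y i j` is
moved to `Y (π i) (π j)`. -/
def IsSymmetric {𝒳 : Type u} {𝒴 : Type v} {k : ℕ} (f : Args 𝒳 𝒴 k → ℝ) : Prop :=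
  ∀ (π : Equiv.Perm (Fin k)) (x : Fin k → 𝒳) (y : Edge (Fin k) → 𝒴),
    f (fun i => x (π i), fun e => y (e.map π.toEmbedding)) = f (x, y)

noncomputable instance (k n : ℕ) : Fintype (Fin k ↪o Fin n) := Fintype.ofFinite _

/-- The generalized U-statistic: the sum, over `1 ≤ α 1 < ⋯ < α k ≤ n`, of
`f (X_{α 1}, …, X_{α k}; Y_{α 1, α 2}, …, Y_{α (k-1), α k})`. -/
noncomputable def stat {𝒳 : Type u} {𝒴 : Type v} {Ω : Type w} {k n : ℕ} (f : Args 𝒳 𝒴 k → ℝ)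
    (X : Fin n → Ω → 𝒳) (Y : Edge (Fin n) → Ω → 𝒴) (ω : Ω) : ℝ :=
  ∑ α : Fin k ↪o Fin n, f (fun i => X (α i) ω, fun e => Y (e.map α.toEmbedding) ω)

section Hoeffding

variable {𝒳 : Type u} {𝒴 : Type v} [MeasurableSpace 𝒳] [MeasurableSpace 𝒴] {k : ℕ}

/-- The joint law of `(X_1, …, X_k; Y_{1,2}, …, Y_{k-1,k})`, when the `X_i` are i.i.d. with law `μ`,
the `Y_e` are i.i.d. with law `ν`, and the two families are independent. -/
noncomputable def law (μ : Measure 𝒳) (ν : Measure 𝒴) (k : ℕ) : Measure (Args 𝒳 𝒴 k) :=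
  (Measure.pi fun _ => μ).prod (Measure.pi fun _ => ν)

/-- The conditional expectation `E {f (X; Y) | X_A = x_A, Y_B = y_B}` at `p = (x, y)`: as all the
variables are independent, the coordinates in `A` and `B` are held fixed and the others are
integrated against their law. -/
noncomputable def condMean (μ : Measure 𝒳) (ν : Measure 𝒴) (f : Args 𝒳 𝒴 k → ℝ)
    (A : Finset (Fin k)) (B : Finset (Edge (Fin k))) (p : Args 𝒳 𝒴 k) : ℝ :=
  ∫ q, f (A.piecewise p.1 q.1, B.piecewise p.2 q.2) ∂(law μ ν k)

/-- The Hoeffding component `f_{A,B}`, written as a function of all the coordinates, although it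
depends only on those in `A` and `B`. -/
noncomputable def component (μ : Measure 𝒳) (ν : Measure 𝒴) (f : Args 𝒳 𝒴 k → ℝ)
    (A : Finset (Fin k)) (B : Finset (Edge (Fin k))) (p : Args 𝒳 𝒴 k) : ℝ :=
  ∑ A' ∈ A.powerset, ∑ B' ∈ B.powerset,
    (-1 : ℝ) ^ ((#A - #A') + (#B - #B')) * condMean μ ν f A' B' p

/-- The graph `G_{A,B}` generated by `A` and `B`, with edge set `B`; its nodes are the elements of `A`
and the endpoints of the edges in `B`. -/
def graph (A : Finset (Fin k)) (B : Finset (Edge (Fin k))) :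
    (⊤ : SimpleGraph (Fin k)).Subgraph where
  verts := {i | i ∈ A ∨ ∃ e ∈ B, i ∈ e.1}
  Adj i j := ∃ e ∈ B, e.1 = s(i, j)
  adj_sub := by
    rintro i j ⟨e, -, he⟩
    have h := e.2
    rw [he] at h
    simpa using h
  edge_vert := by
    rintro i j ⟨e, he, h⟩
    exact Or.inr ⟨e, he, by simp [h]⟩
  symm := ⟨by
    rintro i j ⟨e, he, h⟩
    exact ⟨e, he, by rw [h, Sym2.eq_swap]⟩⟩

/-- The number `v_{A,B}` of nodes of `G_{A,B}`. -/
noncomputable def numNodes (A : Finset (Fin k)) (B : Finset (Edge (Fin k))) : ℕ :=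
  (graph A B).verts.ncard

/-- `f_{(ℓ)}`, the sum of the components `f_{A,B}` with `v_{A,B} = ℓ`. -/
noncomputable def levelPart (μ : Measure 𝒳) (ν : Measure 𝒴) (f : Args 𝒳 𝒴 k → ℝ) (ℓ : ℕ)
    (p : Args 𝒳 𝒴 k) : ℝ :=
  ∑ AB : Finset (Fin k) × Finset (Edge (Fin k)) with numNodes AB.1 AB.2 = ℓ,
    component μ ν f AB.1 AB.2 p

/-- `d` is the principal degree of `f`: the least `ℓ > 0` for which `f_{(ℓ)} (X; Y)` is not almost
surely zero. -/
def IsPrincipalDegree (μ : Measure 𝒳) (ν : Measure 𝒴) (f : Args 𝒳 𝒴 k → ℝ) (d : ℕ) : Prop :=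
  IsLeast {ℓ : ℕ | 0 < ℓ ∧ ¬ (levelPart μ ν f ℓ =ᵐ[law μ ν k] 0)} d

/-- `σ_{A,B}`, the `L²` norm of `f_{A,B} (X_A; Y_B)`. -/
noncomputable def sigma (μ : Measure 𝒳) (ν : Measure 𝒴) (f : Args 𝒳 𝒴 k → ℝ)
    (A : Finset (Fin k)) (B : Finset (Edge (Fin k))) : ℝ :=
  (eLpNorm (component μ ν f A B) 2 (law μ ν k)).toReal

/-- The pairs `(A, B)` for which `G_{A,B}` belongs to `𝒢_{f,d}`. For the principal degree `d`, these
index the principal support graphs of `f`. -/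
def principalSupport (μ : Measure 𝒳) (ν : Measure 𝒴) (f : Args 𝒳 𝒴 k → ℝ) (d : ℕ) :
    Set (Finset (Fin k) × Finset (Edge (Fin k))) :=
  {AB | sigma μ ν f AB.1 AB.2 ≠ 0 ∧ numNodes AB.1 AB.2 = d}

end Hoeffding

end GenUStat

set_option linter.unusedSectionVars false

namespace GenUStat

/-! Each coordinate, a vertex or a pair of vertices, carries an independent variable, and the
centred U-statistic is a sum of Hoeffding components `w T` over nonempty sets `T` of coordinates,
orthogonal for different `T`. A component whose graph has `v` vertices is met by at most `n ^ (k -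
v)` summands, while the variance is at least of order `n ^ (2 * k - d)` (`pow_mul_le_variance`,
which rests on the symmetry of the kernel). After normalisation its squared L⁴ norm is thus `O(n ^
(d - 2 * v))`. As there are `O(n ^ v)` sets with `v` vertices, the level `d` dominates; the levels
above it have total weight `O(1 / n)`, and so do the sets that contain a given coordinate.

The normal approximation is Stein's method with one coordinate resampled at a time
(`abs_sub_ncdf_le`). Let `W` be the normalised sum, `u i` the sum of the components containing `i`,
and `h i` the same sum with each component divided by its number of coordinates, so that `W = ∑ h
i`, and resampling `i` changes `W` only through `u i`. As `h i` is orthogonal to all that is free of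
`i`, the mean of `W S(W)` is the sum of the means of `h i (S(W) - S(W'))`, with `S` the Stein
solution for a half line and `W'` the resampled sum. The Taylor error of the nonsmooth `S` is at
most `(W - W') (G(W) - G(W'))` with `G` bounded and monotone (`abs_steinSol_sub_le`).
Exchangeability of `W` and `W'` moves the increment of `G` onto the antisymmetric coefficient `(|h|
+ |h'|) (u - u')`, so that only boundedness of `G` is needed and no rate is lost.

It remains to see that the means of `|1 - ∑ h i u i|` and of the absolute value of the summed
conditional antisymmetric terms are `O(n ^ (-1/2))`. In the second quantity the covariance of the
terms for `i` and `j` feels only the components containing both (`integral_sq_sum_antisymmMean_le`);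
fourth moments are handled by hypercontractivity (`sqNorm4_sum_le`). In the first, the levels above
`d` are negligible, and at level `d` the variance is a sum of covariances of `w A w B` and `w C w D`
with `A` meeting `B`. Connectedness enters here: the covariance vanishes once the four graphs cover
at least `2 * d` vertices (`cov4_eq_zero`). This leaves `O(n ^ (2 * d - 1))` quadruples, each
contributing `O(n ^ (-2 * d))`. -/

/-- Change of variables along a measure preserving map. -/
theorem integral_comp_measurePreserving {α β : Type*} [MeasurableSpace α] [MeasurableSpace β]
    {μ : Measure α} {ν : Measure β} {g : α → β} (hg : MeasurePreserving g μ ν) {F : β → ℝ}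
    (hF : AEStronglyMeasurable F ν) : ∫ a, F (g a) ∂μ = ∫ b, F b ∂ν := by
  have := integral_map hg.measurable.aemeasurable (f := F) (by rwa [hg.map_eq])
  rw [← this, hg.map_eq]

/-! ### Integrability of products of functions in L⁴. -/

section FourthPowers

variable {α : Type*} [MeasurableSpace α] {μ : Measure α}

theorem integrable_pow_four {F : α → ℝ} (hF : MemLp F 4 μ) : Integrable (fun a => F a ^ 4) μ := by
  have := hF.integrable_norm_pow (p := 4) (by norm_num)
  refine this.congr (Filter.Eventually.of_forall fun a => ?_)
  simp only [Real.norm_eq_abs]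
  exact Even.pow_abs (by decide) _

theorem memLp_four_of_integrable {F : α → ℝ} (hF : AEStronglyMeasurable F μ)
    (h : Integrable (fun a => F a ^ 4) μ) : MemLp F 4 μ := by
  have := (integrable_norm_rpow_iff (p := 4) hF (by norm_num) (by norm_num)).1
  refine this (h.congr (Filter.Eventually.of_forall fun a => ?_))
  have h4 : ((4 : ℝ≥0∞).toReal) = ((4 : ℕ) : ℝ) := by norm_num
  simp only [h4, Real.rpow_natCast, Real.norm_eq_abs]
  exact (Even.pow_abs (by decide) _).symm

theorem abs_mul_four_le (a b c d : ℝ) :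
    |a * b * c * d| ≤ (a ^ 4 + b ^ 4 + c ^ 4 + d ^ 4) / 4 := by
  rw [abs_le]
  constructor <;> nlinarith [sq_nonneg (a * b + c * d), sq_nonneg (a * b - c * d),
    sq_nonneg (a ^ 2 - b ^ 2), sq_nonneg (c ^ 2 - d ^ 2)]

theorem integrable_mul_four {F G H K : α → ℝ} (hF : MemLp F 4 μ) (hG : MemLp G 4 μ)
    (hH : MemLp H 4 μ) (hK : MemLp K 4 μ) : Integrable (fun a => F a * G a * H a * K a) μ := by
  refine (((((integrable_pow_four hF).add (integrable_pow_four hG)).add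
    (integrable_pow_four hH)).add (integrable_pow_four hK)).div_const 4).mono'
    (((hF.1.mul hG.1).mul hH.1).mul hK.1) (Filter.Eventually.of_forall fun a => ?_)
  exact abs_mul_four_le _ _ _ _

theorem integrable_mul_two [IsProbabilityMeasure μ] {F G : α → ℝ} (hF : MemLp F 4 μ)
    (hG : MemLp G 4 μ) : Integrable (fun a => F a * G a) μ := by
  have := integrable_mul_four hF hG (memLp_const (1 : ℝ)) (memLp_const (1 : ℝ))
  simpa using this

theorem memLp_four_of_bound [IsFiniteMeasure μ] {F : α → ℝ} (hF : Measurable F) (B : ℝ)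
    (h : ∀ a, |F a| ≤ B) : MemLp F 4 μ :=
  MemLp.of_bound hF.aestronglyMeasurable B (Filter.Eventually.of_forall h)

theorem memLp_four_abs {F : α → ℝ} (hF : MemLp F 4 μ) : MemLp (fun a => |F a|) 4 μ := hF.norm

end FourthPowers

/-! ### Product spaces, resampling of a coordinate, and completely degenerate functions. -/

section ProductSpace

variable {I Z : Type*} [Fintype I] [DecidableEq I] [MeasurableSpace Z]

/-- The law of i.i.d. coordinates indexed by `I`. -/
noncomputable abbrev piLaw (m : Measure Z) (I : Type*) [Fintype I] : Measure (I → Z) :=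
  Measure.pi fun _ : I => m

variable (m : Measure Z) [IsProbabilityMeasure m]

/-- Exchanging the coordinates outside `S` between two independent copies preserves their law. -/
theorem measurePreserving_exchange (S : Finset I) :
    MeasurePreserving (fun p : (I → Z) × (I → Z) => (S.piecewise p.1 p.2, S.piecewise p.2 p.1))
      ((piLaw m I).prod (piLaw m I)) ((piLaw m I).prod (piLaw m I)) := by
  -- Two families of variables are one family of pairs; there the exchange acts coordinatewise, as
  -- the identity or as the swap.
  have h1 := measurePreserving_arrowProdEquivProdArrow Z Z I (fun _ => m) (fun _ => m)
  have h2 : MeasurePreserving (fun (a : I → Z × Z) i => if i ∈ S then a i else (a i).swap)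
      (Measure.pi fun _ => m.prod m) (Measure.pi fun _ => m.prod m) := by
    have := measurePreserving_pi (fun _ : I => m.prod m) (fun _ : I => m.prod m)
      (f := fun i (q : Z × Z) => if i ∈ S then q else q.swap) (fun i => by
        by_cases hi : i ∈ S
        · simp only [hi, if_true]; exact MeasurePreserving.id _
        · simp only [hi, if_false]; exact Measure.measurePreserving_swap)
    exact this
  have h3 := (h1.comp h2).comp (h1.symm _)
  convert h3 using 1
  ext p i
  · by_cases hi : i ∈ S <;>
      simp [hi, MeasurableEquiv.arrowProdEquivProdArrow, Equiv.arrowProdEquivProdArrow]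
  · by_cases hi : i ∈ S <;>
      simp [hi, MeasurableEquiv.arrowProdEquivProdArrow, Equiv.arrowProdEquivProdArrow]

theorem measurePreserving_piecewise (S : Finset I) :
    MeasurePreserving (fun p : (I → Z) × (I → Z) => S.piecewise p.1 p.2)
      ((piLaw m I).prod (piLaw m I)) (piLaw m I) :=
  measurePreserving_fst.comp (measurePreserving_exchange m S)

/-- Replacing the coordinate `i` by that of an independent copy. -/
def resample (i : I) (p : (I → Z) × (I → Z)) : I → Z := Function.update p.1 i (p.2 i)

/-- Exchanging the coordinate `i` between two copies. -/
def swapAt (i : I) (p : (I → Z) × (I → Z)) : (I → Z) × (I → Z) :=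
  (resample i p, resample i p.swap)

/-- `swapAt i` interchanges the configuration with its resampled version, so the two form an
exchangeable pair. -/
theorem resample_swapAt (i : I) (p : (I → Z) × (I → Z)) : resample i (swapAt i p) = p.1 := by
  ext j
  by_cases h : j = i
  · subst h; simp [resample, swapAt]
  · simp [resample, swapAt, h]

theorem measurePreserving_swapAt (i : I) :
    MeasurePreserving (swapAt (Z := Z) i)
      ((piLaw m I).prod (piLaw m I)) ((piLaw m I).prod (piLaw m I)) := by
  convert measurePreserving_exchange m ({i}ᶜ : Finset I) using 1
  ext p j
  · by_cases h : j = i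
    · subst h; simp [resample, swapAt]
    · simp [resample, swapAt, h]
  · by_cases h : j = i
    · subst h; simp [resample, swapAt]
    · simp [resample, swapAt, h]

theorem measurePreserving_resample (i : I) :
    MeasurePreserving (resample (Z := Z) i) ((piLaw m I).prod (piLaw m I)) (piLaw m I) :=
  measurePreserving_fst.comp (measurePreserving_swapAt m i)

theorem integral_swapAt (i : I) {F : (I → Z) × (I → Z) → ℝ} (hF : Measurable F) :
    ∫ p, F (swapAt i p) ∂((piLaw m I).prod (piLaw m I)) =
      ∫ p, F p ∂((piLaw m I).prod (piLaw m I)) :=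
  integral_comp_measurePreserving (measurePreserving_swapAt m i) hF.aestronglyMeasurable

theorem dependsOn_comp_binary {F G : (I → Z) → ℝ} {S : Set I} (op : ℝ → ℝ → ℝ)
    (hF : DependsOn F S) (hG : DependsOn G S) : DependsOn (fun z => op (F z) (G z)) S := by
  intro x y h
  simp only [hF h, hG h]

theorem dependsOn_finset_sum {ι : Type*} {s : Finset ι} {F : ι → (I → Z) → ℝ} {S : Set I}
    (hF : ∀ j ∈ s, DependsOn (F j) S) : DependsOn (fun z => ∑ j ∈ s, F j z) S := by
  intro x y h
  exact Finset.sum_congr rfl fun j hj => hF j hj h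

/-- Functions of disjoint sets of coordinates are independent. -/
theorem integral_mul_of_disjoint {F G : (I → Z) → ℝ} (hF : Measurable F) (hG : Measurable G)
    {S T : Finset I} (hFS : DependsOn F S) (hGT : DependsOn G T) (hST : Disjoint S T) :
    ∫ z, F z * G z ∂(piLaw m I) = (∫ z, F z ∂(piLaw m I)) * ∫ z, G z ∂(piLaw m I) := by
  -- A mixture of two independent copies has the same law; in it `F` sees only the first copy and
  -- `G` only the second.
  rw [← integral_prod_mul, ← integral_comp_measurePreserving (measurePreserving_piecewise m S)
    (F := fun z => F z * G z) (hF.mul hG).aestronglyMeasurable]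
  refine integral_congr_ae (Filter.Eventually.of_forall fun p => ?_)
  have h1 : F (S.piecewise p.1 p.2) = F p.1 := hFS fun i hi => by
    simp [Finset.mem_coe.1 hi]
  have h2 : G (S.piecewise p.1 p.2) = G p.2 := hGT fun i hi => by
    have : i ∉ S := Finset.disjoint_right.1 hST (Finset.mem_coe.1 hi)
    simp [this]
  simp [h1, h2]

/-- `F` is orthogonal to the functions that do not depend on the coordinate `i`. -/
def OrthAt (i : I) (F : (I → Z) → ℝ) : Prop :=
  ∀ G : (I → Z) → ℝ, Measurable G → DependsOn G ({i}ᶜ : Set I) →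
    Integrable (fun z => F z * G z) (piLaw m I) → ∫ z, F z * G z ∂(piLaw m I) = 0

variable {m}

theorem OrthAt.const_mul {i : I} {F : (I → Z) → ℝ} (h : OrthAt m i F) (c : ℝ) :
    OrthAt m i (fun z => c * F z) := by
  intro G hG hd hint
  -- For `c = 0` the integrability hypothesis says nothing about `F * G`.
  by_cases hc : c = 0
  · simp [hc]
  have e : ∀ z, c * F z * G z = c * (F z * G z) := fun z => by ring
  simp only [e] at hint ⊢
  rw [integral_const_mul, h G hG hd ((integrable_const_mul_iff (IsUnit.mk0 c hc) _).1 hint),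
    mul_zero]

/-- The function `F` is a Hoeffding component for the set `T` of coordinates: it depends only on
those coordinates, and it is completely degenerate. -/
structure Pure (m : Measure Z) [IsProbabilityMeasure m] (T : Finset I) (F : (I → Z) → ℝ) :
    Prop where
  meas : Measurable F
  memLp : MemLp F 4 (piLaw m I)
  dep : DependsOn F (T : Set I)
  orth : ∀ i ∈ T, OrthAt m i F

theorem Pure.integral_mul_eq_zero {T : Finset I} {F G : (I → Z) → ℝ} (hF : Pure m T F)
    {i : I} (hi : i ∈ T) (hG : Measurable G) (hd : DependsOn G ({i}ᶜ : Set I)) :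
    ∫ z, F z * G z ∂(piLaw m I) = 0 := by
  by_cases h : Integrable (fun z => F z * G z) (piLaw m I)
  · exact hF.orth i hi G hG hd h
  -- The integral of a nonintegrable function is `0` by convention, which spares the users an
  -- integrability proof.
  · exact integral_undef h

theorem Pure.dep_compl {T : Finset I} {F : (I → Z) → ℝ} (hF : Pure m T F) {i : I} (hi : i ∉ T) :
    DependsOn F ({i}ᶜ : Set I) :=
  hF.dep.mono fun j hj => by
    rintro rfl
    exact hi (Finset.mem_coe.1 hj)

theorem Pure.const_mul {T : Finset I} {F : (I → Z) → ℝ} (hF : Pure m T F) (c : ℝ) :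
    Pure m T (fun z => c * F z) where
  meas := hF.meas.const_mul c
  memLp := hF.memLp.const_mul c
  dep := fun x y h => by simp only [hF.dep h]
  orth := fun i hi => (hF.orth i hi).const_mul c

/-- Completely degenerate functions of different sets of coordinates are orthogonal. -/
theorem Pure.integral_mul_of_ne {S T : Finset I} {F G : (I → Z) → ℝ} (hF : Pure m S F)
    (hG : Pure m T G) (h : S ≠ T) : ∫ z, F z * G z ∂(piLaw m I) = 0 := by
  by_cases hst : S ⊆ T
  · obtain ⟨i, hi, hi'⟩ : ∃ i ∈ T, i ∉ S := by
      by_contra hc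
      push Not at hc
      exact h (Finset.Subset.antisymm hst hc)
    simp only [mul_comm (F _)]
    exact hG.integral_mul_eq_zero hi hF.meas (hF.dep_compl hi')
  · obtain ⟨i, hi, hi'⟩ := Finset.not_subset.1 hst
    exact hF.integral_mul_eq_zero hi hG.meas (hG.dep_compl hi')

/-- The test function is taken in L⁴ because integrability of the whole sum against `G` would not
pass to the individual terms. `orthAt_of_bounded` later removes this restriction. -/
theorem OrthAt.sum {ι : Type*} {s : Finset ι} {F : ι → (I → Z) → ℝ} {i : I}
    (hF : ∀ j ∈ s, OrthAt m i (F j)) (hL : ∀ j ∈ s, MemLp (F j) 4 (piLaw m I))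
    {G : (I → Z) → ℝ} (hG : Measurable G) (hd : DependsOn G ({i}ᶜ : Set I))
    (hGL : MemLp G 4 (piLaw m I)) : ∫ z, (∑ j ∈ s, F j z) * G z ∂(piLaw m I) = 0 := by
  simp only [Finset.sum_mul]
  rw [integral_finsetSum _ fun j hj => integrable_mul_two (hL j hj) hGL]
  exact Finset.sum_eq_zero fun j hj => hF j hj G hG hd (integrable_mul_two (hL j hj) hGL)

end ProductSpace

/-! ### The Stein equation for half lines. -/

section SteinSolution

open Set Filter Topology

/-- The standard normal density. -/
noncomputable def npdf (x : ℝ) : ℝ := gaussianPDFReal 0 1 x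

/-- The standard normal distribution function. -/
noncomputable def ncdf (x : ℝ) : ℝ := cdf (gaussianReal 0 1) x

theorem npdf_eq (x : ℝ) : npdf x = (√(2 * Real.pi))⁻¹ * Real.exp (-(1 / 2) * x ^ 2) := by
  simp only [npdf, gaussianPDFReal]
  congr 2
  · simp
  · simp; ring

theorem npdf_pos (x : ℝ) : 0 < npdf x := gaussianPDFReal_pos 0 1 x one_ne_zero

theorem npdf_neg (x : ℝ) : npdf (-x) = npdf x := by simp [npdf_eq]

theorem hasDerivAt_npdf (x : ℝ) : HasDerivAt npdf (-x * npdf x) x := by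
  have h : HasDerivAt (fun x : ℝ => (√(2 * Real.pi))⁻¹ * Real.exp (-(1 / 2) * x ^ 2))
      (-x * npdf x) x := by
    have h1 : HasDerivAt (fun x : ℝ => -(1 / 2) * x ^ 2) (-x) x := by
      refine ((hasDerivAt_pow 2 x).const_mul (-(1 / 2 : ℝ))).congr_deriv ?_
      norm_num
      ring
    refine ((h1.exp).const_mul ((√(2 * Real.pi))⁻¹)).congr_deriv ?_
    rw [npdf_eq]; ring
  exact h.congr_of_eventuallyEq (Eventually.of_forall npdf_eq)

theorem continuous_npdf : Continuous npdf :=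
  continuous_iff_continuousAt.2 fun x => (hasDerivAt_npdf x).continuousAt

theorem integrable_npdf : Integrable npdf := integrable_gaussianPDFReal 0 1

theorem integrable_mul_npdf : Integrable fun x : ℝ => x * npdf x := by
  have := (integrable_mul_exp_neg_mul_sq (b := 1 / 2) (by norm_num)).const_mul
    ((√(2 * Real.pi))⁻¹)
  refine this.congr (Eventually.of_forall fun x => ?_)
  simp only [npdf_eq]; ring

theorem integrable_sq_mul_npdf : Integrable fun x : ℝ => x ^ 2 * npdf x := by
  have := (integrable_rpow_mul_exp_neg_mul_sq (b := 1 / 2) (by norm_num) (s := 2)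
    (by norm_num)).const_mul ((√(2 * Real.pi))⁻¹)
  refine this.congr (Eventually.of_forall fun x => ?_)
  simp only [npdf_eq, Real.rpow_two]; ring

theorem ncdf_eq_integral (x : ℝ) : ncdf x = ∫ t in Iic x, npdf t := by
  rw [ncdf, cdf_eq_real, Measure.real, gaussianReal_apply_eq_integral 0 one_ne_zero,
    ENNReal.toReal_ofReal]
  · rfl
  · exact setIntegral_nonneg measurableSet_Iic fun t _ => (npdf_pos t).le

theorem ncdf_nonneg (x : ℝ) : 0 ≤ ncdf x := cdf_nonneg _ _

theorem ncdf_le_one (x : ℝ) : ncdf x ≤ 1 := cdf_le_one _ _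

theorem ncdf_mono : Monotone ncdf := monotone_cdf _

theorem ncdf_neg (x : ℝ) : ncdf (-x) = 1 - ncdf x := by
  have h1 : ∫ t in Iic (-x), npdf t = ∫ t in Ioi x, npdf t := by
    rw [← integral_comp_neg_Ioi]
    simp [npdf_neg]
  have h2 : ∫ t, npdf t = 1 := integral_gaussianPDFReal_eq_one 0 one_ne_zero
  have h3 := intervalIntegral.integral_Iic_add_Ioi (b := x) integrable_npdf.integrableOn
    integrable_npdf.integrableOn
  rw [ncdf_eq_integral, ncdf_eq_integral, h1]
  linarith

theorem hasDerivAt_ncdf (x : ℝ) : HasDerivAt ncdf (npdf x) x := by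
  have h : ∀ y, ncdf y = ncdf 0 + ∫ t in (0 : ℝ)..y, npdf t := fun y => by
    rw [ncdf_eq_integral, ncdf_eq_integral,
      ← intervalIntegral.integral_Iic_sub_Iic integrable_npdf.integrableOn
        integrable_npdf.integrableOn]
    ring
  have := (intervalIntegral.integral_hasDerivAt_right
    (continuous_npdf.intervalIntegrable 0 x)
    continuous_npdf.aestronglyMeasurable.stronglyMeasurableAtFilter
    continuous_npdf.continuousAt).const_add (ncdf 0)
  exact this.congr_of_eventuallyEq (Eventually.of_forall h)

theorem tendsto_npdf_atBot : Tendsto npdf atBot (𝓝 0) := by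
  have h := (tendsto_rpow_abs_mul_exp_neg_mul_sq_cocompact (a := 1 / 2) (by norm_num) 0).mono_left
    atBot_le_cocompact
  have := h.const_mul ((√(2 * Real.pi))⁻¹)
  rw [mul_zero] at this
  refine this.congr fun x => ?_
  simp [npdf_eq]

theorem tendsto_mul_npdf_atBot : Tendsto (fun x => x * npdf x) atBot (𝓝 0) := by
  have h := (tendsto_rpow_abs_mul_exp_neg_mul_sq_cocompact (a := 1 / 2) (by norm_num) 1).mono_left
    atBot_le_cocompact
  have := h.const_mul ((√(2 * Real.pi))⁻¹)
  rw [mul_zero] at this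
  rw [tendsto_zero_iff_norm_tendsto_zero]
  refine this.congr fun x => ?_
  rw [norm_mul, Real.norm_eq_abs, Real.norm_of_nonneg (npdf_pos x).le, npdf_eq, Real.rpow_one]
  ring

theorem integral_Iic_mul_npdf (w : ℝ) : ∫ t in Iic w, t * npdf t = -npdf w := by
  have := integral_Iic_of_hasDerivAt_of_tendsto' (a := w) (f := fun t => -npdf t)
    (f' := fun t => t * npdf t) (m := 0) (fun x _ => by simpa using (hasDerivAt_npdf x).fun_neg)
    integrable_mul_npdf.integrableOn (by simpa using tendsto_npdf_atBot.neg)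
  simpa using this

theorem integral_Iic_sq_mul_npdf (w : ℝ) :
    ∫ t in Iic w, t ^ 2 * npdf t = ncdf w - w * npdf w := by
  have := integral_Iic_of_hasDerivAt_of_tendsto' (a := w) (f := fun t => -(t * npdf t))
    (f' := fun t => t ^ 2 * npdf t - npdf t) (m := 0) (fun x _ => by
      refine ((hasDerivAt_id' x).fun_mul (hasDerivAt_npdf x)).fun_neg.congr_deriv ?_
      ring)
    (integrable_sq_mul_npdf.sub integrable_npdf).integrableOn
    (by simpa using tendsto_mul_npdf_atBot.neg)
  rw [integral_sub integrable_sq_mul_npdf.integrableOn integrable_npdf.integrableOn,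
    ← ncdf_eq_integral] at this
  linarith

/-- This is the integral of `(w - t) φ(t)` over `t ≤ w`; it bounds `w * mills w` from below. -/
theorem mills_one (w : ℝ) : 0 ≤ w * ncdf w + npdf w := by
  have h : 0 ≤ ∫ t in Iic w, (w * npdf t - t * npdf t) :=
    setIntegral_nonneg measurableSet_Iic fun t ht => by
      rw [← sub_mul]; exact mul_nonneg (sub_nonneg.2 ht) (npdf_pos t).le
  rw [integral_sub (integrable_npdf.const_mul w).integrableOn integrable_mul_npdf.integrableOn,
    integral_const_mul, integral_Iic_mul_npdf, ← ncdf_eq_integral] at h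
  linarith

/-- This is the integral of `(t - w)² φ(t)` over `t ≤ w`; up to the factor `φ(w)` it is the
derivative of `w * mills w`. -/
theorem mills_two (w : ℝ) : 0 ≤ (1 + w ^ 2) * ncdf w + w * npdf w := by
  have h : 0 ≤ ∫ t in Iic w, (t ^ 2 * npdf t - 2 * w * (t * npdf t) + w ^ 2 * npdf t) :=
    setIntegral_nonneg measurableSet_Iic fun t ht => by
      nlinarith [mul_nonneg (sq_nonneg (t - w)) (npdf_pos t).le]
  have hi : Integrable (fun t => t ^ 2 * npdf t - 2 * w * (t * npdf t)) :=
    integrable_sq_mul_npdf.sub (integrable_mul_npdf.const_mul _)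
  rw [integral_add hi.integrableOn (integrable_npdf.const_mul _).integrableOn,
    integral_sub integrable_sq_mul_npdf.integrableOn
      (integrable_mul_npdf.const_mul _).integrableOn, integral_const_mul, integral_const_mul,
    integral_Iic_mul_npdf, integral_Iic_sq_mul_npdf, ← ncdf_eq_integral] at h
  linarith

/-- The inverse Mills ratio on the left tail, `Φ / φ`. -/
noncomputable def mills (w : ℝ) : ℝ := ncdf w / npdf w

theorem mills_nonneg (w : ℝ) : 0 ≤ mills w := div_nonneg (ncdf_nonneg w) (npdf_pos w).le

theorem hasDerivAt_mills (w : ℝ) : HasDerivAt mills (1 + w * mills w) w := by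
  refine ((hasDerivAt_ncdf w).fun_div (hasDerivAt_npdf w) (npdf_pos w).ne').congr_deriv ?_
  have := (npdf_pos w).ne'
  simp only [mills]
  field_simp
  ring

theorem neg_one_le_mul_mills (w : ℝ) : -1 ≤ w * mills w := by
  have h := npdf_pos w
  rw [mills, mul_div_assoc', le_div_iff₀ h]
  linarith [mills_one w]

theorem monotone_mul_mills : Monotone fun w => w * mills w := by
  have hd : ∀ w, HasDerivAt (fun w => w * mills w) (mills w + w * (1 + w * mills w)) w :=
    fun w => by
      simpa using (hasDerivAt_id' w).fun_mul (hasDerivAt_mills w)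
  refine monotone_of_deriv_nonneg (fun w => (hd w).differentiableAt) fun w => ?_
  rw [(hd w).deriv]
  have h := npdf_pos w
  have e : mills w + w * (1 + w * mills w) = ((1 + w ^ 2) * ncdf w + w * npdf w) / npdf w := by
    rw [mills]; field_simp; ring
  rw [e]
  exact div_nonneg (mills_two w) h.le

/-- With `w = z` this says that the two branches of the Stein solution agree at `z`. -/
theorem ncdf_mul_mills_neg (w : ℝ) : ncdf w * mills (-w) = (1 - ncdf w) * mills w := by
  rw [mills, mills, npdf_neg, ncdf_neg]; ring

/-- The solution of Stein's equation for the half line `(-∞, z]`. -/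
noncomputable def steinSol (z w : ℝ) : ℝ :=
  if w ≤ z then (1 - ncdf z) * mills w else ncdf z * mills (-w)

/-- Its derivative, as prescribed by Stein's equation. -/
noncomputable def steinDer (z w : ℝ) : ℝ :=
  w * steinSol z w + (if w ≤ z then 1 else 0) - ncdf z

/-- A monotone function which controls the increments of `steinDer z`. -/
noncomputable def steinMono (z w : ℝ) : ℝ :=
  w * steinSol z w - (if w ≤ z then 1 else 0)

theorem steinSol_of_ge {z w : ℝ} (h : z ≤ w) : steinSol z w = ncdf z * mills (-w) := by
  rcases h.eq_or_lt with rfl | h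
  · rw [steinSol, if_pos le_rfl, ncdf_mul_mills_neg]
  · rw [steinSol, if_neg (not_le.2 h)]

theorem monotone_mul_steinSol (z : ℝ) : Monotone fun w => w * steinSol z w := by
  have h1 : ∀ a b, a ≤ b → b ≤ z → a * steinSol z a ≤ b * steinSol z b := fun a b hab hb => by
    rw [steinSol, steinSol, if_pos hb, if_pos (hab.trans hb)]
    have := mul_le_mul_of_nonneg_left (monotone_mul_mills hab) (sub_nonneg.2 (ncdf_le_one z))
    simp only at this
    linarith
  have h2 : ∀ a b, a ≤ b → z ≤ a → a * steinSol z a ≤ b * steinSol z b := fun a b hab ha => by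
    rw [steinSol_of_ge ha, steinSol_of_ge (ha.trans hab)]
    have := mul_le_mul_of_nonneg_left (monotone_mul_mills (neg_le_neg hab)) (ncdf_nonneg z)
    simp only at this
    linarith
  intro a b hab
  rcases le_total b z with hb | hb
  · exact h1 a b hab hb
  rcases le_total a z with ha | ha
  · exact (h1 a z ha le_rfl).trans (h2 z b hb le_rfl)
  · exact h2 a b hab ha

/-- By the reflection `(z, w) ↦ (-z, -w)` only the left branch matters. For `w ≥ 0` there,
monotonicity of the distribution function replaces `1 - ncdf z` by `1 - ncdf w`, and the Mills bound
applies at `-w`. -/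
theorem abs_mul_steinSol_le (z w : ℝ) : |w * steinSol z w| ≤ 1 := by
  have key : ∀ a b : ℝ, a ≤ b → |a * ((1 - ncdf b) * mills a)| ≤ 1 := fun a b hab => by
    have hb0 := sub_nonneg.2 (ncdf_le_one b)
    have hb1 : 1 - ncdf b ≤ 1 := by linarith [ncdf_nonneg b]
    rw [abs_le]
    constructor
    · have := neg_one_le_mul_mills a
      nlinarith
    · rcases le_total a 0 with ha | ha
      · have := mul_nonneg hb0 (mills_nonneg a)
        nlinarith
      · have h1 : (1 - ncdf b) * mills a ≤ (1 - ncdf a) * mills a :=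
          mul_le_mul_of_nonneg_right (by linarith [ncdf_mono hab]) (mills_nonneg a)
        rw [← ncdf_mul_mills_neg] at h1
        have h2 := neg_one_le_mul_mills (-a)
        have h3 := mul_le_mul_of_nonneg_left h1 ha
        have h4 : a * mills (-a) ≤ 1 := by linarith
        have h5 := ncdf_nonneg a
        have h6 := ncdf_le_one a
        nlinarith
  rcases le_or_gt w z with h | h
  · rw [steinSol, if_pos h]; exact key w z h
  · rw [steinSol, if_neg (not_le.2 h)]
    have := key (-w) (-z) (neg_le_neg h.le)
    rw [ncdf_neg] at this
    rw [← abs_neg]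
    convert this using 2
    ring

theorem abs_steinDer_le (z w : ℝ) : |steinDer z w| ≤ 2 := by
  have h1 := abs_le.1 (abs_mul_steinSol_le z w)
  have h2 := ncdf_nonneg z
  have h3 := ncdf_le_one z
  rw [steinDer, abs_le]
  split_ifs <;> constructor <;> linarith

theorem abs_steinMono_le (z w : ℝ) : |steinMono z w| ≤ 2 := by
  have h1 := abs_le.1 (abs_mul_steinSol_le z w)
  rw [steinMono, abs_le]
  split_ifs <;> constructor <;> linarith

theorem monotone_steinMono (z : ℝ) : Monotone (steinMono z) := by
  intro a b hab
  have h := monotone_mul_steinSol z hab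
  simp only at h
  have h2 : (if b ≤ z then (1 : ℝ) else 0) ≤ if a ≤ z then 1 else 0 := by
    split_ifs <;> linarith
  simp only [steinMono]
  linarith

theorem continuous_steinSol (z : ℝ) : Continuous (steinSol z) := by
  have hm : Continuous mills :=
    continuous_iff_continuousAt.2 fun x => (hasDerivAt_mills x).continuousAt
  refine Continuous.if_le (by fun_prop) (by fun_prop) continuous_id continuous_const ?_
  rintro x rfl
  exact (ncdf_mul_mills_neg x).symm

theorem hasDerivAt_steinSol {z w : ℝ} (h : w ≠ z) : HasDerivAt (steinSol z) (steinDer z w) w := by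
  rcases lt_or_gt_of_ne h with h | h
  · have h1 := (hasDerivAt_mills w).const_mul (1 - ncdf z)
    refine (h1.congr_of_eventuallyEq ?_).congr_deriv ?_
    · filter_upwards [Iio_mem_nhds h] with x hx
      rw [steinSol, if_pos hx.le]
    · rw [steinDer, steinSol, if_pos h.le, if_pos h.le]; ring
  · have h1 := (((hasDerivAt_mills (-w)).comp w (hasDerivAt_neg w))).const_mul (ncdf z)
    refine (h1.congr_of_eventuallyEq ?_).congr_deriv ?_
    · filter_upwards [Ioi_mem_nhds h] with x hx
      rw [steinSol, if_neg (not_le.2 hx)]; rfl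
    · rw [steinDer, steinSol, if_neg (not_le.2 h), if_neg (not_le.2 h)]; ring

theorem measurable_steinDer (z : ℝ) : Measurable (steinDer z) := by
  refine ((measurable_id.mul (continuous_steinSol z).measurable).add ?_).sub_const _
  exact Measurable.ite measurableSet_Iic measurable_const measurable_const

theorem measurable_steinMono (z : ℝ) : Measurable (steinMono z) :=
  (monotone_steinMono z).measurable

/-- Only integrability needs this bound, so its value is immaterial: compactness on `[-1, 1]`, and
the bound on `w * steinSol z w` elsewhere. -/
theorem exists_abs_steinSol_le (z : ℝ) : ∃ B, ∀ w, |steinSol z w| ≤ B := by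
  obtain ⟨B, hB⟩ := (isCompact_Icc (a := (-1 : ℝ)) (b := 1)).exists_bound_of_continuousOn
    (continuous_steinSol z).continuousOn
  refine ⟨max B 1, fun w => ?_⟩
  by_cases hw : |w| ≤ 1
  · exact (hB w (abs_le.1 hw)).trans (le_max_left _ _)
  · have h := abs_mul_steinSol_le z w
    rw [abs_mul] at h
    push Not at hw
    exact (by nlinarith [abs_nonneg (steinSol z w)] : |steinSol z w| ≤ 1).trans (le_max_right _ _)

/-- The error in the first order expansion of the Stein solution. -/
theorem abs_steinSol_sub_le (z a b : ℝ) :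
    |steinSol z a - steinSol z b - (a - b) * steinDer z a| ≤
      (a - b) * (steinMono z a - steinMono z b) := by
  have hmono : Monotone fun w => (if w ≤ z then (0 : ℝ) else 1) := by
    intro x y hxy
    simp only
    split_ifs <;> linarith
  have hder : ∀ t, steinDer z t =
      (fun w => w * steinSol z w) t - (if t ≤ z then (0 : ℝ) else 1) + (1 - ncdf z) := fun t => by
    simp only [steinDer]; split_ifs <;> ring
  have hint : ∀ x y, IntervalIntegrable (steinDer z) volume x y := fun x y => by
    rw [show steinDer z = _ from funext hder]
    exact ((monotone_mul_steinSol z).intervalIntegrable.sub hmono.intervalIntegrable).add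
      intervalIntegrable_const
  -- The solution has a corner at `z`; the fundamental theorem tolerates a countable exceptional
  -- set.
  have hftc : ∫ t in b..a, steinDer z t = steinSol z a - steinSol z b :=
    integral_eq_of_hasDerivAt_off_countable _ _ (countable_singleton z)
      (continuous_steinSol z).continuousOn (fun x hx => hasDerivAt_steinSol hx.2) (hint b a)
  have e : steinSol z a - steinSol z b - (a - b) * steinDer z a =
      ∫ t in b..a, (steinDer z t - steinDer z a) := by
    rw [intervalIntegral.integral_sub (hint b a) intervalIntegrable_const, hftc,
      intervalIntegral.integral_const, smul_eq_mul]
  -- Up to constants, `steinDer` is the difference and `steinMono` the sum of the same two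
  -- increasing functions, so increments of the sum dominate those of the difference.
  have hinc : ∀ s t, s ≤ t → |steinDer z t - steinDer z s| ≤ steinMono z t - steinMono z s := by
    intro s t hst
    have h1 := monotone_mul_steinSol z hst
    have h2 := hmono hst
    have h3 : ∀ t, steinMono z t =
      (fun w => w * steinSol z w) t + (if t ≤ z then (0 : ℝ) else 1) - 1 := fun t => by
      simp only [steinMono]; split_ifs <;> ring
    rw [hder, hder, h3, h3, abs_le]
    simp only at h1 h2 ⊢
    constructor <;> linarith
  have hb : ∀ t ∈ uIoc b a, ‖steinDer z t - steinDer z a‖ ≤ |steinMono z a - steinMono z b| := by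
    intro t ht
    rcases le_total b a with hba | hba
    · rw [uIoc_of_le hba] at ht
      rw [Real.norm_eq_abs, abs_sub_comm, abs_of_nonneg (sub_nonneg.2 (monotone_steinMono z hba))]
      linarith [hinc t a ht.2, monotone_steinMono z ht.1.le]
    · rw [uIoc_of_ge hba] at ht
      rw [Real.norm_eq_abs, abs_of_nonpos (sub_nonpos.2 (monotone_steinMono z hba))]
      linarith [hinc a t ht.1.le, monotone_steinMono z ht.2]
  rw [e]
  refine (intervalIntegral.norm_integral_le_of_norm_le_const hb).trans (le_of_eq ?_)
  rw [← abs_mul, abs_of_nonneg, mul_comm]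
  rcases le_total b a with hba | hba
  · exact mul_nonneg (sub_nonneg.2 (monotone_steinMono z hba)) (sub_nonneg.2 hba)
  · exact mul_nonneg_of_nonpos_of_nonpos (sub_nonpos.2 (monotone_steinMono z hba))
      (sub_nonpos.2 hba)

end SteinSolution

/-! ### Stein's method by resampling single coordinates. -/

section SteinBound

variable {I Z : Type*} [Fintype I] [DecidableEq I] [MeasurableSpace Z]
  {m : Measure Z} [IsProbabilityMeasure m]

theorem measurable_resample (i : I) : Measurable (resample (Z := Z) i) := by
  refine measurable_pi_lambda _ fun j => ?_
  by_cases h : j = i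
  · subst h
    simp only [resample, Function.update_self]
    fun_prop
  · simp only [resample, Function.update_of_ne h]
    fun_prop

theorem dependsOn_resample (i : I) (F : (I → Z) → ℝ) (z' : I → Z) :
    DependsOn (fun z => F (resample i (z, z'))) ({i}ᶜ : Set I) := by
  intro x y h
  have : resample i (x, z') = resample i (y, z') := by
    ext j
    by_cases hj : j = i
    · subst hj; simp [resample]
    · simp [resample, hj, h j hj]
  simp only [this]

/-- By Fubini: with the second copy frozen, `K` is an admissible test function. -/
theorem OrthAt.integral_prod_eq_zero {i : I} {F : (I → Z) → ℝ} (hF : OrthAt m i F)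
    {K : (I → Z) × (I → Z) → ℝ} (hK : Measurable K)
    (hd : ∀ z', DependsOn (fun z => K (z, z')) ({i}ᶜ : Set I))
    (hint : Integrable (fun p : (I → Z) × (I → Z) => F p.1 * K p)
      ((piLaw m I).prod (piLaw m I))) :
    ∫ p, F p.1 * K p ∂((piLaw m I).prod (piLaw m I)) = 0 := by
  rw [integral_prod_symm _ hint]
  refine integral_eq_zero_of_ae (Filter.Eventually.of_forall fun z' => ?_)
  by_cases h : Integrable (fun z => F z * K (z, z')) (piLaw m I)
  · exact hF _ (hK.comp (by fun_prop)) (hd z') h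
  · exact integral_undef h

theorem MemLp.fst_prod {F : (I → Z) → ℝ} (hF : MemLp F 4 (piLaw m I)) :
    MemLp (fun p : (I → Z) × (I → Z) => F p.1) 4 ((piLaw m I).prod (piLaw m I)) :=
  hF.comp_measurePreserving measurePreserving_fst

theorem MemLp.resample_prod {F : (I → Z) → ℝ} (hF : MemLp F 4 (piLaw m I)) (i : I) :
    MemLp (fun p => F (resample i p)) 4 ((piLaw m I).prod (piLaw m I)) :=
  hF.comp_measurePreserving (measurePreserving_resample m i)

/-- The integrand `(|h| + |h'|) (u - u')`, where the prime stands for resampling the coordinate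
`i`. -/
def antisymm (i : I) (h u : (I → Z) → ℝ) (p : (I → Z) × (I → Z)) : ℝ :=
  (|h p.1| + |h (resample i p)|) * (u p.1 - u (resample i p))

/-- The conditional mean of `(|h| + |h'|) (u - u')`. -/
noncomputable def antisymmMean (m : Measure Z) (i : I) (h u : (I → Z) → ℝ) (z : I → Z) : ℝ :=
  ∫ z', antisymm i h u (z, z') ∂(piLaw m I)

theorem antisymm_swapAt (i : I) (h u : (I → Z) → ℝ) (p : (I → Z) × (I → Z)) :
    antisymm i h u (swapAt i p) = -antisymm i h u p := by
  simp only [antisymm, resample_swapAt]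
  simp only [swapAt]
  ring

theorem measurable_antisymm (i : I) {h u : (I → Z) → ℝ} (hh : Measurable h) (hu : Measurable u) :
    Measurable (antisymm i h u) := by
  have := measurable_resample (Z := Z) i
  unfold antisymm
  exact ((hh.comp measurable_fst).abs.add (hh.comp this).abs).mul
    ((hu.comp measurable_fst).sub (hu.comp this))

theorem measurable_antisymmMean (i : I) {h u : (I → Z) → ℝ} (hh : Measurable h)
    (hu : Measurable u) : Measurable (antisymmMean m i h u) :=
  ((measurable_antisymm i hh hu).stronglyMeasurable.integral_prod_right').measurable

theorem integrable_antisymm_mul (i : I) {h u : (I → Z) → ℝ} (hh : MemLp h 4 (piLaw m I))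
    (hu : MemLp u 4 (piLaw m I)) {K L : (I → Z) × (I → Z) → ℝ}
    (hK : MemLp K 4 ((piLaw m I).prod (piLaw m I)))
    (hL : MemLp L 4 ((piLaw m I).prod (piLaw m I))) :
    Integrable (fun p => antisymm i h u p * K p * L p) ((piLaw m I).prod (piLaw m I)) :=
  integrable_mul_four ((memLp_four_abs (MemLp.fst_prod hh)).add
    (memLp_four_abs (MemLp.resample_prod hh i)))
    ((MemLp.fst_prod hu).sub (MemLp.resample_prod hu i)) hK hL

theorem integrable_antisymm_mul_fst (i : I) {h u g : (I → Z) → ℝ} (hh : MemLp h 4 (piLaw m I))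
    (hu : MemLp u 4 (piLaw m I)) (hg : MemLp g 4 (piLaw m I)) :
    Integrable (fun p => antisymm i h u p * g p.1) ((piLaw m I).prod (piLaw m I)) := by
  simpa using integrable_antisymm_mul i hh hu (MemLp.fst_prod hg) (memLp_const (1 : ℝ))

theorem integrable_antisymm (i : I) {h u : (I → Z) → ℝ} (hh : MemLp h 4 (piLaw m I))
    (hu : MemLp u 4 (piLaw m I)) :
    Integrable (antisymm i h u) ((piLaw m I).prod (piLaw m I)) := by
  simpa using integrable_antisymm_mul_fst i hh hu (memLp_const (1 : ℝ))

theorem integral_antisymm_mul (i : I) {h u g : (I → Z) → ℝ} (hh : MemLp h 4 (piLaw m I))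
    (hu : MemLp u 4 (piLaw m I)) (hg : MemLp g 4 (piLaw m I)) :
    ∫ p, antisymm i h u p * g p.1 ∂((piLaw m I).prod (piLaw m I)) =
      ∫ z, antisymmMean m i h u z * g z ∂(piLaw m I) := by
  rw [integral_prod _ (integrable_antisymm_mul_fst i hh hu hg)]
  simp only [integral_mul_const, antisymmMean]

/-- Write a prime for resampling `i`. The mean of `h S(W')` vanishes because `h` is orthogonal to
what is free of `i`; the mean of `S'(W) h u'` vanishes for the same reason for `u`, once the copies
are exchanged. Subtracting both leaves `h` times the first order Taylor error of `S`, which is at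
most `|h| (u - u') (G(W) - G(W'))` with `G = steinMono t`. Exchanging the copies in the part with
`G(W')` turns this into `(|h| + |h'|) (u - u') G(W)`. -/
theorem integral_stein_term_le (t : ℝ) (i : I) {h u W : (I → Z) → ℝ} (hh : Measurable h)
    (hu : Measurable u) (hW : Measurable W) (hhL : MemLp h 4 (piLaw m I))
    (huL : MemLp u 4 (piLaw m I)) (hho : OrthAt m i h) (huo : OrthAt m i u)
    (hWu : DependsOn (fun z => W z - u z) ({i}ᶜ : Set I)) :
    |∫ z, h z * steinSol t (W z) ∂(piLaw m I) - ∫ z, steinDer t (W z) * (h z * u z) ∂(piLaw m I)|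
      ≤ ∫ z, antisymmMean m i h u z * steinMono t (W z) ∂(piLaw m I) := by
  have hr := measurable_resample (Z := Z) i
  obtain ⟨B, hB⟩ := exists_abs_steinSol_le t
  have mS : Measurable fun z => steinSol t (W z) := (continuous_steinSol t).measurable.comp hW
  have mD : Measurable fun z => steinDer t (W z) := (measurable_steinDer t).comp hW
  have mG : Measurable fun z => steinMono t (W z) := (measurable_steinMono t).comp hW
  have lS : MemLp (fun z => steinSol t (W z)) 4 (piLaw m I) :=
    memLp_four_of_bound mS B fun z => hB _
  have lD : MemLp (fun z => steinDer t (W z)) 4 (piLaw m I) :=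
    memLp_four_of_bound mD 2 fun z => abs_steinDer_le _ _
  have lG : MemLp (fun z => steinMono t (W z)) 4 (piLaw m I) :=
    memLp_four_of_bound mG 2 fun z => abs_steinMono_le _ _
  set PP := (piLaw m I).prod (piLaw m I) with hPP
  have one : MemLp (fun _ : (I → Z) × (I → Z) => (1 : ℝ)) 4 PP := memLp_const _
  have h1 := MemLp.fst_prod hhL
  have h2 := MemLp.resample_prod hhL i
  have u1 := MemLp.fst_prod huL
  have u2 := MemLp.resample_prod huL i
  have S1 := MemLp.fst_prod lS
  have S2 := MemLp.resample_prod lS i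
  have D1 := MemLp.fst_prod lD
  have D2 := MemLp.resample_prod lD i
  have G1 := MemLp.fst_prod lG
  have G2 := MemLp.resample_prod lG i
  have hWdiff : ∀ p, W p.1 - W (resample i p) = u p.1 - u (resample i p) := fun p => by
    have : W p.1 - u p.1 = W (resample i p) - u (resample i p) := hWu fun j hj => by
      have hj : j ≠ i := hj
      simp [resample, hj]
    linarith
  have eA : ∫ z, h z * steinSol t (W z) ∂(piLaw m I) =
      ∫ p, h p.1 * steinSol t (W p.1) ∂PP :=
    (integral_comp_measurePreserving (g := Prod.fst) (measurePreserving_fst (ν := piLaw m I))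
      (F := fun z => h z * steinSol t (W z)) (hh.mul mS).aestronglyMeasurable).symm
  have eC : ∫ z, steinDer t (W z) * (h z * u z) ∂(piLaw m I) =
      ∫ p, steinDer t (W p.1) * (h p.1 * u p.1) ∂PP :=
    (integral_comp_measurePreserving (g := Prod.fst) (measurePreserving_fst (ν := piLaw m I))
      (F := fun z => steinDer t (W z) * (h z * u z))
      (mD.mul (hh.mul hu)).aestronglyMeasurable).symm
  have iB : Integrable (fun p => h p.1 * steinSol t (W (resample i p))) PP :=
    integrable_mul_two h1 S2
  have eB : ∫ p, h p.1 * steinSol t (W (resample i p)) ∂PP = 0 :=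
    hho.integral_prod_eq_zero (mS.comp hr)
      (fun z' => dependsOn_resample i (fun z => steinSol t (W z)) z') iB
  have iE : Integrable (fun p => u p.1 * (h (resample i p) * steinDer t (W (resample i p)))) PP := by
    refine (integrable_mul_four u1 h2 D2 one).congr (Filter.Eventually.of_forall fun p => ?_)
    ring
  have eE : ∫ p, steinDer t (W p.1) * (h p.1 * u (resample i p)) ∂PP = 0 := by
    rw [← integral_swapAt m i (F := fun p => steinDer t (W p.1) * (h p.1 * u (resample i p)))
      ((mD.comp measurable_fst).mul ((hh.comp measurable_fst).mul (hu.comp hr)))]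
    have := huo.integral_prod_eq_zero
      (K := fun p => h (resample i p) * steinDer t (W (resample i p)))
      ((hh.comp hr).mul (mD.comp hr))
      (fun z' => dependsOn_resample i (fun z => h z * steinDer t (W z)) z') iE
    rw [← this]
    refine integral_congr_ae (Filter.Eventually.of_forall fun p => ?_)
    simp only [resample_swapAt]
    simp only [swapAt]
    ring
  have iA : Integrable (fun p : (I → Z) × (I → Z) => h p.1 * steinSol t (W p.1)) PP :=
    integrable_mul_two h1 S1
  have iC : Integrable (fun p : (I → Z) × (I → Z) => steinDer t (W p.1) * (h p.1 * u p.1)) PP :=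
    (integrable_mul_four D1 h1 u1 one).congr (Filter.Eventually.of_forall fun p => by
      ring)
  have iE' : Integrable (fun p => steinDer t (W p.1) * (h p.1 * u (resample i p))) PP :=
    (integrable_mul_four D1 h1 u2 one).congr (Filter.Eventually.of_forall fun p => by
      ring)
  have iG1 : Integrable (fun p => |h p.1| * (u p.1 - u (resample i p)) * steinMono t (W p.1)) PP :=
    (integrable_mul_four (memLp_four_abs h1) (u1.sub u2) G1 one).congr
      (Filter.Eventually.of_forall fun p => by simp)
  have iG2 : Integrable
      (fun p => |h p.1| * (u p.1 - u (resample i p)) * steinMono t (W (resample i p))) PP :=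
    (integrable_mul_four (memLp_four_abs h1) (u1.sub u2) G2 one).congr
      (Filter.Eventually.of_forall fun p => by simp)
  have iG3 : Integrable
      (fun p => |h (resample i p)| * (u p.1 - u (resample i p)) * steinMono t (W p.1)) PP :=
    (integrable_mul_four (memLp_four_abs h2) (u1.sub u2) G1 one).congr
      (Filter.Eventually.of_forall fun p => by simp)
  have eG : ∫ p, |h p.1| * (u p.1 - u (resample i p)) * steinMono t (W (resample i p)) ∂PP =
      -∫ p, |h (resample i p)| * (u p.1 - u (resample i p)) * steinMono t (W p.1) ∂PP := by
    rw [← integral_swapAt m i (F := fun p =>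
        |h p.1| * (u p.1 - u (resample i p)) * steinMono t (W (resample i p)))
      (((hh.comp measurable_fst).abs.mul ((hu.comp measurable_fst).sub (hu.comp hr))).mul
        (mG.comp hr)), ← integral_neg]
    refine integral_congr_ae (Filter.Eventually.of_forall fun p => ?_)
    simp only [resample_swapAt]
    simp only [swapAt]
    ring
  have eF : ∫ p, (|h p.1| * (u p.1 - u (resample i p)) * steinMono t (W p.1) -
      |h p.1| * (u p.1 - u (resample i p)) * steinMono t (W (resample i p))) ∂PP =
      ∫ z, antisymmMean m i h u z * steinMono t (W z) ∂(piLaw m I) := by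
    rw [integral_sub iG1 iG2, eG, sub_neg_eq_add, ← integral_add iG1 iG3,
      ← integral_antisymm_mul i hhL huL lG]
    refine integral_congr_ae (Filter.Eventually.of_forall fun p => ?_)
    simp only [antisymm]
    ring
  have eL : ∫ z, h z * steinSol t (W z) ∂(piLaw m I) -
      ∫ z, steinDer t (W z) * (h z * u z) ∂(piLaw m I) =
      ∫ p, ((h p.1 * steinSol t (W p.1) - h p.1 * steinSol t (W (resample i p))) -
        (steinDer t (W p.1) * (h p.1 * u p.1) -
          steinDer t (W p.1) * (h p.1 * u (resample i p)))) ∂PP := by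
    have i1 : Integrable (fun p : (I → Z) × (I → Z) =>
      h p.1 * steinSol t (W p.1) - h p.1 * steinSol t (W (resample i p))) PP := iA.sub iB
    have i2 : Integrable (fun p : (I → Z) × (I → Z) => steinDer t (W p.1) * (h p.1 * u p.1) -
      steinDer t (W p.1) * (h p.1 * u (resample i p))) PP := iC.sub iE'
    rw [integral_sub i1 i2, integral_sub iA iB, integral_sub iC iE', eA, eC, eB,
      eE, sub_zero, sub_zero]
  rw [eL, ← eF]
  refine (abs_integral_le_integral_abs).trans (integral_mono_of_nonneg
    (Filter.Eventually.of_forall fun p => abs_nonneg _) (iG1.sub iG2)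
    (Filter.Eventually.of_forall fun p => ?_))
  have key := abs_steinSol_sub_le t (W p.1) (W (resample i p))
  rw [hWdiff] at key
  have := mul_le_mul_of_nonneg_left key (abs_nonneg (h p.1))
  rw [← abs_mul] at this
  simp only
  refine (le_of_eq ?_).trans (this.trans (le_of_eq ?_))
  · congr 1; ring
  · ring

/-- A Berry–Esseen bound from Stein's method: `h i` and `u i` are orthogonal to the functions not
depending on the coordinate `i`, the `h i` sum up to `W`, and `u i` is the part of `W` depending on
the coordinate `i`. -/
theorem abs_sub_ncdf_le (t : ℝ) {h u : I → (I → Z) → ℝ} {W : (I → Z) → ℝ}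
    (hh : ∀ i, Measurable (h i)) (hu : ∀ i, Measurable (u i))
    (hhL : ∀ i, MemLp (h i) 4 (piLaw m I)) (huL : ∀ i, MemLp (u i) 4 (piLaw m I))
    (hho : ∀ i, OrthAt m i (h i)) (huo : ∀ i, OrthAt m i (u i))
    (hW : ∀ z, W z = ∑ i, h i z)
    (hWu : ∀ i, DependsOn (fun z => W z - u i z) ({i}ᶜ : Set I)) :
    |(piLaw m I).real {z | W z ≤ t} - ncdf t| ≤
      2 * ∫ z, |1 - ∑ i, h i z * u i z| ∂(piLaw m I) +
      2 * ∫ z, |∑ i, antisymmMean m i (h i) (u i) z| ∂(piLaw m I) := by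
  have mW : Measurable W := by
    rw [show W = fun z => ∑ i, h i z from funext hW]
    exact Finset.measurable_sum _ fun i _ => hh i
  obtain ⟨B, hB⟩ := exists_abs_steinSol_le t
  have mS : Measurable fun z => steinSol t (W z) := (continuous_steinSol t).measurable.comp mW
  have mD : Measurable fun z => steinDer t (W z) := (measurable_steinDer t).comp mW
  have mG : Measurable fun z => steinMono t (W z) := (measurable_steinMono t).comp mW
  have lS : MemLp (fun z => steinSol t (W z)) 4 (piLaw m I) :=
    memLp_four_of_bound mS B fun z => hB _
  have lD : MemLp (fun z => steinDer t (W z)) 4 (piLaw m I) :=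
    memLp_four_of_bound mD 2 fun z => abs_steinDer_le _ _
  have lG : MemLp (fun z => steinMono t (W z)) 4 (piLaw m I) :=
    memLp_four_of_bound mG 2 fun z => abs_steinMono_le _ _
  have one : MemLp (fun _ : I → Z => (1 : ℝ)) 4 (piLaw m I) := memLp_const _
  have ihS : ∀ i, Integrable (fun z => h i z * steinSol t (W z)) (piLaw m I) :=
    fun i => integrable_mul_two (hhL i) lS
  have iD : Integrable (fun z => steinDer t (W z)) (piLaw m I) := by
    simpa using integrable_mul_two lD one
  have ihuD : ∀ i, Integrable (fun z => steinDer t (W z) * (h i z * u i z)) (piLaw m I) :=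
    fun i => (integrable_mul_four lD (hhL i) (huL i) one).congr
      (Filter.Eventually.of_forall fun p => by ring)
  have ihu : Integrable (fun z => ∑ i, h i z * u i z) (piLaw m I) :=
    integrable_finsetSum _ fun i _ => integrable_mul_two (hhL i) (huL i)
  have iEta : ∀ i, Integrable (antisymmMean m i (h i) (u i)) (piLaw m I) := fun i =>
    (integrable_antisymm i (hhL i) (huL i)).integral_prod_left
  have iEtaG : ∀ i, Integrable (fun z => antisymmMean m i (h i) (u i) z * steinMono t (W z))
      (piLaw m I) := fun i =>
    (iEta i).mul_bdd (c := 2) mG.aestronglyMeasurable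
      (Filter.Eventually.of_forall fun z => abs_steinMono_le _ _)
  -- the left hand side through Stein's equation
  have e1 : (piLaw m I).real {z | W z ≤ t} - ncdf t =
      ∫ z, (steinDer t (W z) - W z * steinSol t (W z)) ∂(piLaw m I) := by
    have hms : MeasurableSet {z | W z ≤ t} := measurableSet_le mW measurable_const
    have : ∀ z, steinDer t (W z) - W z * steinSol t (W z) =
        {z | W z ≤ t}.indicator (fun _ => (1 : ℝ)) z - ncdf t := fun z => by
      simp only [steinDer, Set.indicator, Set.mem_ofPred_eq]
      ring
    simp only [this]
    rw [integral_sub ((integrable_const _).indicator hms) (integrable_const _),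
      integral_indicator_const _ hms]
    simp
  have e2 : ∫ z, (steinDer t (W z) - W z * steinSol t (W z)) ∂(piLaw m I) =
      ∫ z, steinDer t (W z) * (1 - ∑ i, h i z * u i z) ∂(piLaw m I) +
      ∑ i, (∫ z, steinDer t (W z) * (h i z * u i z) ∂(piLaw m I) -
        ∫ z, h i z * steinSol t (W z) ∂(piLaw m I)) := by
    have a1 : ∫ z, W z * steinSol t (W z) ∂(piLaw m I) =
        ∑ i, ∫ z, h i z * steinSol t (W z) ∂(piLaw m I) := by
      rw [← integral_finsetSum _ fun i _ => ihS i]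
      refine integral_congr_ae (Filter.Eventually.of_forall fun z => ?_)
      simp only
      rw [hW z, Finset.sum_mul]
    have a2 : ∫ z, steinDer t (W z) * (1 - ∑ i, h i z * u i z) ∂(piLaw m I) =
        ∫ z, steinDer t (W z) ∂(piLaw m I) -
        ∑ i, ∫ z, steinDer t (W z) * (h i z * u i z) ∂(piLaw m I) := by
      rw [← integral_finsetSum _ fun i _ => ihuD i, ← integral_sub iD
        (integrable_finsetSum _ fun i _ => ihuD i)]
      refine integral_congr_ae (Filter.Eventually.of_forall fun z => ?_)
      simp only [mul_sub, mul_one, Finset.mul_sum]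
    have iWS : Integrable (fun z => W z * steinSol t (W z)) (piLaw m I) := by
      refine (integrable_finsetSum Finset.univ fun i _ => ihS i).congr
        (Filter.Eventually.of_forall fun z => ?_)
      simp only
      rw [hW z, Finset.sum_mul]
    rw [integral_sub iD iWS, a1, a2, Finset.sum_sub_distrib]
    ring
  rw [e1, e2]
  refine (abs_add_le _ _).trans (add_le_add ?_ ?_)
  · rw [← integral_const_mul]
    refine (abs_integral_le_integral_abs).trans (integral_mono_of_nonneg
      (Filter.Eventually.of_forall fun p => abs_nonneg _)
      (((integrable_const _).sub ihu).abs.const_mul 2) (Filter.Eventually.of_forall fun z => ?_))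
    simp only [abs_mul]
    exact mul_le_mul_of_nonneg_right (abs_steinDer_le _ _) (abs_nonneg _)
  · calc _ ≤ ∑ i, ∫ z, antisymmMean m i (h i) (u i) z * steinMono t (W z) ∂(piLaw m I) := by
          refine (Finset.abs_sum_le_sum_abs _ _).trans (Finset.sum_le_sum fun i _ => ?_)
          rw [abs_sub_comm]
          exact integral_stein_term_le t i (hh i) (hu i) mW (hhL i) (huL i) (hho i) (huo i) (hWu i)
      _ = ∫ z, (∑ i, antisymmMean m i (h i) (u i) z) * steinMono t (W z) ∂(piLaw m I) := by
          rw [← integral_finsetSum _ fun i _ => iEtaG i]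
          simp only [Finset.sum_mul]
      _ ≤ _ := by
          rw [← integral_const_mul]
          refine (le_abs_self _).trans ((abs_integral_le_integral_abs).trans
            (integral_mono_of_nonneg (Filter.Eventually.of_forall fun p => abs_nonneg _)
            ((integrable_finsetSum Finset.univ fun i _ => iEta i).abs.const_mul 2)
            (Filter.Eventually.of_forall fun z => ?_)))
          simp only [abs_mul]
          rw [mul_comm]
          exact mul_le_mul_of_nonneg_right (abs_steinMono_le _ _) (abs_nonneg _)

end SteinBound

/-! ### Squared L⁴ norms and moment inequalities. -/

section Norms

variable {α : Type*} [MeasurableSpace α] {μ : Measure α}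

/-- The square of the `L⁴` norm. -/
noncomputable def sqNorm4 (μ : Measure α) (F : α → ℝ) : ℝ := √(∫ a, F a ^ 4 ∂μ)

theorem sqNorm4_nonneg (F : α → ℝ) : 0 ≤ sqNorm4 μ F := Real.sqrt_nonneg _

theorem sq_sqNorm4 (F : α → ℝ) : sqNorm4 μ F ^ 2 = ∫ a, F a ^ 4 ∂μ :=
  Real.sq_sqrt (integral_nonneg fun a => by positivity)

theorem sqNorm4_const_mul (c : ℝ) (F : α → ℝ) :
    sqNorm4 μ (fun a => c * F a) = c ^ 2 * sqNorm4 μ F := by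
  simp only [sqNorm4, mul_pow, integral_const_mul]
  rw [Real.sqrt_mul (by positivity), show c ^ 4 = (c ^ 2) ^ 2 by ring,
    Real.sqrt_sq (sq_nonneg c)]

theorem integral_sq_mul_sq_le {F G : α → ℝ} (hF : MemLp F 4 μ) (hG : MemLp G 4 μ) :
    ∫ a, F a ^ 2 * G a ^ 2 ∂μ ≤ sqNorm4 μ F * sqNorm4 μ G := by
  have h2 : ∀ {K : α → ℝ}, MemLp K 4 μ → MemLp (fun a => K a ^ 2) (ENNReal.ofReal 2) μ := by
    intro K hK
    have e : ENNReal.ofReal 2 = 2 := by norm_num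
    have hm : AEStronglyMeasurable (fun a => K a ^ 2) μ := hK.1.pow 2
    rw [e, memLp_two_iff_integrable_sq hm]
    refine (integrable_pow_four hK).congr (Filter.Eventually.of_forall fun a => ?_)
    ring
  have := integral_mul_le_Lp_mul_Lq_of_nonneg (μ := μ) Real.HolderConjugate.two_two
    (Filter.Eventually.of_forall fun a => sq_nonneg (F a))
    (Filter.Eventually.of_forall fun a => sq_nonneg (G a)) (h2 hF) (h2 hG)
  refine this.trans (le_of_eq ?_)
  simp only [sqNorm4, Real.sqrt_eq_rpow, Real.rpow_two]
  congr 3 <;> · ext a; ring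

variable [IsProbabilityMeasure μ]

theorem sqNorm4_one : sqNorm4 μ (fun _ => 1) = 1 := by simp [sqNorm4]

theorem integral_sq_le_sqNorm4 {F : α → ℝ} (hF : MemLp F 4 μ) :
    ∫ a, F a ^ 2 ∂μ ≤ sqNorm4 μ F := by
  simpa [sqNorm4_one] using integral_sq_mul_sq_le hF (memLp_const (1 : ℝ))

theorem integrable_sq_of_four {F : α → ℝ} (hF : MemLp F 4 μ) :
    Integrable (fun a => F a ^ 2) μ := by
  simpa [sq] using integrable_mul_two hF hF

theorem integrable_pow_mul_pow {F G : α → ℝ} (hF : MemLp F 4 μ) (hG : MemLp G 4 μ) :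
    Integrable (fun a => F a ^ 2 * G a ^ 2) μ :=
  (integrable_mul_four hF hF hG hG).congr (Filter.Eventually.of_forall fun a => by ring)

/-- A two point hypercontractivity inequality. -/
theorem sqNorm4_add_le {F G : α → ℝ} (hF : MemLp F 4 μ) (hG : MemLp G 4 μ)
    (h : ∫ a, G a * F a ^ 3 ∂μ = 0) :
    sqNorm4 μ (fun a => F a + G a) ≤ sqNorm4 μ F + 4 * sqNorm4 μ G := by
  have n1 := sqNorm4_nonneg (μ := μ) F
  have n2 := sqNorm4_nonneg (μ := μ) G
  refine Real.sqrt_le_iff.2 ⟨by positivity, ?_⟩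
  have i1 := integrable_pow_four hF
  have i2 := integrable_pow_four hG
  have i3 := integrable_pow_mul_pow hF hG
  have i4 : Integrable (fun a => G a * F a ^ 3) μ :=
    (integrable_mul_four hG hF hF hF).congr (Filter.Eventually.of_forall fun a => by ring)
  -- In the binomial expansion `4 F G³ ≤ 2 F² G² + 2 G⁴`, whence the coefficients `6 + 2 = 8` and `1
  -- + 2 = 3`. The term in `G F³` has mean zero, and completing the square with `8 = 2 * 4` gives
  -- the factor `4`.
  have hle : ∫ a, (F a + G a) ^ 4 ∂μ ≤
      ∫ a, (F a ^ 4 + 4 * (G a * F a ^ 3) + (8 * (F a ^ 2 * G a ^ 2) + 3 * G a ^ 4)) ∂μ := by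
    refine integral_mono (integrable_pow_four (hF.add hG))
      ((i1.add (i4.const_mul 4)).add ((i3.const_mul 8).add (i2.const_mul 3))) fun a => ?_
    nlinarith [sq_nonneg (F a * G a - G a ^ 2), sq_nonneg (F a * G a)]
  have j1 : Integrable (fun a => F a ^ 4 + 4 * (G a * F a ^ 3)) μ := i1.add (i4.const_mul 4)
  have j2 : Integrable (fun a => 8 * (F a ^ 2 * G a ^ 2) + 3 * G a ^ 4) μ :=
    (i3.const_mul 8).add (i2.const_mul 3)
  rw [integral_add j1 j2, integral_add i1 (i4.const_mul 4),
    integral_add (i3.const_mul 8) (i2.const_mul 3), integral_const_mul, integral_const_mul,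
    integral_const_mul, h, ← sq_sqNorm4 F, ← sq_sqNorm4 G] at hle
  have := integral_sq_mul_sq_le hF hG
  refine hle.trans ?_
  nlinarith

theorem sq_integral_le {F : α → ℝ} (hF : MemLp F 2 μ) :
    (∫ a, F a ∂μ) ^ 2 ≤ ∫ a, F a ^ 2 ∂μ := by
  have h := variance_nonneg F μ
  rw [variance_eq_sub hF] at h
  simpa using h

/-- Conditional means contract the `L²` norm. -/
theorem memLp_two_integral_prod {β : Type*} [MeasurableSpace β] {ν : Measure β}
    [IsProbabilityMeasure ν] {F : α × β → ℝ} (hF : MemLp F 2 (μ.prod ν)) :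
    MemLp (fun a => ∫ b, F (a, b) ∂ν) 2 μ ∧
      ∫ a, (∫ b, F (a, b) ∂ν) ^ 2 ∂μ ≤ ∫ p, F p ^ 2 ∂(μ.prod ν) := by
  have hi := hF.integrable_sq
  have hm := hF.1.integral_prod_right'
  have hsec : ∀ᵐ a ∂μ, (∫ b, F (a, b) ∂ν) ^ 2 ≤ ∫ b, F (a, b) ^ 2 ∂ν := by
    filter_upwards [hi.prod_right_ae, hF.1.prodMk_left] with a h1 h2
    exact sq_integral_le ((memLp_two_iff_integrable_sq h2).2 h1)
  have hI : Integrable (fun a => (∫ b, F (a, b) ∂ν) ^ 2) μ := by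
    refine hi.integral_prod_left.mono' (hm.pow 2) ?_
    filter_upwards [hsec] with a ha
    rwa [Real.norm_of_nonneg (sq_nonneg _)]
  refine ⟨(memLp_two_iff_integrable_sq hm).2 hI, ?_⟩
  rw [integral_prod _ hi]
  exact integral_mono_ae hI hi.integral_prod_left hsec

/-- From `|x| ≤ s x² / 2 + 1 / (2 s)`. The bound stays linear in `B` and no square root of it
appears. -/
theorem integral_abs_le_of_sq {F : α → ℝ} (hF : MemLp F 2 μ) {s B : ℝ} (hs : 0 < s)
    (h : ∫ a, F a ^ 2 ∂μ ≤ B / s ^ 2) : ∫ a, |F a| ∂μ ≤ (B + 1) / 2 / s := by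
  have hi := hF.integrable_sq
  have : ∫ a, |F a| ∂μ ≤ ∫ a, (s / 2 * F a ^ 2 + 1 / (2 * s)) ∂μ := by
    refine integral_mono (hF.integrable (by norm_num)).abs
      ((hi.const_mul _).add (integrable_const _)) fun a => ?_
    have : |F a| ^ 2 = F a ^ 2 := sq_abs _
    have e : s / 2 * F a ^ 2 + 1 / (2 * s) - |F a| = (s * |F a| - 1) ^ 2 / (2 * s) := by
      rw [← this]; field_simp; ring
    have : 0 ≤ (s * |F a| - 1) ^ 2 / (2 * s) := by positivity
    linarith
  rw [integral_add (hi.const_mul _) (integrable_const _), integral_const_mul] at this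
  refine this.trans ?_
  have h2 : s / 2 * ∫ a, F a ^ 2 ∂μ ≤ s / 2 * (B / s ^ 2) :=
    mul_le_mul_of_nonneg_left h (by positivity)
  have e : (B + 1) / 2 / s = s / 2 * (B / s ^ 2) + 1 / (2 * s) := by field_simp
  rw [e]
  simpa using h2

theorem memLp_two_of_four {F : α → ℝ} (hF : MemLp F 4 μ) : MemLp F 2 μ :=
  hF.mono_exponent (by norm_num)

theorem memLp_two_mul {F G : α → ℝ} (hF : MemLp F 4 μ) (hG : MemLp G 4 μ) :
    MemLp (fun a => F a * G a) 2 μ := by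
  have hm : AEStronglyMeasurable (fun a => F a * G a) μ := hF.1.mul hG.1
  rw [memLp_two_iff_integrable_sq hm]
  exact (integrable_pow_mul_pow hF hG).congr (Filter.Eventually.of_forall fun a => by ring)

end Norms

/-! ### Hypercontractivity for sums of Hoeffding components. -/

section Hypercontractivity

variable {I Z : Type*} [Fintype I] [DecidableEq I] [MeasurableSpace Z]
  {m : Measure Z} [IsProbabilityMeasure m]

theorem Pure.zero (T : Finset I) : Pure m T (fun _ => 0) where
  meas := measurable_const
  memLp := memLp_const 0
  dep := fun _ _ _ => rfl
  orth := fun i _ G _ _ _ => by simp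

/-- Induction on the coordinates: the part of the sum that involves `a` is orthogonal to the cube of
the part that does not, so the two point inequality applies and each coordinate costs a factor `4`.
The set `Q` records the coordinates already split off, in which the components remain degenerate. -/
theorem sqNorm4_sum_powerset_le (J : Finset I) : ∀ (Q : Finset I), Disjoint J Q →
    ∀ F : Finset I → (I → Z) → ℝ, (∀ T ⊆ J, Pure m (T ∪ Q) (F T)) →
      sqNorm4 (piLaw m I) (fun z => ∑ T ∈ J.powerset, F T z) ≤
        ∑ T ∈ J.powerset, 4 ^ #T * sqNorm4 (piLaw m I) (F T) := by
  induction J using Finset.induction_on with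
  | empty => intro Q _ F _; simp
  | insert a J ha ih =>
    intro Q hQ F hF
    rw [Finset.disjoint_insert_left] at hQ
    have hF0 : ∀ T ⊆ J, Pure m (T ∪ Q) (F T) := fun T hT =>
      hF T (hT.trans (Finset.subset_insert _ _))
    have hF1 : ∀ T ⊆ J, Pure m (T ∪ insert a Q) (F (insert a T)) := fun T hT => by
      have := hF (insert a T) (Finset.insert_subset_insert a hT)
      rwa [Finset.insert_union, ← Finset.union_insert] at this
    have l0 : MemLp (fun z => ∑ T ∈ J.powerset, F T z) 4 (piLaw m I) :=
      memLp_finsetSum _ fun T hT => (hF0 T (Finset.mem_powerset.1 hT)).memLp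
    have l1 : MemLp (fun z => ∑ T ∈ J.powerset, F (insert a T) z) 4 (piLaw m I) :=
      memLp_finsetSum _ fun T hT => (hF1 T (Finset.mem_powerset.1 hT)).memLp
    have m0 : Measurable (fun z => ∑ T ∈ J.powerset, F T z) :=
      Finset.measurable_sum _ fun T hT => (hF0 T (Finset.mem_powerset.1 hT)).meas
    have d0 : DependsOn (fun z => ∑ T ∈ J.powerset, F T z) ({a}ᶜ : Set I) :=
      dependsOn_finset_sum fun T hT => (hF0 T (Finset.mem_powerset.1 hT)).dep_compl (by
        rw [Finset.mem_union, not_or]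
        exact ⟨fun h => ha (Finset.mem_powerset.1 hT h), hQ.1⟩)
    have key : ∫ z, (∑ T ∈ J.powerset, F (insert a T) z) * (∑ T ∈ J.powerset, F T z) ^ 3
        ∂(piLaw m I) = 0 := by
      simp only [Finset.sum_mul]
      rw [integral_finsetSum]
      · refine Finset.sum_eq_zero fun T hT =>
          (hF1 T (Finset.mem_powerset.1 hT)).integral_mul_eq_zero (i := a) (by simp)
            (m0.pow_const 3) fun x y h => ?_
        simp only [d0 h]
      · intro T hT
        exact (integrable_mul_four (hF1 T (Finset.mem_powerset.1 hT)).memLp l0 l0 l0).congr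
          (Filter.Eventually.of_forall fun z => by ring)
    simp only [Finset.sum_powerset_insert ha]
    refine (sqNorm4_add_le l0 l1 key).trans (add_le_add (ih Q hQ.2 F hF0) ?_)
    have := ih (insert a Q) (Finset.disjoint_insert_right.2 ⟨ha, hQ.2⟩) (fun T => F (insert a T)) hF1
    refine (mul_le_mul_of_nonneg_left this (by norm_num)).trans (le_of_eq ?_)
    rw [Finset.mul_sum]
    refine Finset.sum_congr rfl fun T hT => ?_
    rw [Finset.card_insert_of_notMem fun h => ha (Finset.mem_powerset.1 hT h)]
    ring

/-- Hypercontractivity: the `L⁴` norm of a sum of Hoeffding components of bounded order. -/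
theorem sqNorm4_sum_le (P : Finset (Finset I)) {F : Finset I → (I → Z) → ℝ}
    (hF : ∀ T ∈ P, Pure m T (F T)) :
    sqNorm4 (piLaw m I) (fun z => ∑ T ∈ P, F T z) ≤
      ∑ T ∈ P, 4 ^ #T * sqNorm4 (piLaw m I) (F T) := by
  classical
  have := sqNorm4_sum_powerset_le (m := m) (Finset.univ : Finset I) ∅ (by simp)
    (fun T => if T ∈ P then F T else fun _ => 0) (fun T _ => by
      by_cases h : T ∈ P
      · simpa [h] using hF T h
      · simpa [h] using Pure.zero T)
  simp only [Finset.powerset_univ] at this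
  have e1 : ∀ z : I → Z, ∑ T, (if T ∈ P then F T else fun _ => 0) z = ∑ T ∈ P, F T z := fun z => by
    rw [← Finset.sum_filter_add_sum_filter_not Finset.univ (· ∈ P)]
    rw [Finset.sum_eq_zero (s := Finset.univ.filter (· ∉ P)), add_zero]
    · simp only [Finset.filter_univ_mem]
      exact Finset.sum_congr rfl fun T hT => by rw [if_pos hT]
    · intro T hT; rw [if_neg (Finset.mem_filter.1 hT).2]
  simp only [e1] at this
  refine this.trans (le_of_eq ?_)
  rw [← Finset.sum_filter_add_sum_filter_not Finset.univ (· ∈ P)]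
  rw [Finset.sum_eq_zero (s := Finset.univ.filter (· ∉ P)), add_zero]
  · simp only [Finset.filter_univ_mem]
    exact Finset.sum_congr rfl fun T hT => by rw [if_pos hT]
  · intro T hT; rw [if_neg (Finset.mem_filter.1 hT).2]; simp [sqNorm4]

end Hypercontractivity

/-! ### The conditional means of the antisymmetric terms. -/

section AntisymmetricTerm

variable {I Z : Type*} [Fintype I] [DecidableEq I] [MeasurableSpace Z]
  {m : Measure Z} [IsProbabilityMeasure m]

theorem memLp_two_antisymm (i : I) {h u : (I → Z) → ℝ} (hh : MemLp h 4 (piLaw m I))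
    (hu : MemLp u 4 (piLaw m I)) :
    MemLp (antisymm i h u) 2 ((piLaw m I).prod (piLaw m I)) :=
  memLp_two_mul ((memLp_four_abs (MemLp.fst_prod hh)).add
    (memLp_four_abs (MemLp.resample_prod hh i)))
    ((MemLp.fst_prod hu).sub (MemLp.resample_prod hu i))

theorem memLp_two_antisymmMean (i : I) {h u : (I → Z) → ℝ} (hh : MemLp h 4 (piLaw m I))
    (hu : MemLp u 4 (piLaw m I)) : MemLp (antisymmMean m i h u) 2 (piLaw m I) :=
  (memLp_two_integral_prod (memLp_two_antisymm i hh hu)).1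

theorem sqNorm4_fst_prod {F : (I → Z) → ℝ} (hF : MemLp F 4 (piLaw m I)) :
    sqNorm4 ((piLaw m I).prod (piLaw m I)) (fun p => F p.1) = sqNorm4 (piLaw m I) F := by
  rw [sqNorm4, sqNorm4, integral_comp_measurePreserving (g := Prod.fst) measurePreserving_fst
    (integrable_pow_four hF).1]

theorem sqNorm4_resample_prod {F : (I → Z) → ℝ} (hF : MemLp F 4 (piLaw m I)) (i : I) :
    sqNorm4 ((piLaw m I).prod (piLaw m I)) (fun p => F (resample i p)) =
      sqNorm4 (piLaw m I) F := by
  rw [sqNorm4, sqNorm4, integral_comp_measurePreserving (measurePreserving_resample m i)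
    (integrable_pow_four hF).1]

/-- The difference is a sum of two products, each with a factor controlled by a removed part, `b` or
`d`. -/
theorem sq_antisymm_sub_le (a a' b b' c c' d d' : ℝ) :
    ((|a + b| + |a' + b'|) * ((c + d) - (c' + d')) - (|a| + |a'|) * (c - c')) ^ 2 ≤
      8 * ((b ^ 2 + b' ^ 2) * ((c + d) ^ 2 + (c' + d') ^ 2)) +
        8 * ((a ^ 2 + a' ^ 2) * (d ^ 2 + d' ^ 2)) := by
  have e : (|a + b| + |a' + b'|) * ((c + d) - (c' + d')) - (|a| + |a'|) * (c - c') =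
      ((|a + b| - |a|) + (|a' + b'| - |a'|)) * ((c + d) - (c' + d')) +
        (|a| + |a'|) * (d - d') := by ring
  have sq2 : ∀ x y : ℝ, (x + y) ^ 2 ≤ 2 * (x ^ 2 + y ^ 2) := fun x y => by
    nlinarith [sq_nonneg (x - y)]
  have sq2' : ∀ x y : ℝ, (x - y) ^ 2 ≤ 2 * (x ^ 2 + y ^ 2) := fun x y => by
    nlinarith [sq_nonneg (x + y)]
  have hb : ∀ x y : ℝ, (|x + y| - |x|) ^ 2 ≤ y ^ 2 := fun x y => by
    have := abs_abs_sub_abs_le_abs_sub (x + y) x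
    rw [add_sub_cancel_left] at this
    exact sq_le_sq.2 this
  have h1 : ((|a + b| - |a|) + (|a' + b'| - |a'|)) ^ 2 ≤ 2 * (b ^ 2 + b' ^ 2) :=
    (sq2 _ _).trans (by linarith [hb a b, hb a' b'])
  have h2 := sq2' (c + d) (c' + d')
  have h3 : (|a| + |a'|) ^ 2 ≤ 2 * (a ^ 2 + a' ^ 2) := by
    refine (sq2 _ _).trans ?_
    rw [sq_abs, sq_abs]
  have h4 := sq2' d d'
  rw [e]
  refine (sq2 _ _).trans ?_
  rw [mul_pow, mul_pow]
  have k1 := mul_le_mul h1 h2 (sq_nonneg _) (by positivity)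
  have k2 := mul_le_mul h3 h4 (sq_nonneg _) (by positivity)
  linarith

/-- Conditional means contract L², and resampling preserves norms. Each of the two products becomes
four products of squares, one for each choice of copies, whence `32 = 8 * 4`. -/
theorem integral_sq_antisymmMean_sub_le (i : I) {h u h' u' h'' u'' : (I → Z) → ℝ}
    (hh' : MemLp h' 4 (piLaw m I)) (hh'' : MemLp h'' 4 (piLaw m I))
    (hu' : MemLp u' 4 (piLaw m I)) (hu'' : MemLp u'' 4 (piLaw m I))
    (eh : ∀ z, h z = h' z + h'' z) (eu : ∀ z, u z = u' z + u'' z) :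
    ∫ z, (antisymmMean m i h u z - antisymmMean m i h' u' z) ^ 2 ∂(piLaw m I) ≤
      32 * (sqNorm4 (piLaw m I) h'' * sqNorm4 (piLaw m I) u +
        sqNorm4 (piLaw m I) h' * sqNorm4 (piLaw m I) u'') := by
  have hh : MemLp h 4 (piLaw m I) := by rw [funext eh]; exact hh'.add hh''
  have hu : MemLp u 4 (piLaw m I) := by rw [funext eu]; exact hu'.add hu''
  set PP := (piLaw m I).prod (piLaw m I) with hPP
  have hs : MemLp (fun p => antisymm i h u p - antisymm i h' u' p) 2 PP :=
    (memLp_two_antisymm i hh hu).sub (memLp_two_antisymm i hh' hu')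
  have hle := (memLp_two_integral_prod hs).2
  have e1 : ∫ z, (antisymmMean m i h u z - antisymmMean m i h' u' z) ^ 2 ∂(piLaw m I) =
      ∫ z, (∫ z', (antisymm i h u (z, z') - antisymm i h' u' (z, z')) ∂(piLaw m I)) ^ 2
        ∂(piLaw m I) := by
    refine integral_congr_ae ?_
    filter_upwards [(integrable_antisymm i hh hu).prod_right_ae,
      (integrable_antisymm i hh' hu').prod_right_ae] with z h1 h2
    rw [integral_sub h1 h2]
    rfl
  rw [e1]
  refine hle.trans ?_
  have a1 := MemLp.fst_prod hh'
  have a2 := MemLp.resample_prod hh' i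
  have b1 := MemLp.fst_prod hh''
  have b2 := MemLp.resample_prod hh'' i
  have c1 := MemLp.fst_prod hu
  have c2 := MemLp.resample_prod hu i
  have d1 := MemLp.fst_prod hu''
  have d2 := MemLp.resample_prod hu'' i
  have key : ∫ p, (antisymm i h u p - antisymm i h' u' p) ^ 2 ∂PP ≤
      ∫ p, (8 * (((h'' p.1 ^ 2 * u p.1 ^ 2 + h'' p.1 ^ 2 * u (resample i p) ^ 2) +
        (h'' (resample i p) ^ 2 * u p.1 ^ 2 + h'' (resample i p) ^ 2 * u (resample i p) ^ 2)) +
        ((h' p.1 ^ 2 * u'' p.1 ^ 2 + h' p.1 ^ 2 * u'' (resample i p) ^ 2) +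
        (h' (resample i p) ^ 2 * u'' p.1 ^ 2 +
          h' (resample i p) ^ 2 * u'' (resample i p) ^ 2)))) ∂PP := by
    refine integral_mono hs.integrable_sq (Integrable.const_mul (Integrable.add
      (Integrable.add ((integrable_pow_mul_pow b1 c1).add (integrable_pow_mul_pow b1 c2))
        ((integrable_pow_mul_pow b2 c1).add (integrable_pow_mul_pow b2 c2)))
      (Integrable.add ((integrable_pow_mul_pow a1 d1).add (integrable_pow_mul_pow a1 d2))
        ((integrable_pow_mul_pow a2 d1).add (integrable_pow_mul_pow a2 d2)))) _) fun p => ?_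
    have := sq_antisymm_sub_le (h' p.1) (h' (resample i p)) (h'' p.1) (h'' (resample i p))
      (u' p.1) (u' (resample i p)) (u'' p.1) (u'' (resample i p))
    simp only [← eh, ← eu] at this
    simp only [antisymm]
    refine this.trans (le_of_eq ?_)
    ring
  have s1 : ∀ {A B C D : (I → Z) × (I → Z) → ℝ} {x y : ℝ}, MemLp A 4 PP → MemLp B 4 PP →
      MemLp C 4 PP → MemLp D 4 PP → sqNorm4 PP A = x → sqNorm4 PP B = x → sqNorm4 PP C = y →
      sqNorm4 PP D = y →
      Integrable (fun p => (A p ^ 2 * C p ^ 2 + A p ^ 2 * D p ^ 2) +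
        (B p ^ 2 * C p ^ 2 + B p ^ 2 * D p ^ 2)) PP ∧
      ∫ p, ((A p ^ 2 * C p ^ 2 + A p ^ 2 * D p ^ 2) +
        (B p ^ 2 * C p ^ 2 + B p ^ 2 * D p ^ 2)) ∂PP ≤ 4 * (x * y) := by
    intro A B C D x y hA hB hC hD eA eB eC eD
    have i1 : Integrable (fun p => A p ^ 2 * C p ^ 2 + A p ^ 2 * D p ^ 2) PP :=
      (integrable_pow_mul_pow hA hC).add (integrable_pow_mul_pow hA hD)
    have i2 : Integrable (fun p => B p ^ 2 * C p ^ 2 + B p ^ 2 * D p ^ 2) PP :=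
      (integrable_pow_mul_pow hB hC).add (integrable_pow_mul_pow hB hD)
    refine ⟨i1.add i2, ?_⟩
    rw [integral_add i1 i2, integral_add (integrable_pow_mul_pow hA hC)
      (integrable_pow_mul_pow hA hD), integral_add (integrable_pow_mul_pow hB hC)
      (integrable_pow_mul_pow hB hD)]
    have q1 := integral_sq_mul_sq_le hA hC
    have q2 := integral_sq_mul_sq_le hA hD
    have q3 := integral_sq_mul_sq_le hB hC
    have q4 := integral_sq_mul_sq_le hB hD
    rw [eA, eC] at q1
    rw [eA, eD] at q2
    rw [eB, eC] at q3
    rw [eB, eD] at q4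
    linarith
  refine key.trans ?_
  obtain ⟨i1, k1⟩ := s1 b1 b2 c1 c2 (sqNorm4_fst_prod hh'') (sqNorm4_resample_prod hh'' i)
    (sqNorm4_fst_prod hu) (sqNorm4_resample_prod hu i)
  obtain ⟨i2, k2⟩ := s1 a1 a2 d1 d2 (sqNorm4_fst_prod hh') (sqNorm4_resample_prod hh' i)
    (sqNorm4_fst_prod hu'') (sqNorm4_resample_prod hu'' i)
  rw [integral_const_mul, integral_add i1 i2]
  linarith

/-- Exchanging coordinate `i` between the copies changes the sign of the antisymmetric term and
leaves `K` alone, so the integral equals its negative. -/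
theorem integral_antisymmMean_mul_eq_zero (i : I) {h u K : (I → Z) → ℝ} (hhm : Measurable h)
    (hum : Measurable u) (hKm : Measurable K) (hh : MemLp h 4 (piLaw m I))
    (hu : MemLp u 4 (piLaw m I)) (hK : MemLp K 2 (piLaw m I))
    (hd : DependsOn K ({i}ᶜ : Set I)) :
    ∫ z, antisymmMean m i h u z * K z ∂(piLaw m I) = 0 := by
  have hK1 : MemLp (fun p : (I → Z) × (I → Z) => K p.1) 2 ((piLaw m I).prod (piLaw m I)) :=
    hK.comp_measurePreserving measurePreserving_fst
  have hint : Integrable (fun p => antisymm i h u p * K p.1) ((piLaw m I).prod (piLaw m I)) :=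
    (memLp_two_antisymm i hh hu).integrable_mul hK1
  have e : ∫ z, antisymmMean m i h u z * K z ∂(piLaw m I) =
      ∫ p, antisymm i h u p * K p.1 ∂((piLaw m I).prod (piLaw m I)) := by
    rw [integral_prod _ hint]
    simp only [integral_mul_const, antisymmMean]
  have hs := integral_swapAt m i (F := fun p => antisymm i h u p * K p.1)
    ((measurable_antisymm i hhm hum).mul (hKm.comp measurable_fst))
  have e2 : ∫ p, antisymm i h u (swapAt i p) * K (swapAt i p).1
      ∂((piLaw m I).prod (piLaw m I)) =
      -∫ p, antisymm i h u p * K p.1 ∂((piLaw m I).prod (piLaw m I)) := by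
    rw [← integral_neg]
    refine integral_congr_ae (Filter.Eventually.of_forall fun p => ?_)
    have : K (swapAt i p).1 = K p.1 := hd fun j hj => by
      have hj : j ≠ i := hj
      simp [swapAt, resample, hj]
    simp only [antisymm_swapAt, this]
    ring
  rw [e]
  linarith

theorem dependsOn_antisymmMean (i j : I) {h u : (I → Z) → ℝ} (hh : DependsOn h ({j}ᶜ : Set I))
    (hu : DependsOn u ({j}ᶜ : Set I)) : DependsOn (antisymmMean m i h u) ({j}ᶜ : Set I) := by
  intro x y hxy
  have hr : ∀ z' : I → Z, ∀ k ∈ ({j}ᶜ : Set I), resample i (x, z') k = resample i (y, z') k := by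
    intro z' k hk
    by_cases h : k = i
    · subst h; simp [resample]
    · simp [resample, h, hxy k hk]
  simp only [antisymmMean, antisymm]
  refine integral_congr_ae (Filter.Eventually.of_forall fun z' => ?_)
  simp only [hh hxy, hu hxy, hh (hr z'), hu (hr z')]

end AntisymmetricTerm

/-! ### A Berry–Esseen bound in terms of influences. -/

section Influence

variable {I Z : Type*} [Fintype I] [DecidableEq I] [MeasurableSpace Z]
  {m : Measure Z} [IsProbabilityMeasure m]

/-- The linear combination `∑ c_T w_T` over the sets `T` of a family `P`. -/
def linPart (c : Finset I → ℝ) (w : Finset I → (I → Z) → ℝ) (P : Finset (Finset I))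
    (z : I → Z) : ℝ :=
  ∑ T ∈ P, c T * w T z

/-- The weight of a set in the hypercontractivity bound. -/
noncomputable def hyperWeight (m : Measure Z) (w : Finset I → (I → Z) → ℝ) (T : Finset I) : ℝ :=
  4 ^ #T * sqNorm4 (piLaw m I) (w T)

theorem hyperWeight_nonneg (w : Finset I → (I → Z) → ℝ) (T : Finset I) :
    0 ≤ hyperWeight m w T :=
  mul_nonneg (by positivity) (sqNorm4_nonneg _)

variable {w : Finset I → (I → Z) → ℝ} {c : Finset I → ℝ} {P : Finset (Finset I)}

theorem measurable_linPart (hw : ∀ T ∈ P, Pure m T (w T)) : Measurable (linPart c w P) :=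
  Finset.measurable_sum _ fun T hT => (hw T hT).meas.const_mul _

theorem memLp_linPart (hw : ∀ T ∈ P, Pure m T (w T)) : MemLp (linPart c w P) 4 (piLaw m I) :=
  memLp_finsetSum _ fun T hT => (hw T hT).memLp.const_mul _

theorem dependsOn_linPart (hw : ∀ T ∈ P, Pure m T (w T)) {i : I} (hi : ∀ T ∈ P, i ∉ T) :
    DependsOn (linPart c w P) ({i}ᶜ : Set I) :=
  dependsOn_finset_sum fun T hT => ((hw T hT).const_mul (c T)).dep_compl (hi T hT)


theorem sqNorm4_linPart_le (hw : ∀ T ∈ P, Pure m T (w T)) (hc : ∀ T, |c T| ≤ 1) :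
    sqNorm4 (piLaw m I) (linPart c w P) ≤ ∑ T ∈ P, hyperWeight m w T := by
  refine (sqNorm4_sum_le P fun T hT => (hw T hT).const_mul (c T)).trans
    (Finset.sum_le_sum fun T _ => ?_)
  rw [sqNorm4_const_mul]
  have h1 : c T ^ 2 ≤ 1 := (sq_le_one_iff_abs_le_one _).2 (hc T)
  have h2 := sqNorm4_nonneg (μ := piLaw m I) (w T)
  exact mul_le_mul_of_nonneg_left (by nlinarith) (by positivity)

theorem linPart_filter_add (p : Finset I → Prop) [DecidablePred p] (z : I → Z) :
    linPart c w (P.filter fun T => ¬ p T) z + linPart c w (P.filter p) z = linPart c w P z := by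
  rw [add_comm]
  exact Finset.sum_filter_add_sum_filter_not _ _ _

theorem integral_linPart_mul_linPart {c' : Finset I → ℝ} (hw : ∀ T ∈ P, Pure m T (w T)) :
    ∫ z, linPart c w P z * linPart c' w P z ∂(piLaw m I) =
      ∑ T ∈ P, c T * c' T * ∫ z, w T z ^ 2 ∂(piLaw m I) := by
  have hi : ∀ T ∈ P, ∀ T' ∈ P, Integrable (fun z => (c T * w T z) * (c' T' * w T' z))
      (piLaw m I) := fun T hT T' hT' =>
    integrable_mul_two ((hw T hT).memLp.const_mul _) ((hw T' hT').memLp.const_mul _)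
  simp only [linPart, Finset.sum_mul_sum]
  rw [integral_finsetSum _ fun T hT => integrable_finsetSum _ fun T' hT' => hi T hT T' hT']
  refine Finset.sum_congr rfl fun T hT => ?_
  rw [integral_finsetSum _ fun T' hT' => hi T hT T' hT', Finset.sum_eq_single_of_mem T hT]
  · rw [← integral_const_mul]
    refine integral_congr_ae (Filter.Eventually.of_forall fun z => ?_)
    simp only
    ring
  · intro T' hT' hne
    exact ((hw T hT).const_mul (c T)).integral_mul_of_ne ((hw T' hT').const_mul (c' T')) hne.symm

theorem sum_sum_filter_mem (F : Finset I → ℝ) :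
    ∑ i, ∑ T ∈ P.filter (i ∈ ·), F T = ∑ T ∈ P, (#T : ℝ) * F T := by
  simp only [Finset.sum_filter]
  rw [Finset.sum_comm]
  refine Finset.sum_congr rfl fun T _ => ?_
  rw [← Finset.sum_filter, Finset.sum_const, nsmul_eq_mul]
  simp

/-- The coefficients `1 / |T|`. -/
noncomputable def invCard (T : Finset I) : ℝ := (#T : ℝ)⁻¹

theorem abs_invCard_le (T : Finset I) : |invCard T| ≤ 1 := by
  rw [invCard, abs_of_nonneg (by positivity)]
  exact Nat.cast_inv_le_one _

/-- The terms which involve the coordinate `i`, divided by their number of coordinates. -/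
noncomputable def invPart (w : Finset I → (I → Z) → ℝ) (P : Finset (Finset I)) (i : I) :
    (I → Z) → ℝ :=
  linPart invCard w (P.filter (i ∈ ·))

/-- The terms which involve the coordinate `i`. -/
def fullPart (w : Finset I → (I → Z) → ℝ) (P : Finset (Finset I)) (i : I) : (I → Z) → ℝ :=
  linPart (fun _ => 1) w (P.filter (i ∈ ·))

/-- Each `T` is counted once for each of its coordinates, which the weight `1 / |T|` compensates;
the empty set would be lost. -/
theorem sum_invPart (hP : ∅ ∉ P) (z : I → Z) : ∑ i, invPart w P i z = ∑ T ∈ P, w T z := by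
  simp only [invPart, linPart]
  rw [sum_sum_filter_mem (fun T => invCard T * w T z)]
  refine Finset.sum_congr rfl fun T hT => ?_
  have : (#T : ℝ) ≠ 0 := by
    rw [Nat.cast_ne_zero, Finset.card_ne_zero, Finset.nonempty_iff_ne_empty]
    rintro rfl
    exact hP hT
  rw [invCard, ← mul_assoc, mul_inv_cancel₀ this, one_mul]

/-- Dropping the components that contain `j` makes the `i`-th term free of coordinate `j`, and costs
only the weight of the sets containing both `i` and `j`, times the influence of `i`. -/
theorem sq_integral_antisymmMean_le (hw : ∀ T ∈ P, Pure m T (w T)) {M : ℝ}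
    (hM : ∀ i, ∑ T ∈ P.filter (i ∈ ·), hyperWeight m w T ≤ M) (i j : I) :
    ∫ z, (antisymmMean m i (invPart w P i) (fullPart w P i) z -
      antisymmMean m i (linPart invCard w ((P.filter (i ∈ ·)).filter (j ∉ ·)))
        (linPart (fun _ => 1) w ((P.filter (i ∈ ·)).filter (j ∉ ·))) z) ^ 2 ∂(piLaw m I) ≤
      64 * M * ∑ T ∈ (P.filter (i ∈ ·)).filter (j ∈ ·), hyperWeight m w T := by
  have hwi : ∀ T ∈ P.filter (i ∈ ·), Pure m T (w T) := fun T hT => hw T (Finset.filter_subset _ _ hT)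
  have hw1 : ∀ T ∈ (P.filter (i ∈ ·)).filter (j ∉ ·), Pure m T (w T) := fun T hT =>
    hwi T (Finset.filter_subset _ _ hT)
  have hw2 : ∀ T ∈ (P.filter (i ∈ ·)).filter (j ∈ ·), Pure m T (w T) := fun T hT =>
    hwi T (Finset.filter_subset _ _ hT)
  have h1 : ∀ T : Finset I, |(fun _ : Finset I => (1 : ℝ)) T| ≤ 1 := fun T => by simp
  refine (integral_sq_antisymmMean_sub_le (m := m) (h := invPart w P i) (u := fullPart w P i) i
    (memLp_linPart hw1)
    (memLp_linPart (c := invCard) hw2) (memLp_linPart hw1)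
    (memLp_linPart (c := fun _ => 1) hw2) (fun z => (linPart_filter_add (j ∈ ·) z).symm)
    (fun z => (linPart_filter_add (j ∈ ·) z).symm)).trans ?_
  have b1 := sqNorm4_linPart_le (m := m) hw2 (abs_invCard_le (I := I))
  have b2 := sqNorm4_linPart_le (m := m) hw2 h1
  have b3 := (sqNorm4_linPart_le (m := m) hwi h1).trans (hM i)
  have b4 : sqNorm4 (piLaw m I) (linPart invCard w ((P.filter (i ∈ ·)).filter (j ∉ ·))) ≤ M :=
    (sqNorm4_linPart_le (m := m) hw1 (abs_invCard_le (I := I))).trans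
      ((Finset.sum_le_sum_of_subset_of_nonneg (Finset.filter_subset _ _)
        fun T _ _ => hyperWeight_nonneg w T).trans (hM i))
  have hs : 0 ≤ ∑ T ∈ (P.filter (i ∈ ·)).filter (j ∈ ·), hyperWeight m w T :=
    Finset.sum_nonneg fun T _ => hyperWeight_nonneg w T
  have hM0 : 0 ≤ M := (sqNorm4_nonneg _).trans b4
  have c2 := mul_le_mul b4 b2 (sqNorm4_nonneg _) hM0
  have b3' : sqNorm4 (piLaw m I) (fullPart w P i) ≤ M := b3
  have c1 := mul_le_mul b1 b3' (sqNorm4_nonneg _) hs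
  linarith

/-- The variance bound for the antisymmetric part of Stein's method in terms of the influences of
the coordinates. -/
theorem integral_sq_sum_antisymmMean_le (hw : ∀ T ∈ P, Pure m T (w T)) {M L R : ℝ}
    (hR : ∀ T ∈ P, (#T : ℝ) ≤ R) (hL : ∑ T ∈ P, hyperWeight m w T ≤ L)
    (hM0 : 0 ≤ M) (hM : ∀ i, ∑ T ∈ P.filter (i ∈ ·), hyperWeight m w T ≤ M) :
    ∫ z, (∑ i, antisymmMean m i (invPart w P i) (fullPart w P i) z) ^ 2 ∂(piLaw m I) ≤
      64 * M * (R ^ 2 * L) := by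
  have hwi : ∀ i, ∀ T ∈ P.filter (i ∈ ·), Pure m T (w T) := fun i T hT =>
    hw T (Finset.filter_subset _ _ hT)
  have hw1 : ∀ i j, ∀ T ∈ (P.filter (i ∈ ·)).filter (j ∉ ·), Pure m T (w T) := fun i j T hT =>
    hwi i T (Finset.filter_subset _ _ hT)
  set E : I → (I → Z) → ℝ := fun i => antisymmMean m i (invPart w P i) (fullPart w P i) with hE
  set D : I → I → (I → Z) → ℝ := fun i j =>
    antisymmMean m i (linPart invCard w ((P.filter (i ∈ ·)).filter (j ∉ ·)))
      (linPart (fun _ => 1) w ((P.filter (i ∈ ·)).filter (j ∉ ·))) with hD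
  set A : I → I → ℝ := fun i j =>
    ∑ T ∈ (P.filter (i ∈ ·)).filter (j ∈ ·), hyperWeight m w T with hA
  have lE : ∀ i, MemLp (E i) 2 (piLaw m I) := fun i =>
    memLp_two_antisymmMean i (memLp_linPart (hwi i)) (memLp_linPart (hwi i))
  have lD : ∀ i j, MemLp (D i j) 2 (piLaw m I) := fun i j =>
    memLp_two_antisymmMean i (memLp_linPart (hw1 i j)) (memLp_linPart (hw1 i j))
  have mE : ∀ i, Measurable (E i) := fun i =>
    measurable_antisymmMean i (measurable_linPart (hwi i)) (measurable_linPart (hwi i))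
  have mD : ∀ i j, Measurable (D i j) := fun i j =>
    measurable_antisymmMean i (measurable_linPart (hw1 i j)) (measurable_linPart (hw1 i j))
  have dD : ∀ i j, DependsOn (D i j) ({j}ᶜ : Set I) := fun i j =>
    dependsOn_antisymmMean i j
      (dependsOn_linPart (hw1 i j) fun T hT => (Finset.mem_filter.1 hT).2)
      (dependsOn_linPart (hw1 i j) fun T hT => (Finset.mem_filter.1 hT).2)
  -- `D j i` is free of the coordinate `i`, in which `E i` is antisymmetric.
  have o1 : ∀ i j, ∫ z, E i z * D j i z ∂(piLaw m I) = 0 := fun i j =>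
    integral_antisymmMean_mul_eq_zero i (measurable_linPart (hwi i)) (measurable_linPart (hwi i))
      (mD j i) (memLp_linPart (hwi i)) (memLp_linPart (hwi i)) (lD j i) (dD j i)
  have o2 : ∀ i j, ∫ z, D i j z * D j i z ∂(piLaw m I) = 0 := fun i j =>
    integral_antisymmMean_mul_eq_zero i (measurable_linPart (hw1 i j))
      (measurable_linPart (hw1 i j)) (mD j i) (memLp_linPart (hw1 i j))
      (memLp_linPart (hw1 i j)) (lD j i) (dD j i)
  have hij : ∀ i j, ∫ z, E i z * E j z ∂(piLaw m I) ≤ 64 * M * A i j := by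
    intro i j
    have ei : Integrable (fun z => E i z * E j z) (piLaw m I) := (lE i).integrable_mul (lE j)
    have e1 : Integrable (fun z => E i z * D j i z) (piLaw m I) := (lE i).integrable_mul (lD j i)
    have e2 : Integrable (fun z => D i j z * E j z) (piLaw m I) := (lD i j).integrable_mul (lE j)
    have e3 : Integrable (fun z => D i j z * D j i z) (piLaw m I) :=
      (lD i j).integrable_mul (lD j i)
    have o3 : ∫ z, D i j z * E j z ∂(piLaw m I) = 0 := by
      simp only [mul_comm (D i j _)]; exact o1 j i
    have s1 := sq_integral_antisymmMean_le hw hM i j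
    have s2 := sq_integral_antisymmMean_le hw hM j i
    have hsymm : A j i = A i j := by
      simp only [hA, Finset.filter_filter, and_comm]
    -- By orthogonality both factors may be replaced by their small remainders.
    have e : ∫ z, E i z * E j z ∂(piLaw m I) =
        ∫ z, (E i z - D i j z) * (E j z - D j i z) ∂(piLaw m I) := by
      have a1 : Integrable (fun z => E i z * E j z - E i z * D j i z) (piLaw m I) := ei.sub e1
      have a2 : Integrable (fun z => D i j z * E j z - D i j z * D j i z) (piLaw m I) :=
        e2.sub e3
      have : ∀ z, (E i z - D i j z) * (E j z - D j i z) =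
        (E i z * E j z - E i z * D j i z) - (D i j z * E j z - D i j z * D j i z) := fun z => by
        ring
      simp only [this]
      rw [integral_sub a1 a2, integral_sub ei e1, integral_sub e2 e3, o1, o2, o3]
      ring
    rw [e]
    have l1 : MemLp (fun z => E i z - D i j z) 2 (piLaw m I) := (lE i).sub (lD i j)
    have l2 : MemLp (fun z => E j z - D j i z) 2 (piLaw m I) := (lE j).sub (lD j i)
    calc ∫ z, (E i z - D i j z) * (E j z - D j i z) ∂(piLaw m I)
        ≤ ∫ z, (1 / 2 * (E i z - D i j z) ^ 2 + 1 / 2 * (E j z - D j i z) ^ 2) ∂(piLaw m I) :=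
          integral_mono (l1.integrable_mul l2)
            ((l1.integrable_sq.const_mul _).add (l2.integrable_sq.const_mul _)) fun z => by
              simp only
              nlinarith [sq_nonneg ((E i z - D i j z) - (E j z - D j i z))]
      _ ≤ 64 * M * A i j := by
          rw [integral_add (l1.integrable_sq.const_mul _) (l2.integrable_sq.const_mul _),
            integral_const_mul, integral_const_mul]
          have s2' : ∫ z, (E j z - D j i z) ^ 2 ∂(piLaw m I) ≤ 64 * M * A j i := s2
          have s1' : ∫ z, (E i z - D i j z) ^ 2 ∂(piLaw m I) ≤ 64 * M * A i j := s1
          rw [hsymm] at s2'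
          linarith
  have hsum : ∫ z, (∑ i, E i z) ^ 2 ∂(piLaw m I) = ∑ i, ∑ j, ∫ z, E i z * E j z ∂(piLaw m I) := by
    have ei : ∀ i j, Integrable (fun z => E i z * E j z) (piLaw m I) := fun i j =>
      (lE i).integrable_mul (lE j)
    simp only [sq, Finset.sum_mul_sum]
    rw [integral_finsetSum _ fun i _ => integrable_finsetSum _ fun j _ => ei i j]
    exact Finset.sum_congr rfl fun i _ => integral_finsetSum _ fun j _ => ei i j
  rw [hsum]
  calc ∑ i, ∑ j, ∫ z, E i z * E j z ∂(piLaw m I)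
      ≤ ∑ i, ∑ j, 64 * M * A i j :=
        Finset.sum_le_sum fun i _ => Finset.sum_le_sum fun j _ => hij i j
    -- A set `T` is counted once for each ordered pair of its coordinates.
    _ = 64 * M * ∑ T ∈ P, (#T : ℝ) * ((#T : ℝ) * hyperWeight m w T) := by
        simp only [← Finset.mul_sum, hA]
        congr 1
        rw [← sum_sum_filter_mem]
        exact Finset.sum_congr rfl fun i _ => sum_sum_filter_mem _
    _ ≤ 64 * M * (R ^ 2 * L) := by
        refine mul_le_mul_of_nonneg_left ?_ (by positivity)
        calc ∑ T ∈ P, (#T : ℝ) * ((#T : ℝ) * hyperWeight m w T)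
            ≤ ∑ T ∈ P, R ^ 2 * hyperWeight m w T := by
              refine Finset.sum_le_sum fun T hT => ?_
              rw [← mul_assoc, ← sq]
              exact mul_le_mul_of_nonneg_right (pow_le_pow_left₀ (Nat.cast_nonneg _) (hR T hT) 2)
                (hyperWeight_nonneg w T)
          _ ≤ R ^ 2 * L := by
              rw [← Finset.mul_sum]
              exact mul_le_mul_of_nonneg_left hL (sq_nonneg R)

/-- It suffices to test the orthogonality on bounded functions. -/
theorem orthAt_of_bounded {i : I} {F : (I → Z) → ℝ}
    (h : ∀ G : (I → Z) → ℝ, Measurable G → DependsOn G ({i}ᶜ : Set I) →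
      ∀ B : ℝ, (∀ z, |G z| ≤ B) → ∫ z, F z * G z ∂(piLaw m I) = 0) : OrthAt m i F := by
  intro G hG hd hint
  -- Truncating `G` by its own size keeps it free of the coordinate `i`, and `|F * G|` dominates.
  set Gn : ℕ → (I → Z) → ℝ := fun n z => if |G z| ≤ n then G z else 0 with hGn
  have hmeas : ∀ n, MeasurableSet {z | |G z| ≤ n} := fun n =>
    measurableSet_le hG.abs measurable_const
  have hz : ∀ n, ∫ z, F z * Gn n z ∂(piLaw m I) = 0 := by
    intro n
    refine h (Gn n) (Measurable.ite (hmeas n) hG measurable_const) (fun x y hxy => ?_) n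
      fun z => ?_
    · simp only [hGn, hd hxy]
    · simp only [hGn]
      split_ifs with hc
      · exact hc
      · simp
  have hlim : Filter.Tendsto (fun n => ∫ z, F z * Gn n z ∂(piLaw m I)) Filter.atTop
      (nhds (∫ z, F z * G z ∂(piLaw m I))) := by
    refine tendsto_integral_of_dominated_convergence (fun z => |F z * G z|) (fun n => ?_)
      hint.abs (fun n => Filter.Eventually.of_forall fun z => ?_)
      (Filter.Eventually.of_forall fun z => ?_)
    · have e : (fun z => F z * Gn n z) = {z | |G z| ≤ n}.indicator (fun z => F z * G z) := by
        ext z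
        simp only [hGn, Set.indicator, Set.mem_ofPred_eq]
        split_ifs <;> simp
      rw [e]
      exact hint.1.indicator (hmeas n)
    · simp only [hGn, Real.norm_eq_abs]
      split_ifs
      · exact le_rfl
      · rw [mul_zero, abs_zero]; exact abs_nonneg _
    · obtain ⟨n₀, hn₀⟩ := exists_nat_ge |G z|
      refine tendsto_const_nhds.congr' ?_
      filter_upwards [Filter.eventually_ge_atTop n₀] with n hn
      have : |G z| ≤ n := hn₀.trans (Nat.cast_le.2 hn)
      simp [hGn, this]
  simp only [hz] at hlim
  exact (tendsto_nhds_unique hlim tendsto_const_nhds)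

theorem orthAt_linPart {i : I} (hw : ∀ T ∈ P, Pure m T (w T)) (hi : ∀ T ∈ P, i ∈ T) :
    OrthAt m i (linPart c w P) :=
  orthAt_of_bounded fun G hG hd B hB =>
    OrthAt.sum (G := G) (fun T hT => ((hw T hT).orth i (hi T hT)).const_mul (c T))
      (fun T hT => (hw T hT).memLp.const_mul (c T)) hG hd (memLp_four_of_bound hG B hB)

/-- A Berry–Esseen bound for sums of Hoeffding components of bounded order in terms of the
influences of the coordinates. -/
theorem berryEsseen_of_influence (hw : ∀ T ∈ P, Pure m T (w T)) (hP : ∅ ∉ P)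
    {P₀ : Finset (Finset I)} (hP₀ : P₀ ⊆ P) {L R s : ℝ} (hs : 0 < s)
    (hR : ∀ T ∈ P, (#T : ℝ) ≤ R) (hL : ∑ T ∈ P, hyperWeight m w T ≤ L)
    (hM : ∀ i, ∑ T ∈ P.filter (i ∈ ·), hyperWeight m w T ≤ L / s ^ 2)
    (hL₁ : ∑ T ∈ P \ P₀, hyperWeight m w T ≤ L / s ^ 2)
    (hvar : ∫ z, (∑ T ∈ P, w T z) ^ 2 ∂(piLaw m I) = 1)
    (hQ : ∫ z, (∑ i, invPart w P₀ i z * fullPart w P₀ i z -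
      ∫ z', ∑ i, invPart w P₀ i z' * fullPart w P₀ i z' ∂(piLaw m I)) ^ 2 ∂(piLaw m I) ≤
        L / s ^ 2) (t : ℝ) :
    |(piLaw m I).real {z | ∑ T ∈ P, w T z ≤ t} - ncdf t| ≤
      (L + 2 + 8 * R * L + 64 * L ^ 2 * R ^ 2) / s := by
  have hL0 : 0 ≤ L := (Finset.sum_nonneg fun T _ => hyperWeight_nonneg w T).trans hL
  have hw₀ : ∀ T ∈ P₀, Pure m T (w T) := fun T hT => hw T (hP₀ hT)
  have hw₁ : ∀ T ∈ P \ P₀, Pure m T (w T) := fun T hT => hw T (Finset.sdiff_subset hT)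
  have fw : ∀ {S : Finset (Finset I)}, (∀ T ∈ S, Pure m T (w T)) → ∀ i,
      ∀ T ∈ S.filter (i ∈ ·), Pure m T (w T) := fun h i T hT => h T (Finset.filter_subset _ _ hT)
  have h1 : ∀ T : Finset I, |(fun _ : Finset I => (1 : ℝ)) T| ≤ 1 := fun T => by simp
  have mem := fun (S : Finset (Finset I)) (i : I) (T : Finset I) (hT : T ∈ S.filter (i ∈ ·)) =>
    (Finset.mem_filter.1 hT).2
  have main := abs_sub_ncdf_le (m := m) t (h := invPart w P) (u := fullPart w P)
    (W := fun z => ∑ T ∈ P, w T z)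
    (fun i => measurable_linPart (fw hw i)) (fun i => measurable_linPart (fw hw i))
    (fun i => memLp_linPart (fw hw i)) (fun i => memLp_linPart (fw hw i))
    (fun i => orthAt_linPart (fw hw i) (mem P i)) (fun i => orthAt_linPart (fw hw i) (mem P i))
    (fun z => (sum_invPart hP z).symm) (fun i => by
      have e : (fun z => ∑ T ∈ P, w T z - fullPart w P i z) =
          linPart (fun _ => 1) w (P.filter (i ∉ ·)) := by
        ext z
        have := linPart_filter_add (c := fun _ => (1 : ℝ)) (w := w) (P := P) (i ∈ ·) z
        simp only [fullPart]
        rw [sub_eq_iff_eq_add, this]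
        simp [linPart]
      rw [e]
      exact dependsOn_linPart (fun T hT => hw T (Finset.filter_subset _ _ hT))
        fun T hT => (Finset.mem_filter.1 hT).2)
  refine main.trans ?_
  -- the antisymmetric term
  have lE : MemLp (fun z => ∑ i, antisymmMean m i (invPart w P i) (fullPart w P i) z) 2
      (piLaw m I) := memLp_finsetSum _ fun i _ =>
    memLp_two_antisymmMean i (memLp_linPart (fw hw i)) (memLp_linPart (fw hw i))
  have bE := integral_abs_le_of_sq lE hs (B := 64 * L ^ 2 * R ^ 2)
    ((integral_sq_sum_antisymmMean_le hw hR hL (by positivity) hM).trans (le_of_eq (by ring)))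
  -- the splitting of the quadratic term
  set Q : (I → Z) → ℝ := fun z => ∑ i, invPart w P₀ i z * fullPart w P₀ i z with hQdef
  set V : (I → Z) → ℝ := fun z => ∑ i, (invPart w (P \ P₀) i z * fullPart w P i z +
    invPart w P₀ i z * fullPart w (P \ P₀) i z) with hVdef
  have split : ∀ (c : Finset I → ℝ) i z, linPart c w (P.filter (i ∈ ·)) z =
      linPart c w (P₀.filter (i ∈ ·)) z + linPart c w ((P \ P₀).filter (i ∈ ·)) z := by
    intro c i z
    simp only [linPart]
    rw [← Finset.sum_union]
    · congr 1
      rw [← Finset.filter_union, Finset.union_sdiff_of_subset hP₀]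
    · exact Finset.disjoint_filter_filter Finset.disjoint_sdiff
  have hQV : ∀ z, ∑ i, invPart w P i z * fullPart w P i z = Q z + V z := by
    intro z
    simp only [hQdef, hVdef, ← Finset.sum_add_distrib]
    refine Finset.sum_congr rfl fun i _ => ?_
    simp only [invPart, fullPart, split _ i z]
    ring
  have ip : ∀ {S S' : Finset (Finset I)} {c c' : Finset I → ℝ}, (∀ T ∈ S, Pure m T (w T)) →
      (∀ T ∈ S', Pure m T (w T)) → ∀ i, MemLp (fun z => linPart c w (S.filter (i ∈ ·)) z *
        linPart c' w (S'.filter (i ∈ ·)) z) 2 (piLaw m I) := fun hS hS' i =>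
    memLp_two_mul (memLp_linPart (fw hS i)) (memLp_linPart (fw hS' i))
  have lQ : MemLp Q 2 (piLaw m I) := memLp_finsetSum _ fun i _ => ip hw₀ hw₀ i
  have lV : MemLp V 2 (piLaw m I) := memLp_finsetSum _ fun i _ =>
    (ip hw₁ hw i).add (ip hw₀ hw₁ i)
  have iQ : Integrable Q (piLaw m I) := lQ.integrable (by norm_num)
  have iV : Integrable V (piLaw m I) := lV.integrable (by norm_num)
  -- By orthogonality `∑ i, h i u i` has mean `∑ T, |T| * |T|⁻¹ * ∫ (w T)²`, which is the variance.
  have hmean : ∫ z, Q z ∂(piLaw m I) + ∫ z, V z ∂(piLaw m I) = 1 := by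
    rw [← integral_add iQ iV, ← hvar]
    simp only [← hQV]
    have ihu : ∀ i, Integrable (fun z => invPart w P i z * fullPart w P i z) (piLaw m I) :=
      fun i => (ip hw hw i).integrable (by norm_num)
    rw [integral_finsetSum _ fun i _ => ihu i]
    have e1 : ∀ i, ∫ z, invPart w P i z * fullPart w P i z ∂(piLaw m I) =
        ∑ T ∈ P.filter (i ∈ ·), invCard T * 1 * ∫ z, w T z ^ 2 ∂(piLaw m I) := fun i =>
      integral_linPart_mul_linPart (fw hw i)
    have e2 := integral_linPart_mul_linPart (c := fun _ => (1 : ℝ)) (c' := fun _ => 1) hw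
    simp only [linPart, one_mul, ← sq] at e2
    rw [e2, Finset.sum_congr rfl fun i _ => e1 i, sum_sum_filter_mem]
    refine Finset.sum_congr rfl fun T hT => ?_
    have : (#T : ℝ) ≠ 0 := by
      rw [Nat.cast_ne_zero, Finset.card_ne_zero, Finset.nonempty_iff_ne_empty]
      rintro rfl
      exact hP hT
    rw [invCard, mul_one, ← mul_assoc, mul_inv_cancel₀ this, one_pow]
  have bQ := integral_abs_le_of_sq (lQ.sub (memLp_const (∫ z, Q z ∂(piLaw m I)))) hs hQ
  have bV : ∫ z, |V z| ∂(piLaw m I) ≤ 2 * R * L / s := by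
    have bsum : ∀ {S : Finset (Finset I)} {c : Finset I → ℝ}, S ⊆ P → (∀ T, |c T| ≤ 1) →
        ∑ i, ∫ z, linPart c w (S.filter (i ∈ ·)) z ^ 2 ∂(piLaw m I) ≤
          R * ∑ T ∈ S, hyperWeight m w T := by
      intro S c hS hc
      have hwS : ∀ T ∈ S, Pure m T (w T) := fun T hT => hw T (hS hT)
      calc _ ≤ ∑ i, ∑ T ∈ S.filter (i ∈ ·), hyperWeight m w T :=
            Finset.sum_le_sum fun i _ => (integral_sq_le_sqNorm4 (memLp_linPart (fw hwS i))).trans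
              (sqNorm4_linPart_le (fw hwS i) hc)
        _ ≤ _ := by
            rw [sum_sum_filter_mem, Finset.mul_sum]
            exact Finset.sum_le_sum fun T hT =>
              mul_le_mul_of_nonneg_right (hR T (hS hT)) (hyperWeight_nonneg w T)
    have sqi : ∀ {S : Finset (Finset I)} {c : Finset I → ℝ}, S ⊆ P → ∀ i,
        Integrable (fun z => linPart c w (S.filter (i ∈ ·)) z ^ 2) (piLaw m I) := fun hS i =>
      integrable_sq_of_four (memLp_linPart (fw (fun T hT => hw T (hS hT)) i))
    have hsub : P \ P₀ ⊆ P := Finset.sdiff_subset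
    -- The weight `s` balances a factor of squared size `L / s ^ 2`, from above the principal level,
    -- against one of squared size `L`.
    have amgm : ∀ x y : ℝ, |x * y| ≤ s / 2 * x ^ 2 + 1 / (2 * s) * y ^ 2 := by
      intro x y
      rw [abs_mul]
      have e : s / 2 * x ^ 2 + 1 / (2 * s) * y ^ 2 - |x| * |y| =
          (s * |x| - |y|) ^ 2 / (2 * s) := by
        rw [← sq_abs x, ← sq_abs y]; field_simp; ring
      have : 0 ≤ (s * |x| - |y|) ^ 2 / (2 * s) := by positivity
      linarith
    calc ∫ z, |V z| ∂(piLaw m I)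
        ≤ ∫ z, ∑ i, ((s / 2 * invPart w (P \ P₀) i z ^ 2 + 1 / (2 * s) * fullPart w P i z ^ 2) +
            (s / 2 * fullPart w (P \ P₀) i z ^ 2 + 1 / (2 * s) * invPart w P₀ i z ^ 2))
            ∂(piLaw m I) := by
          refine integral_mono iV.abs (integrable_finsetSum _ fun i _ =>
            (((sqi hsub i).const_mul _).add ((sqi subset_rfl i).const_mul _)).add
            (((sqi hsub i).const_mul _).add ((sqi hP₀ i).const_mul _))) fun z => ?_
          refine (Finset.abs_sum_le_sum_abs _ _).trans (Finset.sum_le_sum fun i _ =>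
            (abs_add_le _ _).trans (add_le_add (amgm _ _) ?_))
          rw [mul_comm]
          exact amgm _ _
      _ = s / 2 * ∑ i, ∫ z, invPart w (P \ P₀) i z ^ 2 ∂(piLaw m I) +
          1 / (2 * s) * ∑ i, ∫ z, fullPart w P i z ^ 2 ∂(piLaw m I) +
          (s / 2 * ∑ i, ∫ z, fullPart w (P \ P₀) i z ^ 2 ∂(piLaw m I) +
          1 / (2 * s) * ∑ i, ∫ z, invPart w P₀ i z ^ 2 ∂(piLaw m I)) := by
          have a1 : ∀ i, Integrable (fun z => s / 2 * invPart w (P \ P₀) i z ^ 2) (piLaw m I) :=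
            fun i => (sqi hsub i).const_mul _
          have a2 : ∀ i, Integrable (fun z => 1 / (2 * s) * fullPart w P i z ^ 2) (piLaw m I) :=
            fun i => (sqi subset_rfl i).const_mul _
          have a3 : ∀ i, Integrable (fun z => s / 2 * fullPart w (P \ P₀) i z ^ 2) (piLaw m I) :=
            fun i => (sqi hsub i).const_mul _
          have a4 : ∀ i, Integrable (fun z => 1 / (2 * s) * invPart w P₀ i z ^ 2) (piLaw m I) :=
            fun i => (sqi hP₀ i).const_mul _
          have a5 : ∀ i, Integrable (fun z => s / 2 * invPart w (P \ P₀) i z ^ 2 +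
            1 / (2 * s) * fullPart w P i z ^ 2) (piLaw m I) := fun i => (a1 i).add (a2 i)
          have a6 : ∀ i, Integrable (fun z => s / 2 * fullPart w (P \ P₀) i z ^ 2 +
            1 / (2 * s) * invPart w P₀ i z ^ 2) (piLaw m I) := fun i => (a3 i).add (a4 i)
          have a7 : ∀ i, Integrable (fun z => (s / 2 * invPart w (P \ P₀) i z ^ 2 +
            1 / (2 * s) * fullPart w P i z ^ 2) + (s / 2 * fullPart w (P \ P₀) i z ^ 2 +
            1 / (2 * s) * invPart w P₀ i z ^ 2)) (piLaw m I) := fun i => (a5 i).add (a6 i)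
          rw [integral_finsetSum _ fun i _ => a7 i]
          simp only [Finset.mul_sum, ← Finset.sum_add_distrib]
          refine Finset.sum_congr rfl fun i _ => ?_
          rw [integral_add (a5 i) (a6 i), integral_add (a1 i) (a2 i), integral_add (a3 i) (a4 i),
            integral_const_mul, integral_const_mul, integral_const_mul, integral_const_mul]
      _ ≤ s / 2 * (R * (L / s ^ 2)) + 1 / (2 * s) * (R * L) +
          (s / 2 * (R * (L / s ^ 2)) + 1 / (2 * s) * (R * L)) := by
          -- The unit variance excludes the empty family; a member of `P` is needed to see that `R`
          -- is nonnegative.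
          rcases P.eq_empty_or_nonempty with hPe | ⟨T₀, hT₀⟩
          · subst hPe; simp at hvar
          have hR0 : 0 ≤ R := (Nat.cast_nonneg _).trans (hR T₀ hT₀)
          have k1 := (bsum hsub (abs_invCard_le (I := I))).trans
            (mul_le_mul_of_nonneg_left hL₁ hR0)
          have k2 := (bsum (subset_refl P) h1).trans (mul_le_mul_of_nonneg_left hL hR0)
          have k3 := (bsum hsub h1).trans (mul_le_mul_of_nonneg_left hL₁ hR0)
          have k4 := (bsum hP₀ (abs_invCard_le (I := I))).trans (mul_le_mul_of_nonneg_left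
            ((Finset.sum_le_sum_of_subset_of_nonneg hP₀
              fun T _ _ => hyperWeight_nonneg w T).trans hL) hR0)
          have s2 : 0 ≤ s / 2 := by positivity
          have s3 : 0 ≤ 1 / (2 * s) := by positivity
          exact add_le_add (add_le_add (mul_le_mul_of_nonneg_left k1 s2)
            (mul_le_mul_of_nonneg_left k2 s3)) (add_le_add (mul_le_mul_of_nonneg_left k3 s2)
            (mul_le_mul_of_nonneg_left k4 s3))
      _ = 2 * R * L / s := by field_simp; ring
  have bmain : ∫ z, |1 - ∑ i, invPart w P i z * fullPart w P i z| ∂(piLaw m I) ≤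
      (L + 1) / 2 / s + 2 * (2 * R * L / s) := by
    have iq : Integrable (fun z => |Q z - ∫ z', Q z' ∂(piLaw m I)|) (piLaw m I) :=
      (iQ.sub (integrable_const _)).abs
    have iqv : Integrable (fun z => |Q z - ∫ z', Q z' ∂(piLaw m I)| + |V z|) (piLaw m I) :=
      iq.add iV.abs
    calc _ ≤ ∫ z, ((|Q z - ∫ z', Q z' ∂(piLaw m I)| + |V z|) + |∫ z', V z' ∂(piLaw m I)|)
            ∂(piLaw m I) := by
          refine integral_mono_of_nonneg (Filter.Eventually.of_forall fun z => abs_nonneg _)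
            (iqv.add (integrable_const _)) (Filter.Eventually.of_forall fun z => ?_)
          simp only [hQV z]
          rw [← hmean, abs_le]
          have q1 := abs_le.1 (le_refl |Q z - ∫ z', Q z' ∂(piLaw m I)|)
          have q2 := abs_le.1 (le_refl |V z|)
          have q3 := abs_le.1 (le_refl |∫ z', V z' ∂(piLaw m I)|)
          constructor <;> linarith
      _ ≤ _ := by
          rw [integral_add iqv (integrable_const _), integral_add iq iV.abs]
          have q3 : |∫ z', V z' ∂(piLaw m I)| ≤ ∫ z, |V z| ∂(piLaw m I) :=
            abs_integral_le_integral_abs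
          have q4 : ∫ z, |Q z - ∫ z', Q z' ∂(piLaw m I)| ∂(piLaw m I) ≤ (L + 1) / 2 / s := bQ
          simp only [integral_const, probReal_univ, one_smul]
          linarith
  have fin : (L + 2 + 8 * R * L + 64 * L ^ 2 * R ^ 2) / s =
      2 * ((L + 1) / 2 / s + 2 * (2 * R * L / s)) + 2 * ((64 * L ^ 2 * R ^ 2 + 1) / 2 / s) := by
    field_simp; ring
  rw [fin]
  exact add_le_add (mul_le_mul_of_nonneg_left bmain (by norm_num))
    (mul_le_mul_of_nonneg_left bE (by norm_num))

end Influence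

/-! ### Vanishing covariances of products of components with connected graphs. -/

section Covariances

variable {I Z N : Type*} [Fintype I] [DecidableEq I] [MeasurableSpace Z] [DecidableEq N]
  {m : Measure Z} [IsProbabilityMeasure m]
  {w : Finset I → (I → Z) → ℝ} {P : Finset (Finset I)}

/-- A coordinate seen by only one factor annihilates the mean, by degeneracy of that factor. -/
theorem integral_mul_four_eq_zero {A B C D : Finset I} (hA : Pure m A (w A)) (hB : Pure m B (w B))
    (hC : Pure m C (w C)) (hD : Pure m D (w D)) {t : I} (ht : t ∈ A) (htB : t ∉ B) (htC : t ∉ C)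
    (htD : t ∉ D) : ∫ z, w A z * w B z * w C z * w D z ∂(piLaw m I) = 0 := by
  simp only [mul_assoc]
  refine hA.integral_mul_eq_zero ht (hB.meas.mul (hC.meas.mul hD.meas)) ?_
  exact dependsOn_comp_binary (· * ·) (hB.dep_compl htB)
    (dependsOn_comp_binary (· * ·) (hC.dep_compl htC) (hD.dep_compl htD))

theorem integral_mul_two_eq_zero {A B : Finset I} (hA : Pure m A (w A)) (hB : Pure m B (w B))
    {t : I} (ht : t ∈ A) (htB : t ∉ B) : ∫ z, w A z * w B z ∂(piLaw m I) = 0 :=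
  hA.integral_mul_eq_zero ht hB.meas (hB.dep_compl htB)

/-- The covariance of `w_A w_B` and `w_C w_D`. -/
noncomputable def cov4 (m : Measure Z) (w : Finset I → (I → Z) → ℝ) (A B C D : Finset I) : ℝ :=
  ∫ z, w A z * w B z * w C z * w D z ∂(piLaw m I) -
    (∫ z, w A z * w B z ∂(piLaw m I)) * ∫ z, w C z * w D z ∂(piLaw m I)

theorem abs_cov4_le {A B C D : Finset I} (hA : Pure m A (w A)) (hB : Pure m B (w B))
    (hC : Pure m C (w C)) (hD : Pure m D (w D)) {M : ℝ} (bA : sqNorm4 (piLaw m I) (w A) ≤ M)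
    (bB : sqNorm4 (piLaw m I) (w B) ≤ M) (bC : sqNorm4 (piLaw m I) (w C) ≤ M)
    (bD : sqNorm4 (piLaw m I) (w D) ≤ M) : |cov4 m w A B C D| ≤ 2 * M ^ 2 := by
  have hM : 0 ≤ M := (sqNorm4_nonneg _).trans bA
  have four : ∀ {T}, sqNorm4 (piLaw m I) (w T) ≤ M → ∫ z, w T z ^ 4 ∂(piLaw m I) ≤ M ^ 2 :=
    fun h => by rw [← sq_sqNorm4]; exact pow_le_pow_left₀ (sqNorm4_nonneg _) h 2
  have two : ∀ {S T}, Pure m S (w S) → Pure m T (w T) → sqNorm4 (piLaw m I) (w S) ≤ M →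
      sqNorm4 (piLaw m I) (w T) ≤ M → |∫ z, w S z * w T z ∂(piLaw m I)| ≤ M := by
    intro S T hS hT bS bT
    have iS := integrable_sq_of_four hS.memLp
    have iT := integrable_sq_of_four hT.memLp
    calc |∫ z, w S z * w T z ∂(piLaw m I)| ≤ ∫ z, |w S z * w T z| ∂(piLaw m I) :=
          abs_integral_le_integral_abs
      _ ≤ ∫ z, (1 / 2 * w S z ^ 2 + 1 / 2 * w T z ^ 2) ∂(piLaw m I) := by
          refine integral_mono (integrable_mul_two hS.memLp hT.memLp).abs
            ((iS.const_mul _).add (iT.const_mul _)) fun z => ?_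
          simp only
          rw [abs_le]
          constructor <;> nlinarith [sq_nonneg (w S z - w T z), sq_nonneg (w S z + w T z)]
      _ ≤ M := by
          rw [integral_add (iS.const_mul _) (iT.const_mul _), integral_const_mul,
            integral_const_mul]
          linarith [(integral_sq_le_sqNorm4 hS.memLp).trans bS,
            (integral_sq_le_sqNorm4 hT.memLp).trans bT]
  have h4 : |∫ z, w A z * w B z * w C z * w D z ∂(piLaw m I)| ≤ M ^ 2 := by
    have iA := integrable_pow_four hA.memLp
    have iB := integrable_pow_four hB.memLp
    have iC := integrable_pow_four hC.memLp
    have iD := integrable_pow_four hD.memLp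
    have iAB : Integrable (fun z => w A z ^ 4 + w B z ^ 4) (piLaw m I) := iA.add iB
    have iABC : Integrable (fun z => w A z ^ 4 + w B z ^ 4 + w C z ^ 4) (piLaw m I) := iAB.add iC
    calc |∫ z, w A z * w B z * w C z * w D z ∂(piLaw m I)|
        ≤ ∫ z, |w A z * w B z * w C z * w D z| ∂(piLaw m I) := abs_integral_le_integral_abs
      _ ≤ ∫ z, (w A z ^ 4 + w B z ^ 4 + w C z ^ 4 + w D z ^ 4) / 4 ∂(piLaw m I) :=
          integral_mono (integrable_mul_four hA.memLp hB.memLp hC.memLp hD.memLp).abs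
            ((iABC.add iD).div_const 4) fun z => abs_mul_four_le _ _ _ _
      _ ≤ M ^ 2 := by
          rw [integral_div, integral_add iABC iD, integral_add iAB iC, integral_add iA iB]
          linarith [four bA, four bB, four bC, four bD]
  have h2 : |(∫ z, w A z * w B z ∂(piLaw m I)) * ∫ z, w C z * w D z ∂(piLaw m I)| ≤ M ^ 2 := by
    rw [abs_mul, sq]
    exact mul_le_mul (two hA hB bA bB) (two hC hD bC bD) (abs_nonneg _) hM
  have := abs_sub (∫ z, w A z * w B z * w C z * w D z ∂(piLaw m I))
    ((∫ z, w A z * w B z ∂(piLaw m I)) * ∫ z, w C z * w D z ∂(piLaw m I))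
  rw [cov4]
  linarith

/-- The nodes touched by a set of coordinates. -/
def nodes (nd : I → Finset N) (T : Finset I) : Finset N := T.biUnion nd

/-- Every cut of the nodes of `T` is crossed by an element of `T`. -/
def CutConnected (nd : I → Finset N) (T : Finset I) : Prop :=
  ∀ U : Finset N, U ⊆ nodes nd T → U.Nonempty → U ≠ nodes nd T →
    ∃ t ∈ T, (∃ a ∈ nd t, a ∈ U) ∧ ∃ b ∈ nd t, b ∉ U

theorem mem_nodes {nd : I → Finset N} {T : Finset I} {x : N} :
    x ∈ nodes nd T ↔ ∃ t ∈ T, x ∈ nd t := Finset.mem_biUnion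

/-- A node touched by one set only comes from a coordinate of that set which belongs to none of the
others; both means in the covariance then vanish. -/
theorem cov4_eq_zero_of_mem_one {nd : I → Finset N} {A B C D : Finset I} (hA : Pure m A (w A))
    (hB : Pure m B (w B)) (hC : Pure m C (w C)) (hD : Pure m D (w D)) {x : N}
    (h : (x ∈ nodes nd A ∧ x ∉ nodes nd B ∧ x ∉ nodes nd C ∧ x ∉ nodes nd D) ∨
      (x ∉ nodes nd A ∧ x ∈ nodes nd B ∧ x ∉ nodes nd C ∧ x ∉ nodes nd D) ∨
      (x ∉ nodes nd A ∧ x ∉ nodes nd B ∧ x ∈ nodes nd C ∧ x ∉ nodes nd D) ∨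
      (x ∉ nodes nd A ∧ x ∉ nodes nd B ∧ x ∉ nodes nd C ∧ x ∈ nodes nd D)) :
    cov4 m w A B C D = 0 := by
  have key : ∀ {S T : Finset I} {t : I}, x ∉ nodes nd T → t ∈ S → x ∈ nd t → t ∉ T :=
    fun hT _ hx hc => hT (mem_nodes.2 ⟨_, hc, hx⟩)
  rw [cov4]
  rcases h with ⟨h1, h2, h3, h4⟩ | ⟨h1, h2, h3, h4⟩ | ⟨h1, h2, h3, h4⟩ | ⟨h1, h2, h3, h4⟩
  · obtain ⟨t, ht, hx⟩ := mem_nodes.1 h1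
    rw [integral_mul_four_eq_zero hA hB hC hD ht (key h2 ht hx) (key h3 ht hx) (key h4 ht hx),
      integral_mul_two_eq_zero hA hB ht (key h2 ht hx)]
    simp
  · obtain ⟨t, ht, hx⟩ := mem_nodes.1 h2
    have e1 := integral_mul_four_eq_zero hB hA hC hD ht (key h1 ht hx) (key h3 ht hx) (key h4 ht hx)
    have e2 := integral_mul_two_eq_zero hB hA ht (key h1 ht hx)
    simp only [mul_comm (w B _)] at e1 e2
    rw [e1, e2]
    simp
  · obtain ⟨t, ht, hx⟩ := mem_nodes.1 h3
    have e1 := integral_mul_four_eq_zero hC hA hB hD ht (key h1 ht hx) (key h2 ht hx) (key h4 ht hx)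
    have e2 := integral_mul_two_eq_zero hC hD ht (key h4 ht hx)
    have e : ∀ z, w A z * w B z * w C z * w D z = w C z * w A z * w B z * w D z := fun z => by ring
    simp only [e]
    rw [e1, e2]
    simp
  · obtain ⟨t, ht, hx⟩ := mem_nodes.1 h4
    have e1 := integral_mul_four_eq_zero hD hA hB hC ht (key h1 ht hx) (key h2 ht hx) (key h3 ht hx)
    have e2 := integral_mul_two_eq_zero hD hC ht (key h3 ht hx)
    have e : ∀ z, w A z * w B z * w C z * w D z = w D z * w A z * w B z * w C z := fun z => by ring
    simp only [mul_comm (w D _)] at e2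
    simp only [e]
    rw [e1, e2]
    simp

theorem sum_indicator_card {U V : Finset N} (h : V ⊆ U) :
    ∑ x ∈ U, (if x ∈ V then 1 else 0) = #V := by
  rw [← Finset.sum_filter, Finset.filter_mem_eq_inter, Finset.inter_eq_right.2 h]
  simp

/-- The covariances which involve many nodes vanish. -/
theorem cov4_eq_zero {nd : I → Finset N} (hnd : ∀ i, (nd i).Nonempty) {A B C D : Finset I}
    (hA : Pure m A (w A)) (hB : Pure m B (w B)) (hC : Pure m C (w C)) (hD : Pure m D (w D))
    {d : ℕ} (dA : #(nodes nd A) = d) (dB : #(nodes nd B) = d) (dC : #(nodes nd C) = d)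
    (dD : #(nodes nd D) = d) (hcut : CutConnected nd A) (hAB : (A ∩ B).Nonempty)
    (hU : 2 * d ≤ #(nodes nd A ∪ nodes nd B ∪ nodes nd C ∪ nodes nd D)) :
    cov4 m w A B C D = 0 := by
  by_cases hone : ∃ x, (x ∈ nodes nd A ∧ x ∉ nodes nd B ∧ x ∉ nodes nd C ∧ x ∉ nodes nd D) ∨
      (x ∉ nodes nd A ∧ x ∈ nodes nd B ∧ x ∉ nodes nd C ∧ x ∉ nodes nd D) ∨
      (x ∉ nodes nd A ∧ x ∉ nodes nd B ∧ x ∈ nodes nd C ∧ x ∉ nodes nd D) ∨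
      (x ∉ nodes nd A ∧ x ∉ nodes nd B ∧ x ∉ nodes nd C ∧ x ∈ nodes nd D)
  · obtain ⟨x, hx⟩ := hone
    exact cov4_eq_zero_of_mem_one hA hB hC hD hx
  set VA := nodes nd A with hVA
  set VB := nodes nd B with hVB
  set VC := nodes nd C with hVC
  set VD := nodes nd D with hVD
  set U := VA ∪ VB ∪ VC ∪ VD with hUdef
  have sA : VA ⊆ U := fun x hx => by simp [hUdef, hx]
  have sB : VB ⊆ U := fun x hx => by simp [hUdef, hx]
  have sC : VC ⊆ U := fun x hx => by simp [hUdef, hx]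
  have sD : VD ⊆ U := fun x hx => by simp [hUdef, hx]
  -- In how many of the four node sets a node lies. No node has multiplicity one, the multiplicities
  -- add up to `4 * d`, and there are at least `2 * d` nodes; hence every node lies in exactly two.
  set mult : N → ℕ := fun x => (if x ∈ VA then 1 else 0) + (if x ∈ VB then 1 else 0) +
    (if x ∈ VC then 1 else 0) + (if x ∈ VD then 1 else 0) with hmult
  have hge : ∀ x ∈ U, 2 ≤ mult x := by
    intro x hx
    have h1 : ¬ _ := fun h => hone ⟨x, h⟩
    simp only [hUdef, Finset.mem_union] at hx
    simp only [hmult]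
    by_cases a : x ∈ VA <;> by_cases b : x ∈ VB <;> by_cases c : x ∈ VC <;> by_cases e : x ∈ VD <;>
      simp_all
  have hsum : ∑ x ∈ U, mult x = 4 * d := by
    simp only [hmult, Finset.sum_add_distrib]
    rw [sum_indicator_card sA, sum_indicator_card sB, sum_indicator_card sC,
      sum_indicator_card sD, dA, dB, dC, dD]
    ring
  have heq : ∀ x ∈ U, 2 = mult x := by
    refine (Finset.sum_eq_sum_iff_of_le hge).1 (le_antisymm (Finset.sum_le_sum hge) ?_)
    rw [hsum, Finset.sum_const, smul_eq_mul]
    omega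
  -- If the node sets of `A` and `B` agree, they use up the multiplicity, so `C` and `D` live on
  -- other nodes and the two products are independent.
  by_cases hV : VA = VB
  · have dis : ∀ x ∈ VA, x ∉ VC ∧ x ∉ VD := by
      intro x hx
      have h := heq x (sA hx)
      have hb : x ∈ VB := hV ▸ hx
      simp only [hmult, if_pos hx, if_pos hb] at h
      constructor <;> intro hc <;> rw [if_pos hc] at h <;> split_ifs at h <;> omega
    have hdis : Disjoint (A ∪ B) (C ∪ D) := by
      rw [Finset.disjoint_left]
      intro t ht ht'
      obtain ⟨x, hx⟩ := hnd t
      have h1 : x ∈ VA := by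
        rcases Finset.mem_union.1 ht with h | h
        · exact mem_nodes.2 ⟨t, h, hx⟩
        · rw [hV]; exact mem_nodes.2 ⟨t, h, hx⟩
      rcases Finset.mem_union.1 ht' with h | h
      · exact (dis x h1).1 (mem_nodes.2 ⟨t, h, hx⟩)
      · exact (dis x h1).2 (mem_nodes.2 ⟨t, h, hx⟩)
    have dAB : DependsOn (fun z => w A z * w B z) ((A ∪ B : Finset I) : Set I) :=
      dependsOn_comp_binary (· * ·) (hA.dep.mono (by simp)) (hB.dep.mono (by simp))
    have dCD : DependsOn (fun z => w C z * w D z) ((C ∪ D : Finset I) : Set I) :=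
      dependsOn_comp_binary (· * ·) (hC.dep.mono (by simp)) (hD.dep.mono (by simp))
    rw [cov4, ← integral_mul_of_disjoint m (F := fun z => w A z * w B z)
      (G := fun z => w C z * w D z) (hA.meas.mul hB.meas) (hC.meas.mul hD.meas) dAB dCD hdis]
    simp only [mul_assoc, sub_self]
  · obtain ⟨t₀, ht₀⟩ := hAB
    obtain ⟨x₀, hx₀⟩ := hnd t₀
    have hne : (VA ∩ VB).Nonempty := ⟨x₀, Finset.mem_inter.2
      ⟨mem_nodes.2 ⟨t₀, (Finset.mem_inter.1 ht₀).1, hx₀⟩,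
        mem_nodes.2 ⟨t₀, (Finset.mem_inter.1 ht₀).2, hx₀⟩⟩⟩
    have hproper : VA ∩ VB ≠ VA := by
      intro h
      exact hV (Finset.eq_of_subset_of_card_le (Finset.inter_eq_left.1 h) (by omega))
    -- Connectedness gives a coordinate `t` of `A` that crosses the cut `VA ∩ VB`. Its end outside
    -- `VB` keeps it out of `B`; its end in `VA ∩ VB` already has multiplicity two and keeps it out
    -- of `C` and `D`.
    obtain ⟨t, ht, ⟨a, hat, haU⟩, b, hbt, hbU⟩ := hcut _ Finset.inter_subset_left hne hproper
    have hbA : b ∈ VA := mem_nodes.2 ⟨t, ht, hbt⟩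
    have hbB : b ∉ VB := fun h => hbU (Finset.mem_inter.2 ⟨hbA, h⟩)
    obtain ⟨haA, haB⟩ := Finset.mem_inter.1 haU
    have ha := heq a (sA haA)
    have haC : a ∉ VC ∧ a ∉ VD := by
      simp only [hmult, if_pos haB] at ha
      constructor <;> intro hc <;> rw [if_pos hc] at ha <;> split_ifs at ha <;> omega
    have htB : t ∉ B := fun h => hbB (mem_nodes.2 ⟨t, h, hbt⟩)
    have htC : t ∉ C := fun h => haC.1 (mem_nodes.2 ⟨t, h, hat⟩)
    have htD : t ∉ D := fun h => haC.2 (mem_nodes.2 ⟨t, h, hat⟩)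
    rw [cov4, integral_mul_four_eq_zero hA hB hC hD ht htB htC htD,
      integral_mul_two_eq_zero hA hB ht htB]
    simp

/-- The coefficient of a pair lies in `[0, 1]` and vanishes for disjoint sets, so that only
intersecting pairs matter in the variance. -/
theorem sum_invPart_mul_fullPart (z : I → Z) :
    ∑ i, invPart w P i z * fullPart w P i z =
      ∑ p ∈ P ×ˢ P, (invCard p.1 * #(p.1 ∩ p.2)) * (w p.1 z * w p.2 z) := by
  simp only [invPart, fullPart, linPart, Finset.sum_filter, Finset.sum_mul_sum]
  rw [Finset.sum_comm, Finset.sum_product]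
  refine Finset.sum_congr rfl fun S _ => ?_
  rw [Finset.sum_comm]
  refine Finset.sum_congr rfl fun T _ => ?_
  have : ∀ i, (if i ∈ S then invCard S * w S z else 0) * (if i ∈ T then 1 * w T z else 0) =
      if i ∈ S ∩ T then invCard S * w S z * w T z else 0 := fun i => by
    by_cases h1 : i ∈ S <;> by_cases h2 : i ∈ T <;> simp [h1, h2]
  simp only [this]
  rw [← Finset.sum_filter, Finset.sum_const, nsmul_eq_mul, Finset.filter_univ_mem]
  ring

theorem invCard_mul_card_inter_le (S T : Finset I) :
    0 ≤ invCard S * #(S ∩ T) ∧ invCard S * #(S ∩ T) ≤ 1 := by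
  refine ⟨by rw [invCard]; positivity, ?_⟩
  rw [invCard]
  have : (#(S ∩ T) : ℝ) ≤ #S := Nat.cast_le.2 (Finset.card_le_card Finset.inter_subset_left)
  exact (mul_le_mul_of_nonneg_left this (by positivity)).trans (inv_mul_le_one)

/-- The variance of the quadratic term. -/
theorem integral_sq_sub_le {nd : I → Finset N} (hnd : ∀ i, (nd i).Nonempty)
    (hw : ∀ T ∈ P, Pure m T (w T)) {d : ℕ} (hd : ∀ T ∈ P, #(nodes nd T) = d)
    (hcut : ∀ T ∈ P, CutConnected nd T) {M : ℝ} (hM : ∀ T ∈ P, sqNorm4 (piLaw m I) (w T) ≤ M) :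
    ∫ z, (∑ i, invPart w P i z * fullPart w P i z -
      ∫ z', ∑ i, invPart w P i z' * fullPart w P i z' ∂(piLaw m I)) ^ 2 ∂(piLaw m I) ≤
    #(((P ×ˢ P) ×ˢ (P ×ˢ P)).filter fun q =>
      #(nodes nd q.1.1 ∪ nodes nd q.1.2 ∪ nodes nd q.2.1 ∪ nodes nd q.2.2) < 2 * d) *
      (2 * M ^ 2) := by
  simp only [sum_invPart_mul_fullPart]
  set c : Finset I × Finset I → ℝ := fun p => invCard p.1 * #(p.1 ∩ p.2) with hc
  set g : Finset I × Finset I → (I → Z) → ℝ := fun p z => c p * (w p.1 z * w p.2 z) with hg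
  have hPP : ∀ {p : Finset I × Finset I}, p ∈ P ×ˢ P → p.1 ∈ P ∧ p.2 ∈ P := fun h =>
    Finset.mem_product.1 h
  have ig : ∀ p ∈ P ×ˢ P, Integrable (g p) (piLaw m I) := fun p hp =>
    (integrable_mul_two (hw _ (hPP hp).1).memLp (hw _ (hPP hp).2).memLp).const_mul _
  have igg : ∀ p ∈ P ×ˢ P, ∀ q ∈ P ×ˢ P, Integrable (fun z => g p z * g q z) (piLaw m I) := by
    intro p hp q hq
    refine ((integrable_mul_four (hw _ (hPP hp).1).memLp (hw _ (hPP hp).2).memLp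
      (hw _ (hPP hq).1).memLp (hw _ (hPP hq).2).memLp).const_mul (c p * c q)).congr
      (Filter.Eventually.of_forall fun z => ?_)
    simp only [hg]
    ring
  have hcov : ∀ p ∈ P ×ˢ P, ∀ q ∈ P ×ˢ P,
      ∫ z, (g p z - ∫ z', g p z' ∂(piLaw m I)) * (g q z - ∫ z', g q z' ∂(piLaw m I))
        ∂(piLaw m I) = c p * c q * cov4 m w p.1 p.2 q.1 q.2 := by
    intro p hp q hq
    set x := ∫ z', g p z' ∂(piLaw m I) with hx
    set y := ∫ z', g q z' ∂(piLaw m I) with hy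
    have e : ∀ z, (g p z - x) * (g q z - y) = g p z * g q z - g p z * y - (x * g q z - x * y) :=
      fun z => by ring
    have i1 : Integrable (fun z => g p z * g q z - g p z * y) (piLaw m I) :=
      (igg p hp q hq).sub ((ig p hp).mul_const _)
    have i2 : Integrable (fun z => x * g q z - x * y) (piLaw m I) :=
      ((ig q hq).const_mul _).sub (integrable_const _)
    simp only [e]
    rw [integral_sub i1 i2, integral_sub (igg p hp q hq) ((ig p hp).mul_const _),
      integral_sub ((ig q hq).const_mul _) (integrable_const _), integral_mul_const,
      integral_const_mul x (g q), ← hx, ← hy]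
    have e1 : ∫ z, g p z * g q z ∂(piLaw m I) =
        c p * c q * ∫ z, w p.1 z * w p.2 z * w q.1 z * w q.2 z ∂(piLaw m I) := by
      rw [← integral_const_mul]
      refine integral_congr_ae (Filter.Eventually.of_forall fun z => ?_)
      simp only [hg]
      ring
    have e2 : x = c p * ∫ z, w p.1 z * w p.2 z ∂(piLaw m I) := integral_const_mul _ _
    have e3 : y = c q * ∫ z, w q.1 z * w q.2 z ∂(piLaw m I) := integral_const_mul _ _
    rw [e1, cov4, integral_const, probReal_univ, one_smul, e2, e3]
    ring
  have hmain : ∫ z, (∑ p ∈ P ×ˢ P, g p z - ∫ z', ∑ p ∈ P ×ˢ P, g p z' ∂(piLaw m I)) ^ 2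
      ∂(piLaw m I) = ∑ p ∈ P ×ˢ P, ∑ q ∈ P ×ˢ P, c p * c q * cov4 m w p.1 p.2 q.1 q.2 := by
    rw [integral_finsetSum _ ig]
    simp only [← Finset.sum_sub_distrib, sq, Finset.sum_mul_sum]
    have ii : ∀ p ∈ P ×ˢ P, ∀ q ∈ P ×ˢ P, Integrable (fun z =>
        (g p z - ∫ z', g p z' ∂(piLaw m I)) * (g q z - ∫ z', g q z' ∂(piLaw m I))) (piLaw m I) := by
      intro p hp q hq
      have e : ∀ z, (g p z - ∫ z', g p z' ∂(piLaw m I)) * (g q z - ∫ z', g q z' ∂(piLaw m I)) =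
          g p z * g q z - g p z * (∫ z', g q z' ∂(piLaw m I)) -
          ((∫ z', g p z' ∂(piLaw m I)) * g q z -
            (∫ z', g p z' ∂(piLaw m I)) * (∫ z', g q z' ∂(piLaw m I))) := fun z => by ring
      simp only [e]
      exact ((igg p hp q hq).sub ((ig p hp).mul_const _)).sub
        (((ig q hq).const_mul _).sub (integrable_const _))
    rw [integral_finsetSum _ fun p hp => integrable_finsetSum _ fun q hq => ii p hp q hq]
    refine Finset.sum_congr rfl fun p hp => ?_
    rw [integral_finsetSum _ fun q hq => ii p hp q hq]
    exact Finset.sum_congr rfl fun q hq => hcov p hp q hq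
  refine (le_of_eq hmain).trans ?_
  rw [← Finset.sum_product', ← nsmul_eq_mul, ← Finset.sum_const, Finset.sum_filter]
  refine Finset.sum_le_sum fun r hr => ?_
  obtain ⟨hp, hq⟩ := Finset.mem_product.1 hr
  obtain ⟨h1, h2⟩ := hPP hp
  obtain ⟨h3, h4⟩ := hPP hq
  have b1 := invCard_mul_card_inter_le r.1.1 r.1.2
  have b2 := invCard_mul_card_inter_le r.2.1 r.2.2
  by_cases hcase : #(nodes nd r.1.1 ∪ nodes nd r.1.2 ∪ nodes nd r.2.1 ∪ nodes nd r.2.2) < 2 * d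
  · rw [if_pos hcase]
    refine (le_abs_self _).trans ?_
    rw [abs_mul, abs_of_nonneg (mul_nonneg b1.1 b2.1)]
    calc c r.1 * c r.2 * |cov4 m w r.1.1 r.1.2 r.2.1 r.2.2| ≤ 1 * (2 * M ^ 2) :=
          mul_le_mul (mul_le_one₀ b1.2 b2.1 b2.2) (abs_cov4_le (hw _ h1) (hw _ h2) (hw _ h3)
            (hw _ h4) (hM _ h1) (hM _ h2) (hM _ h3) (hM _ h4)) (abs_nonneg _) zero_le_one
      _ = 2 * M ^ 2 := one_mul _
  · rw [if_neg hcase]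
    refine le_of_eq ?_
    by_cases hint : (r.1.1 ∩ r.1.2).Nonempty
    · rw [cov4_eq_zero hnd (hw _ h1) (hw _ h2) (hw _ h3) (hw _ h4) (hd _ h1) (hd _ h2) (hd _ h3)
        (hd _ h4) (hcut _ h1) hint (not_lt.1 hcase), mul_zero]
    · have : c r.1 = 0 := by
        simp only [hc, Finset.not_nonempty_iff_eq_empty.1 hint]
        simp
      rw [this]
      simp

end Covariances

/-! ### Counting sets of coordinates by the nodes they touch. -/

section Counting

variable {I N : Type*} [Fintype I] [DecidableEq I] [Fintype N] [DecidableEq N]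

/-- The coordinates are the vertices and some of the pairs of vertices: at most `u + u²` of them
only touch `u` given vertices. -/
structure IsNodeMap (nd : I → Finset N) : Prop where
  nonempty : ∀ i, (nd i).Nonempty
  card_le : ∀ U : Finset N, #(Finset.univ.filter fun i => nd i ⊆ U) ≤ #U + #U ^ 2

variable {nd : I → Finset N}

theorem nodes_subset_iff {T : Finset I} {U : Finset N} : nodes nd T ⊆ U ↔ ∀ t ∈ T, nd t ⊆ U := by
  simp [nodes]

theorem IsNodeMap.card_le_nodes (h : IsNodeMap nd) (T : Finset I) :
    #T ≤ #(nodes nd T) + #(nodes nd T) ^ 2 :=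
  (Finset.card_le_card fun t ht => by
    simpa using nodes_subset_iff.1 subset_rfl t ht).trans (h.card_le _)

theorem IsNodeMap.card_nodes_subset (h : IsNodeMap nd) (U : Finset N) :
    #(Finset.univ.filter fun T : Finset I => nodes nd T ⊆ U) ≤ 2 ^ (#U + #U ^ 2) := by
  calc _ ≤ #(Finset.univ.filter fun i => nd i ⊆ U).powerset := by
        refine Finset.card_le_card fun T hT => ?_
        rw [Finset.mem_filter] at hT
        rw [Finset.mem_powerset]
        intro t ht
        simpa using nodes_subset_iff.1 hT.2 t ht
    _ ≤ _ := by
        rw [Finset.card_powerset]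
        exact Nat.pow_le_pow_right (by norm_num) (h.card_le U)

theorem IsNodeMap.card_level_le (h : IsNodeMap nd) (F : Finset (Finset N)) {v : ℕ}
    (hF : ∀ U ∈ F, #U = v) :
    #(Finset.univ.filter fun T : Finset I => nodes nd T ∈ F) ≤ #F * 2 ^ (v + v ^ 2) := by
  calc _ ≤ #(F.biUnion fun U => Finset.univ.filter fun T : Finset I => nodes nd T ⊆ U) := by
        refine Finset.card_le_card fun T hT => ?_
        rw [Finset.mem_filter] at hT
        rw [Finset.mem_biUnion]
        exact ⟨_, hT.2, by simp⟩
    _ ≤ _ := Finset.card_biUnion_le_card_mul _ _ _ fun U hU => by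
        have := h.card_nodes_subset U
        rwa [hF U hU] at this

theorem card_filter_card_eq_le (v : ℕ) :
    #(Finset.univ.filter fun U : Finset N => #U = v) ≤ Fintype.card N ^ v := by
  have : (Finset.univ.filter fun U : Finset N => #U = v) =
      Finset.powersetCard v Finset.univ := by
    ext U; simp [Finset.mem_powersetCard]
  rw [this, Finset.card_powersetCard]
  exact Nat.choose_le_pow _ _

theorem card_filter_card_eq_mem_le (v : ℕ) (x : N) :
    #(Finset.univ.filter fun U : Finset N => #U = v ∧ x ∈ U) ≤ Fintype.card N ^ (v - 1) := by
  refine le_trans ?_ (card_filter_card_eq_le (N := N) (v - 1))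
  refine Finset.card_le_card_of_injOn (fun U => U.erase x) (fun U hU => ?_) fun U hU U' hU' he => ?_
  · have hU := (Finset.mem_filter.1 (Finset.mem_coe.1 hU)).2
    simp [Finset.card_erase_of_mem hU.2, hU.1]
  · have h1 := (Finset.mem_filter.1 (Finset.mem_coe.1 hU)).2.2
    have h2 := (Finset.mem_filter.1 (Finset.mem_coe.1 hU')).2.2
    simp only at he
    rw [← Finset.insert_erase h1, he, Finset.insert_erase h2]

/-- A quadruple is determined by the union of its node sets, of size less than `2 * d`, and by four
sets of coordinates inside that union, whose number is independent of `n`. -/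
theorem IsNodeMap.card_quadruples_le (h : IsNodeMap nd) (P : Finset (Finset I)) {d : ℕ}
    (hd : 1 ≤ d) (hN : 1 ≤ Fintype.card N) :
    #(((P ×ˢ P) ×ˢ (P ×ˢ P)).filter fun q =>
      #(nodes nd q.1.1 ∪ nodes nd q.1.2 ∪ nodes nd q.2.1 ∪ nodes nd q.2.2) < 2 * d) ≤
      (2 * d * Fintype.card N ^ (2 * d - 1)) * (2 ^ (2 * d + (2 * d) ^ 2)) ^ 4 := by
  set F := Finset.univ.filter fun U : Finset N => #U < 2 * d with hF
  have hFc : #F ≤ 2 * d * Fintype.card N ^ (2 * d - 1) := by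
    calc #F ≤ #((Finset.range (2 * d)).biUnion fun j =>
            Finset.univ.filter fun U : Finset N => #U = j) := by
          refine Finset.card_le_card fun U hU => ?_
          rw [Finset.mem_biUnion]
          exact ⟨#U, by simpa [hF] using hU, by simp⟩
      _ ≤ #(Finset.range (2 * d)) * Fintype.card N ^ (2 * d - 1) :=
          Finset.card_biUnion_le_card_mul _ _ _ fun j hj =>
            (card_filter_card_eq_le j).trans (Nat.pow_le_pow_right hN (by
              have := Finset.mem_range.1 hj; omega))
      _ = _ := by rw [Finset.card_range]
  set B : Finset N → Finset (Finset I) := fun U =>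
    Finset.univ.filter fun T : Finset I => nodes nd T ⊆ U with hB
  calc _ ≤ #(F.biUnion fun U => (B U ×ˢ B U) ×ˢ (B U ×ˢ B U)) := by
        refine Finset.card_le_card fun q hq => ?_
        rw [Finset.mem_filter] at hq
        rw [Finset.mem_biUnion]
        refine ⟨_, by simpa [hF] using hq.2, ?_⟩
        simp only [hB, Finset.mem_product, Finset.mem_filter, Finset.mem_univ, true_and]
        refine ⟨⟨?_, ?_⟩, ?_, ?_⟩ <;> intro x hx <;> simp [hx]
    _ ≤ #F * (2 ^ (2 * d + (2 * d) ^ 2)) ^ 4 :=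
        Finset.card_biUnion_le_card_mul _ _ _ fun U hU => by
          have hU' : #U ≤ 2 * d := by
            have : #U < 2 * d := by simpa [hF] using hU
            exact this.le
          have hBU : #(B U) ≤ 2 ^ (2 * d + (2 * d) ^ 2) :=
            (h.card_nodes_subset U).trans (Nat.pow_le_pow_right (by norm_num)
              (Nat.add_le_add hU' (Nat.pow_le_pow_left hU' 2)))
          simp only [Finset.card_product]
          calc _ = #(B U) ^ 4 := by ring
            _ ≤ _ := Nat.pow_le_pow_left hBU 4
    _ ≤ _ := Nat.mul_le_mul_right _ hFc

end Counting

/-! ### The influence bound for families indexed by graphs. -/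

section GraphBound

variable {I Z N : Type*} [Fintype I] [DecidableEq I] [MeasurableSpace Z] [Fintype N]
  [DecidableEq N] {m : Measure Z} [IsProbabilityMeasure m]
  {w : Finset I → (I → Z) → ℝ} {P : Finset (Finset I)} {nd : I → Finset N}

/-- The sets are grouped by their number of nodes. The base `8 = 4 * 2` joins the hypercontractive
weight to the number of sets on given nodes. The budget `θ` will be `1` for the whole family, and `1
/ n` for the sets through one coordinate or above the principal level. -/
theorem sum_hyperWeight_le (h : IsNodeMap nd) {d k : ℕ} {K θ ν : ℝ} (hK : 0 ≤ K)
    (hdk : ∀ T ∈ P, d ≤ #(nodes nd T) ∧ #(nodes nd T) ≤ k)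
    (hw : ∀ T ∈ P, sqNorm4 (piLaw m I) (w T) ≤ K * (ν ^ d / ν ^ (2 * #(nodes nd T))))
    (hθ : 0 ≤ θ) (hc : ∀ v, d ≤ v → v ≤ k →
      (#(P.filter fun T => #(nodes nd T) = v) : ℝ) * (ν ^ d / ν ^ (2 * v)) ≤
        2 ^ (k + k ^ 2) * θ) :
    ∑ T ∈ P, hyperWeight m w T ≤ (k + 1) * (8 ^ (k + k ^ 2) * K) * θ := by
  rw [← Finset.sum_fiberwise_of_maps_to (t := Finset.range (k + 1))
    (g := fun T => #(nodes nd T)) fun T hT =>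
      Finset.mem_range.2 (Nat.lt_succ_of_le (hdk T hT).2)]
  have hv : ∀ v ∈ Finset.range (k + 1),
      ∑ T ∈ P.filter (fun T => #(nodes nd T) = v), hyperWeight m w T ≤
        8 ^ (k + k ^ 2) * K * θ := by
    intro v hv
    have hvk : v ≤ k := Nat.lt_succ_iff.1 (Finset.mem_range.1 hv)
    by_cases hdv : d ≤ v
    · calc _ ≤ ∑ T ∈ P.filter (fun T => #(nodes nd T) = v),
              4 ^ (k + k ^ 2) * (K * (ν ^ d / ν ^ (2 * v))) := by
            refine Finset.sum_le_sum fun T hT => ?_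
            obtain ⟨hTP, hTv⟩ := Finset.mem_filter.1 hT
            have h1 := hw T hTP
            rw [hTv] at h1
            have h2 := h.card_le_nodes T
            rw [hTv] at h2
            refine mul_le_mul (pow_le_pow_right₀ (by norm_num) (h2.trans ?_)) h1
              (sqNorm4_nonneg _) (by positivity)
            exact Nat.add_le_add hvk (Nat.pow_le_pow_left hvk 2)
        _ = 4 ^ (k + k ^ 2) * K *
              ((#(P.filter fun T => #(nodes nd T) = v) : ℝ) * (ν ^ d / ν ^ (2 * v))) := by
            rw [Finset.sum_const, nsmul_eq_mul]; ring
        _ ≤ 4 ^ (k + k ^ 2) * K * (2 ^ (k + k ^ 2) * θ) :=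
            mul_le_mul_of_nonneg_left (hc v hdv hvk) (by positivity)
        _ = _ := by
            rw [show (8 : ℝ) = 4 * 2 by norm_num, mul_pow]; ring
    · rw [Finset.sum_eq_zero]
      · positivity
      · intro T hT
        obtain ⟨hTP, hTv⟩ := Finset.mem_filter.1 hT
        exact absurd (hTv ▸ (hdk T hTP).1) hdv
  refine (Finset.sum_le_sum hv).trans (le_of_eq ?_)
  rw [Finset.sum_const, Finset.card_range, nsmul_eq_mul]
  push_cast
  ring

/-- The constant of the Berry–Esseen bound for sums of Hoeffding components indexed by graphs. -/
noncomputable def boundConst (k d : ℕ) (K : ℝ) : ℝ :=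
  (k + 1) * (8 ^ (k + k ^ 2) * K) + 2 * d * (2 ^ (2 * d + (2 * d) ^ 2)) ^ 4 * (2 * K ^ 2)

/-- The Berry–Esseen bound for sums of Hoeffding components indexed by graphs, with connected
leading graphs. -/
theorem berryEsseen_of_graphs (h : IsNodeMap nd) (hw : ∀ T ∈ P, Pure m T (w T)) {d k : ℕ}
    (hd : 1 ≤ d) (hN : 1 ≤ Fintype.card N)
    (hdk : ∀ T ∈ P, d ≤ #(nodes nd T) ∧ #(nodes nd T) ≤ k)
    (hcut : ∀ T ∈ P, #(nodes nd T) = d → CutConnected nd T) {K : ℝ} (hK : 0 ≤ K)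
    (hwK : ∀ T ∈ P, sqNorm4 (piLaw m I) (w T) ≤
      K * ((Fintype.card N : ℝ) ^ d / (Fintype.card N : ℝ) ^ (2 * #(nodes nd T))))
    (hvar : ∫ z, (∑ T ∈ P, w T z) ^ 2 ∂(piLaw m I) = 1) (t : ℝ) :
    |(piLaw m I).real {z | ∑ T ∈ P, w T z ≤ t} - ncdf t| ≤
      (boundConst k d K + 2 + 8 * (k + k ^ 2) * boundConst k d K +
        64 * boundConst k d K ^ 2 * (k + k ^ 2) ^ 2) / √(Fintype.card N) := by
  set n := Fintype.card N with hn
  have hn0 : (0 : ℝ) < n := Nat.cast_pos.2 hN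
  have hn1 : (1 : ℝ) ≤ n := Nat.one_le_cast.2 hN
  have hs2 : √(n : ℝ) ^ 2 = n := Real.sq_sqrt hn0.le
  set L₁ : ℝ := (k + 1) * (8 ^ (k + k ^ 2) * K) with hL₁
  have hL₁0 : 0 ≤ L₁ := by positivity
  have hLL : L₁ ≤ boundConst k d K := by
    rw [boundConst]
    have : 0 ≤ 2 * (d : ℝ) * (2 ^ (2 * d + (2 * d) ^ 2)) ^ 4 * (2 * K ^ 2) := by positivity
    linarith
  have hmono : ∀ v, v ≤ k → (2 : ℝ) ^ (v + v ^ 2) ≤ 2 ^ (k + k ^ 2) := fun v hv =>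
    pow_le_pow_right₀ (by norm_num) (Nat.add_le_add hv (Nat.pow_le_pow_left hv 2))
  -- counting the graphs with `v` nodes
  have cnt : ∀ v, v ≤ k →
      (#(P.filter fun T => #(nodes nd T) = v) : ℝ) ≤ n ^ v * 2 ^ (k + k ^ 2) := by
    intro v hv
    have h1 := h.card_level_le (Finset.univ.filter fun U : Finset N => #U = v) (v := v) (by simp)
    have h2 : #(P.filter fun T => #(nodes nd T) = v) ≤ n ^ v * 2 ^ (v + v ^ 2) := by
      refine (Finset.card_le_card fun T hT => ?_).trans
        (h1.trans (Nat.mul_le_mul_right _ (card_filter_card_eq_le v)))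
      simpa using (Finset.mem_filter.1 hT).2
    have h3 : (#(P.filter fun T => #(nodes nd T) = v) : ℝ) ≤ n ^ v * 2 ^ (v + v ^ 2) := by
      exact_mod_cast h2
    exact h3.trans (mul_le_mul_of_nonneg_left (hmono v hv) (by positivity))
  have cnt' : ∀ i, ∀ v, v ≤ k →
      (#((P.filter (i ∈ ·)).filter fun T => #(nodes nd T) = v) : ℝ) ≤
        n ^ (v - 1) * 2 ^ (k + k ^ 2) := by
    intro i v hv
    obtain ⟨x, hx⟩ := h.nonempty i
    have h1 := h.card_level_le (Finset.univ.filter fun U : Finset N => #U = v ∧ x ∈ U) (v := v)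
      (fun U hU => by simpa using (Finset.mem_filter.1 hU).2.1)
    have h2 : #((P.filter (i ∈ ·)).filter fun T => #(nodes nd T) = v) ≤
        n ^ (v - 1) * 2 ^ (v + v ^ 2) := by
      refine (Finset.card_le_card fun T hT => ?_).trans
        (h1.trans (Nat.mul_le_mul_right _ (card_filter_card_eq_mem_le v x)))
      obtain ⟨hT1, hT2⟩ := Finset.mem_filter.1 hT
      have hi := (Finset.mem_filter.1 hT1).2
      simp only [Finset.mem_filter, Finset.mem_univ, true_and]
      exact ⟨hT2, mem_nodes.2 ⟨i, hi, hx⟩⟩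
    have h3 : (#((P.filter (i ∈ ·)).filter fun T => #(nodes nd T) = v) : ℝ) ≤
        n ^ (v - 1) * 2 ^ (v + v ^ 2) := by
      exact_mod_cast h2
    exact h3.trans (mul_le_mul_of_nonneg_left (hmono v hv) (by positivity))
  -- The left side is `n ^ (d - v)`, so this needs `a ≤ v - d`, written without subtracting on the
  -- left.
  have ratio : ∀ a v : ℕ, d ≤ v → a + v ≤ 2 * v - d → (n : ℝ) ^ v * (n ^ d / n ^ (2 * v)) ≤ 1 / n ^ a := by
    intro a v hdv hav
    rw [mul_div_assoc', div_le_div_iff₀ (by positivity) (by positivity), one_mul, ← pow_add,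
      ← pow_add]
    exact pow_le_pow_right₀ hn1 (by omega)
  have hpos : ∀ v : ℕ, (0 : ℝ) ≤ (n : ℝ) ^ d / n ^ (2 * v) := fun v => by positivity
  have bL : ∑ T ∈ P, hyperWeight m w T ≤ L₁ := by
    have := sum_hyperWeight_le (m := m) h hK hdk hwK (θ := 1) zero_le_one (fun v hdv hv => by
      calc _ ≤ ((n : ℝ) ^ v * 2 ^ (k + k ^ 2)) * (n ^ d / n ^ (2 * v)) :=
            mul_le_mul_of_nonneg_right (cnt v hv) (hpos v)
        _ = 2 ^ (k + k ^ 2) * (n ^ v * (n ^ d / n ^ (2 * v))) := by ring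
        _ ≤ 2 ^ (k + k ^ 2) * 1 := by
            refine mul_le_mul_of_nonneg_left ?_ (by positivity)
            simpa using ratio 0 v hdv (by omega))
    simpa using this
  have bM : ∀ i, ∑ T ∈ P.filter (i ∈ ·), hyperWeight m w T ≤ L₁ / n := by
    intro i
    have := sum_hyperWeight_le (m := m) h hK (P := P.filter (i ∈ ·))
      (fun T hT => hdk T (Finset.filter_subset _ _ hT))
      (fun T hT => hwK T (Finset.filter_subset _ _ hT)) (θ := 1 / n) (by positivity)
      (fun v hdv hv => by
        calc _ ≤ ((n : ℝ) ^ (v - 1) * 2 ^ (k + k ^ 2)) * (n ^ d / n ^ (2 * v)) :=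
              mul_le_mul_of_nonneg_right (cnt' i v hv) (hpos v)
          _ = 2 ^ (k + k ^ 2) * (n ^ v * (n ^ d / n ^ (2 * v)) / n) := by
              obtain ⟨u, rfl⟩ : ∃ u, v = u + 1 := ⟨v - 1, by omega⟩
              rw [Nat.add_sub_cancel, pow_succ (n : ℝ) u]
              field_simp
          _ ≤ 2 ^ (k + k ^ 2) * (1 / n) := by
              refine mul_le_mul_of_nonneg_left ?_ (by positivity)
              have := ratio 0 v hdv (by omega)
              rw [pow_zero, div_one] at this
              exact div_le_div_of_nonneg_right this hn0.le)
    rw [div_eq_mul_one_div]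
    exact this
  set P₀ := P.filter fun T => #(nodes nd T) = d with hP₀
  have bL₁ : ∑ T ∈ P \ P₀, hyperWeight m w T ≤ L₁ / n := by
    have hsub : P \ P₀ ⊆ P := Finset.sdiff_subset
    have hne : ∀ T ∈ P \ P₀, #(nodes nd T) ≠ d := fun T hT he =>
      (Finset.mem_sdiff.1 hT).2 (Finset.mem_filter.2 ⟨hsub hT, he⟩)
    have := sum_hyperWeight_le (m := m) h hK (P := P \ P₀)
      (fun T hT => hdk T (hsub hT)) (fun T hT => hwK T (hsub hT)) (θ := 1 / n) (by positivity)
      (fun v hdv hv => by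
        -- Level `d` was removed; each higher level gains a factor `1 / n`.
        rcases hdv.eq_or_lt with rfl | hlt
        · rw [Finset.filter_eq_empty_iff.2 fun T hT => hne T hT]
          simp only [Finset.card_empty, Nat.cast_zero, zero_mul]
          positivity
        calc _ ≤ ((n : ℝ) ^ v * 2 ^ (k + k ^ 2)) * (n ^ d / n ^ (2 * v)) := by
              refine mul_le_mul_of_nonneg_right (le_trans ?_ (cnt v hv)) (hpos v)
              exact Nat.cast_le.2 (Finset.card_le_card (Finset.filter_subset_filter _ hsub))
          _ = 2 ^ (k + k ^ 2) * (n ^ v * (n ^ d / n ^ (2 * v))) := by ring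
          _ ≤ 2 ^ (k + k ^ 2) * (1 / n) := by
              refine mul_le_mul_of_nonneg_left ?_ (by positivity)
              have := ratio 1 v hdv (by omega)
              rwa [pow_one] at this)
    rw [div_eq_mul_one_div]
    exact this
  have hw₀ : ∀ T ∈ P₀, Pure m T (w T) := fun T hT => hw T (Finset.filter_subset _ _ hT)
  have hd₀ : ∀ T ∈ P₀, #(nodes nd T) = d := fun T hT => (Finset.mem_filter.1 hT).2
  -- At level `d` the bound `K * n ^ d / n ^ (2 * d)` on the squared norms is `K / n ^ d`.
  have bQ := integral_sq_sub_le (m := m) h.nonempty hw₀ hd₀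
    (fun T hT => hcut T (Finset.filter_subset _ _ hT) (hd₀ T hT)) (M := K / n ^ d) (fun T hT => by
      refine (hwK T (Finset.filter_subset _ _ hT)).trans (le_of_eq ?_)
      rw [hd₀ T hT, two_mul, pow_add]
      field_simp)
  have bQ' : ∫ z, (∑ i, invPart w P₀ i z * fullPart w P₀ i z -
      ∫ z', ∑ i, invPart w P₀ i z' * fullPart w P₀ i z' ∂(piLaw m I)) ^ 2 ∂(piLaw m I) ≤
      boundConst k d K / n := by
    refine bQ.trans ?_
    have hq : (#(((P₀ ×ˢ P₀) ×ˢ (P₀ ×ˢ P₀)).filter fun q =>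
      #(nodes nd q.1.1 ∪ nodes nd q.1.2 ∪ nodes nd q.2.1 ∪ nodes nd q.2.2) < 2 * d) : ℝ) ≤
      (2 * d * n ^ (2 * d - 1)) * (2 ^ (2 * d + (2 * d) ^ 2)) ^ 4 := by
      exact_mod_cast h.card_quadruples_le P₀ hd hN
    refine (mul_le_mul_of_nonneg_right hq (by positivity)).trans ?_
    -- The number of quadruples times the bound on one covariance is the second summand of
    -- `boundConst`, divided by `n`.
    have e : (2 * (d : ℝ) * n ^ (2 * d - 1)) * (2 ^ (2 * d + (2 * d) ^ 2)) ^ 4 *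
        (2 * (K / n ^ d) ^ 2) = (boundConst k d K - L₁) / n := by
      rw [boundConst, hL₁, add_sub_cancel_left]
      obtain ⟨u, rfl⟩ : ∃ u, d = u + 1 := ⟨d - 1, by omega⟩
      have e1 : 2 * (u + 1) - 1 = 2 * u + 1 := by omega
      have e2 : (n : ℝ) ^ (2 * u + 1) * (1 / (n : ℝ) ^ (u + 1)) ^ 2 = 1 / n := by
        rw [div_pow, one_pow, ← pow_mul, mul_one_div, div_eq_div_iff (by positivity) (by positivity)]
        ring
      rw [e1]
      calc _ = 2 * ((u + 1 : ℕ) : ℝ) * (2 ^ (2 * (u + 1) + (2 * (u + 1)) ^ 2)) ^ 4 * (2 * K ^ 2) *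
            ((n : ℝ) ^ (2 * u + 1) * (1 / (n : ℝ) ^ (u + 1)) ^ 2) := by
            ring
        _ = _ := by rw [e2]; ring
    rw [e]
    exact div_le_div_of_nonneg_right (by linarith) hn0.le
  have hle : ∀ {x}, x ≤ L₁ / n → x ≤ boundConst k d K / √(n : ℝ) ^ 2 := fun hx => by
    rw [hs2]
    exact hx.trans (div_le_div_of_nonneg_right hLL hn0.le)
  -- The influence bound is used with `s = √n`.
  refine berryEsseen_of_influence hw (fun he => ?_) (Finset.filter_subset _ _)
    (Real.sqrt_pos.2 hn0) (fun T hT => ?_) (bL.trans hLL) (fun i => hle (bM i)) (hle bL₁) hvar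
    (by rw [hs2]; exact bQ') t
  · have := (hdk ∅ he).1
    simp [nodes] at this
    omega
  · have h1 := h.card_le_nodes T
    have h2 := (hdk T hT).2
    have h3 : #T ≤ k + k ^ 2 := h1.trans (Nat.add_le_add h2 (Nat.pow_le_pow_left h2 2))
    exact_mod_cast h3

end GraphBound

/-! ### Fourth moments of conditional means and of finite sums. -/

section Contraction

variable {α β : Type*} [MeasurableSpace α] [MeasurableSpace β] {μ : Measure α} {ν : Measure β}
  [IsProbabilityMeasure μ] [IsProbabilityMeasure ν]

/-- Conditional means contract the `L⁴` norm. -/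
theorem memLp_four_integral_prod {F : α × β → ℝ} (hF : MemLp F 4 (μ.prod ν)) :
    MemLp (fun a => ∫ b, F (a, b) ∂ν) 4 μ ∧
      ∫ a, (∫ b, F (a, b) ∂ν) ^ 4 ∂μ ≤ ∫ p, F p ^ 4 ∂(μ.prod ν) := by
  have hi := integrable_pow_four hF
  have hm := hF.1.integral_prod_right'
  have hsec : ∀ᵐ a ∂μ, (∫ b, F (a, b) ∂ν) ^ 4 ≤ ∫ b, F (a, b) ^ 4 ∂ν := by
    filter_upwards [hi.prod_right_ae, hF.1.prodMk_left] with a h1 h2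
    have h4 : MemLp (fun b => F (a, b)) 4 ν := memLp_four_of_integrable h2 h1
    have e1 := sq_integral_le (memLp_two_of_four h4)
    have e2 := sq_integral_le (memLp_two_mul h4 h4)
    calc (∫ b, F (a, b) ∂ν) ^ 4 = ((∫ b, F (a, b) ∂ν) ^ 2) ^ 2 := by ring
      _ ≤ (∫ b, F (a, b) ^ 2 ∂ν) ^ 2 := pow_le_pow_left₀ (sq_nonneg _) e1 2
      _ = (∫ b, F (a, b) * F (a, b) ∂ν) ^ 2 := by simp only [sq]
      _ ≤ ∫ b, (F (a, b) * F (a, b)) ^ 2 ∂ν := e2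
      _ = ∫ b, F (a, b) ^ 4 ∂ν := by
          refine integral_congr_ae (Filter.Eventually.of_forall fun b => ?_)
          simp only
          ring
  have hI : Integrable (fun a => (∫ b, F (a, b) ∂ν) ^ 4) μ := by
    refine hi.integral_prod_left.mono' (hm.pow 4) ?_
    filter_upwards [hsec] with a ha
    rwa [Real.norm_of_nonneg (by positivity)]
  refine ⟨memLp_four_of_integrable hm hI, ?_⟩
  rw [integral_prod _ hi]
  exact integral_mono_ae hI hi.integral_prod_left hsec

theorem pow_four_sum_le {ι : Type*} (s : Finset ι) (x : ι → ℝ) :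
    (∑ j ∈ s, x j) ^ 4 ≤ (#s : ℝ) ^ 3 * ∑ j ∈ s, x j ^ 4 := by
  have h1 := sq_sum_le_card_mul_sum_sq (s := s) (f := x)
  have h2 := sq_sum_le_card_mul_sum_sq (s := s) (f := fun j => x j ^ 2)
  calc (∑ j ∈ s, x j) ^ 4 = ((∑ j ∈ s, x j) ^ 2) ^ 2 := by ring
    _ ≤ (#s * ∑ j ∈ s, x j ^ 2) ^ 2 := pow_le_pow_left₀ (sq_nonneg _) h1 2
    _ = (#s : ℝ) ^ 2 * (∑ j ∈ s, x j ^ 2) ^ 2 := by ring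
    _ ≤ (#s : ℝ) ^ 2 * (#s * ∑ j ∈ s, (x j ^ 2) ^ 2) :=
        mul_le_mul_of_nonneg_left h2 (sq_nonneg _)
    _ = _ := by
        simp only [← pow_mul]
        ring

/-- The power mean inequality. It costs the square of the number of terms but needs no
orthogonality, which fails for alternating sums of conditional means and for copies of one
component. -/
theorem sqNorm4_sum_le_card {ι : Type*} (s : Finset ι) {F : ι → α → ℝ} {B : ℝ} (hB : 0 ≤ B)
    (hF : ∀ j ∈ s, MemLp (F j) 4 μ) (hFB : ∀ j ∈ s, sqNorm4 μ (F j) ≤ B) :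
    sqNorm4 μ (fun a => ∑ j ∈ s, F j a) ≤ (#s : ℝ) ^ 2 * B := by
  refine Real.sqrt_le_iff.2 ⟨by positivity, ?_⟩
  have hi : ∀ j ∈ s, Integrable (fun a => F j a ^ 4) μ := fun j hj => integrable_pow_four (hF j hj)
  calc ∫ a, (∑ j ∈ s, F j a) ^ 4 ∂μ ≤ ∫ a, (#s : ℝ) ^ 3 * ∑ j ∈ s, F j a ^ 4 ∂μ :=
        integral_mono (integrable_pow_four (memLp_finsetSum _ hF))
          ((integrable_finsetSum _ hi).const_mul _) fun a => pow_four_sum_le s _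
    _ = (#s : ℝ) ^ 3 * ∑ j ∈ s, sqNorm4 μ (F j) ^ 2 := by
        rw [integral_const_mul, integral_finsetSum _ hi]
        simp only [sq_sqNorm4]
    _ ≤ (#s : ℝ) ^ 3 * ∑ j ∈ s, B ^ 2 :=
        mul_le_mul_of_nonneg_left (Finset.sum_le_sum fun j hj =>
          pow_le_pow_left₀ (sqNorm4_nonneg _) (hFB j hj) 2) (by positivity)
    _ = _ := by
        rw [Finset.sum_const, nsmul_eq_mul]
        ring

end Contraction

/-! ### The Hoeffding decomposition on a product space. -/

section Hoeffding

variable {J Z : Type*} [Fintype J] [DecidableEq J] [MeasurableSpace Z]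
  {m : Measure Z} [IsProbabilityMeasure m] {g : (J → Z) → ℝ}

/-- The conditional mean of `g` given the coordinates in `S`. -/
noncomputable def hcond (m : Measure Z) (g : (J → Z) → ℝ) (S : Finset J) (z : J → Z) : ℝ :=
  ∫ z', g (S.piecewise z z') ∂(piLaw m J)

/-- The Hoeffding component of `g` for the set `S` of coordinates. -/
noncomputable def hcomp (m : Measure Z) (g : (J → Z) → ℝ) (S : Finset J) (z : J → Z) : ℝ :=
  ∑ S' ∈ S.powerset, (-1 : ℝ) ^ (#S - #S') * hcond m g S' z

theorem measurable_hcond (hg : Measurable g) (S : Finset J) : Measurable (hcond m g S) :=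
  ((hg.comp (measurePreserving_piecewise m S).measurable).stronglyMeasurable.integral_prod_right'
    (ν := piLaw m J)).measurable

theorem memLp_hcond (hg : MemLp g 4 (piLaw m J)) (S : Finset J) :
    MemLp (hcond m g S) 4 (piLaw m J) ∧ sqNorm4 (piLaw m J) (hcond m g S) ≤ sqNorm4 (piLaw m J) g := by
  have h := memLp_four_integral_prod (hg.comp_measurePreserving (measurePreserving_piecewise m S))
  refine ⟨h.1, Real.sqrt_le_sqrt (h.2.trans (le_of_eq ?_))⟩
  exact integral_comp_measurePreserving (measurePreserving_piecewise m S)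
    (F := fun z => g z ^ 4) (integrable_pow_four hg).1

theorem dependsOn_hcond (S : Finset J) : DependsOn (hcond m g S) (S : Set J) := by
  intro x y h
  have : ∀ z' : J → Z, S.piecewise x z' = S.piecewise y z' := fun z' => by
    ext j
    by_cases hj : j ∈ S
    · simp [hj, h j (Finset.mem_coe.2 hj)]
    · simp [hj]
  simp only [hcond, this]

theorem integral_hcond_mul (hg : MemLp g 4 (piLaw m J)) (S : Finset J)
    {G : (J → Z) → ℝ} (hG : MemLp G 4 (piLaw m J)) :
    ∫ z, hcond m g S z * G z ∂(piLaw m J) =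
      ∫ p, g (S.piecewise p.1 p.2) * G p.1 ∂((piLaw m J).prod (piLaw m J)) := by
  rw [integral_prod]
  · simp only [integral_mul_const, hcond]
  · exact integrable_mul_two (hg.comp_measurePreserving (measurePreserving_piecewise m S))
      (MemLp.fst_prod hG)

/-- Against a function free of `i` it is irrelevant which copy supplies coordinate `i`: exchanging
that coordinate turns one integrand into the other. -/
theorem integral_hcond_insert_mul (hgm : Measurable g) (hg : MemLp g 4 (piLaw m J)) {S : Finset J}
    {i : J} (hi : i ∉ S) {G : (J → Z) → ℝ} (hGm : Measurable G) (hG : MemLp G 4 (piLaw m J))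
    (hd : DependsOn G ({i}ᶜ : Set J)) :
    ∫ z, hcond m g (insert i S) z * G z ∂(piLaw m J) =
      ∫ z, hcond m g S z * G z ∂(piLaw m J) := by
  rw [integral_hcond_mul hg _ hG, integral_hcond_mul hg _ hG,
    ← integral_swapAt m i (F := fun p => g (S.piecewise p.1 p.2) * G p.1)
      ((hgm.comp (measurePreserving_piecewise m S).measurable).mul (hGm.comp measurable_fst))]
  refine integral_congr_ae (Filter.Eventually.of_forall fun p => ?_)
  have e1 : G (swapAt i p).1 = G p.1 := hd fun j hj => by
    have hj : j ≠ i := hj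
    simp [swapAt, resample, hj]
  have e2 : S.piecewise (swapAt i p).1 (swapAt i p).2 = (insert i S).piecewise p.1 p.2 := by
    ext j
    by_cases hji : j = i
    · subst hji
      simp [swapAt, resample, hi]
    · by_cases hjS : j ∈ S <;> simp [swapAt, resample, hji, hjS]
  simp only [e1, e2]

theorem memLp_hcomp (hg : MemLp g 4 (piLaw m J)) (S : Finset J) :
    MemLp (hcomp m g S) 4 (piLaw m J) :=
  memLp_finsetSum _ fun S' _ => (memLp_hcond hg S').1.const_mul _

/-- At most `2 ^ |J|` conditional means, each a contraction; the number of terms enters squared. -/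
theorem sqNorm4_hcomp_le (hg : MemLp g 4 (piLaw m J)) (S : Finset J) :
    sqNorm4 (piLaw m J) (hcomp m g S) ≤ 4 ^ Fintype.card J * sqNorm4 (piLaw m J) g := by
  have h := sqNorm4_sum_le_card (μ := piLaw m J) S.powerset
    (F := fun S' z => (-1 : ℝ) ^ (#S - #S') * hcond m g S' z) (sqNorm4_nonneg (μ := piLaw m J) g)
    (fun S' _ => (memLp_hcond hg S').1.const_mul _) (fun S' _ => by
      rw [sqNorm4_const_mul, ← pow_mul, mul_comm (#S - #S'), pow_mul]
      simpa using (memLp_hcond hg S').2)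
  refine h.trans (mul_le_mul_of_nonneg_right ?_ (sqNorm4_nonneg _))
  rw [Finset.card_powerset]
  push_cast
  rw [← pow_mul, mul_comm, pow_mul]
  norm_num
  exact pow_le_pow_right₀ (by norm_num) (Finset.card_le_univ S)

/-- Pairing `S'` with `insert i S'` exhibits the alternating sum as a difference in direction `i`;
degeneracy and Möbius inversion both follow from it. -/
theorem sum_powerset_neg_one_insert {S : Finset J} {i : J} (hi : i ∉ S) (F : Finset J → ℝ) :
    ∑ S' ∈ (insert i S).powerset, (-1 : ℝ) ^ (#(insert i S) - #S') * F S' =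
      ∑ S' ∈ S.powerset, (-1 : ℝ) ^ (#S - #S') * (F (insert i S') - F S') := by
  rw [Finset.sum_powerset_insert hi, ← Finset.sum_add_distrib]
  refine Finset.sum_congr rfl fun S' hS' => ?_
  have hsub := Finset.mem_powerset.1 hS'
  have hc := Finset.card_le_card hsub
  rw [Finset.card_insert_of_notMem hi, Finset.card_insert_of_notMem fun h => hi (hsub h),
    Nat.add_sub_add_right, Nat.sub_add_comm hc, pow_succ]
  ring

/-- Möbius inversion on the subsets of a finite set. -/
theorem sum_powerset_sum_powerset_neg_one (S : Finset J) : ∀ F : Finset J → ℝ,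
    ∑ T ∈ S.powerset, ∑ S' ∈ T.powerset, (-1 : ℝ) ^ (#T - #S') * F S' = F S := by
  induction S using Finset.induction_on with
  | empty => intro F; simp
  | insert i S hi ih =>
    intro F
    rw [Finset.sum_powerset_insert hi, ih F]
    have : ∀ T ∈ S.powerset, ∑ S' ∈ (insert i T).powerset, (-1 : ℝ) ^ (#(insert i T) - #S') * F S' =
        ∑ S' ∈ T.powerset, (-1 : ℝ) ^ (#T - #S') * (F (insert i S') - F S') := fun T hT =>
      sum_powerset_neg_one_insert (fun h => hi (Finset.mem_powerset.1 hT h)) F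
    rw [Finset.sum_congr rfl this, ih fun S' => F (insert i S') - F S']
    ring

/-- For `i ∈ S` the subsets pair up, with and without `i`, and the two conditional means of a pair
integrate alike against a function free of `i`. -/
theorem pure_hcomp (hgm : Measurable g) (hg : MemLp g 4 (piLaw m J)) (S : Finset J) :
    Pure m S (hcomp m g S) where
  meas := Finset.measurable_sum _ fun S' _ => (measurable_hcond hgm S').const_mul _
  memLp := memLp_hcomp hg S
  dep := dependsOn_finset_sum fun S' hS' => fun x y h => by
    simp only [(dependsOn_hcond (m := m) (g := g) S').mono
      (Finset.coe_subset.2 (Finset.mem_powerset.1 hS')) h]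
  orth := fun i hi => orthAt_of_bounded fun G hGm hd B hB => by
    have hG : MemLp G 4 (piLaw m J) := memLp_four_of_bound hGm B hB
    obtain ⟨R, hiR, rfl⟩ : ∃ R, i ∉ R ∧ S = insert i R :=
      ⟨S.erase i, Finset.notMem_erase i S, (Finset.insert_erase hi).symm⟩
    have hint : ∀ S' : Finset J, Integrable (fun z => hcond m g S' z * G z) (piLaw m J) :=
      fun S' => integrable_mul_two (memLp_hcond hg S').1 hG
    have e : ∀ z, hcomp m g (insert i R) z * G z = ∑ S' ∈ R.powerset,
        (-1 : ℝ) ^ (#R - #S') * (hcond m g (insert i S') z * G z - hcond m g S' z * G z) := by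
      intro z
      rw [hcomp, sum_powerset_neg_one_insert hiR (fun S' => hcond m g S' z), Finset.sum_mul]
      exact Finset.sum_congr rfl fun S' _ => by ring
    simp only [e]
    have hi2 : ∀ S' : Finset J, Integrable (fun z => (-1 : ℝ) ^ (#R - #S') *
        (hcond m g (insert i S') z * G z - hcond m g S' z * G z)) (piLaw m J) :=
      fun S' => ((hint _).sub (hint _)).const_mul _
    rw [integral_finsetSum _ fun S' _ => hi2 S']
    refine Finset.sum_eq_zero fun S' hS' => ?_
    rw [integral_const_mul, integral_sub (hint _) (hint _), integral_hcond_insert_mul hgm hg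
      (fun h => hiR (Finset.mem_powerset.1 hS' h)) hGm hG hd, sub_self, mul_zero]

theorem sum_hcomp (z : J → Z) : ∑ S : Finset J, hcomp m g S z = g z := by
  have := sum_powerset_sum_powerset_neg_one (Finset.univ : Finset J) fun S => hcond m g S z
  rw [Finset.powerset_univ] at this
  refine this.trans ?_
  -- Given all coordinates, nothing is left to integrate.
  simp [hcond]

/-- The components inherit the symmetries of the function. -/
theorem hcond_map (hgm : Measurable g) (σ : J ≃ J) (hσ : ∀ z : J → Z, g (fun j => z (σ j)) = g z)
    (S : Finset J) (z : J → Z) :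
    hcond m g (S.map σ.toEmbedding) z = hcond m g S (fun j => z (σ j)) := by
  have hmp : MeasurePreserving (fun (z' : J → Z) j => z' (σ j)) (piLaw m J) (piLaw m J) := by
    have := (measurePreserving_piCongrLeft (fun _ : J => m) σ).symm
    exact this
  have hmeas : Measurable fun z' => g (S.piecewise (fun j => z (σ j)) z') :=
    hgm.comp ((measurePreserving_piecewise m S).measurable.comp measurable_prodMk_left)
  rw [hcond, hcond, ← integral_comp_measurePreserving hmp hmeas.aestronglyMeasurable]
  refine integral_congr_ae (Filter.Eventually.of_forall fun z' => ?_)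
  have : S.piecewise (fun j => z (σ j)) (fun j => z' (σ j)) =
      fun j => (S.map σ.toEmbedding).piecewise z z' (σ j) := by
    ext j
    by_cases hj : j ∈ S <;> simp [Finset.piecewise, hj]
  simp only [this, hσ]

theorem hcomp_map (hgm : Measurable g) (σ : J ≃ J) (hσ : ∀ z : J → Z, g (fun j => z (σ j)) = g z)
    (S : Finset J) (z : J → Z) :
    hcomp m g (S.map σ.toEmbedding) z = hcomp m g S (fun j => z (σ j)) := by
  rw [hcomp, hcomp]
  symm
  refine Finset.sum_bij (fun S' _ => S'.map σ.toEmbedding) (fun S' hS' => ?_) (fun _ _ _ _ h =>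
    Finset.map_injective _ h) (fun T hT => ?_) fun S' _ => ?_
  · exact Finset.mem_powerset.2 (Finset.map_subset_map.2 (Finset.mem_powerset.1 hS'))
  · obtain ⟨S', hS', rfl⟩ := Finset.subset_map_iff.1 (Finset.mem_powerset.1 hT)
    exact ⟨S', Finset.mem_powerset.2 hS', rfl⟩
  · rw [Finset.card_map, Finset.card_map, hcond_map hgm σ hσ]

end Hoeffding

/-! ### Pulling degenerate functions back along an embedding of coordinates. -/

section PullBack

variable {I J Z : Type*} [Fintype I] [DecidableEq I] [Fintype J] [DecidableEq J]
  [MeasurableSpace Z] {m : Measure Z} [IsProbabilityMeasure m]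

theorem measurePreserving_comp_embedding (φ : J ↪ I) :
    MeasurePreserving (fun (z : I → Z) j => z (φ j)) (piLaw m I) (piLaw m J) where
  measurable := by fun_prop
  map_eq := by
    refine (Measure.pi_eq fun s hs => ?_).symm
    rw [Measure.map_apply (by fun_prop) (MeasurableSet.univ_pi hs)]
    -- The preimage of a box is a box whose sides outside the range of `φ` are the whole space, of
    -- measure one.
    have e : (fun (z : I → Z) j => z (φ j)) ⁻¹' Set.univ.pi s =
        Set.univ.pi (Function.extend φ s fun _ => Set.univ) := by
      ext z
      simp only [Set.mem_preimage, Set.mem_pi, Set.mem_univ, true_implies]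
      refine ⟨fun h i => ?_, fun h j => ?_⟩
      · by_cases hi : ∃ j, φ j = i
        · obtain ⟨j, rfl⟩ := hi
          rw [φ.injective.extend_apply]
          exact h j
        · rw [Function.extend_apply' _ _ _ hi]
          trivial
      · have := h (φ j)
        rwa [φ.injective.extend_apply] at this
    rw [e, Measure.pi_pi, ← Finset.prod_subset (Finset.subset_univ (Finset.univ.map φ)),
      Finset.prod_map]
    · simp only [φ.injective.extend_apply]
    · intro i _ hi
      rw [Function.extend_apply', measure_univ]
      rintro ⟨j, rfl⟩
      exact hi (by simp)

/-- Overwriting the coordinates in the range of `φ` by an independent family separates them from the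
others, so that Fubini applies. -/
theorem measurePreserving_extend (φ : J ↪ I) :
    MeasurePreserving (fun p : (J → Z) × (I → Z) => Function.extend φ p.1 p.2)
      ((piLaw m J).prod (piLaw m I)) (piLaw m I) := by
  have hmeas : Measurable fun p : (J → Z) × (I → Z) => Function.extend φ p.1 p.2 := by
    refine measurable_pi_lambda _ fun i => ?_
    by_cases hi : ∃ j, φ j = i
    · obtain ⟨j, rfl⟩ := hi
      simp only [φ.injective.extend_apply]
      fun_prop
    · simp only [Function.extend_apply' _ _ _ hi]
      fun_prop
  have h1 : MeasurePreserving (fun p : (I → Z) × (I → Z) => ((fun j => p.1 (φ j)), p.2))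
      ((piLaw m I).prod (piLaw m I)) ((piLaw m J).prod (piLaw m I)) :=
    (measurePreserving_comp_embedding φ).prod (MeasurePreserving.id _)
  refine ⟨hmeas, ?_⟩
  rw [← h1.map_eq, Measure.map_map hmeas h1.measurable]
  convert (measurePreserving_piecewise m (Finset.univ.map φ)).map_eq using 2
  ext p i
  by_cases hi : ∃ j, φ j = i
  · obtain ⟨j, rfl⟩ := hi
    simp [φ.injective.extend_apply]
  · have : i ∉ Finset.univ.map φ := by simpa using hi
    simp only [Function.comp, Function.extend_apply' _ _ _ hi, Finset.piecewise, if_neg this]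

/-- With the coordinates outside the range of `φ` frozen, a test function on `I` becomes one on `J`,
still free of the coordinate in question. -/
theorem Pure.comp_embedding {S : Finset J} {F : (J → Z) → ℝ} (hF : Pure m S F) (φ : J ↪ I) :
    Pure m (S.map φ) (fun z : I → Z => F fun j => z (φ j)) where
  meas := hF.meas.comp (by fun_prop)
  memLp := hF.memLp.comp_measurePreserving (measurePreserving_comp_embedding φ)
  dep := fun x y h => hF.dep fun j hj => h (φ j) (by simpa using hj)
  orth := fun i hi => by
    obtain ⟨j, hj, rfl⟩ := Finset.mem_map.1 hi
    refine orthAt_of_bounded fun G hGm hd B hB => ?_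
    have hG : MemLp G 4 (piLaw m I) := memLp_four_of_bound hGm B hB
    have hmp := measurePreserving_extend (m := m) φ
    rw [← integral_comp_measurePreserving hmp
      (F := fun z => F (fun j => z (φ j)) * G z)
      ((hF.meas.comp (by fun_prop)).mul hGm).aestronglyMeasurable]
    simp only [φ.injective.extend_apply]
    have hint : Integrable (fun p : (J → Z) × (I → Z) => F p.1 * G (Function.extend φ p.1 p.2))
        ((piLaw m J).prod (piLaw m I)) :=
      integrable_mul_two (hF.memLp.comp_measurePreserving measurePreserving_fst)
        (hG.comp_measurePreserving hmp)
    rw [integral_prod_symm _ hint]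
    refine integral_eq_zero_of_ae (Filter.Eventually.of_forall fun z' => ?_)
    refine hF.integral_mul_eq_zero hj (hGm.comp (hmp.measurable.comp measurable_prodMk_right))
      fun x y h => hd fun i hi => ?_
    by_cases hi' : ∃ l, φ l = i
    · obtain ⟨l, rfl⟩ := hi'
      rw [φ.injective.extend_apply, φ.injective.extend_apply]
      refine h l fun hl => hi ?_
      rw [Set.mem_singleton_iff] at hl ⊢
      rw [hl]
    · rw [Function.extend_apply' _ _ _ hi', Function.extend_apply' _ _ _ hi']

theorem Pure.sum {T : Finset I} {ι : Type*} {s : Finset ι} {F : ι → (I → Z) → ℝ}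
    (hF : ∀ j ∈ s, Pure m T (F j)) : Pure m T (fun z => ∑ j ∈ s, F j z) where
  meas := Finset.measurable_sum _ fun j hj => (hF j hj).meas
  memLp := memLp_finsetSum _ fun j hj => (hF j hj).memLp
  dep := dependsOn_finset_sum fun j hj => (hF j hj).dep
  orth := fun i hi => orthAt_of_bounded fun _ hGm hd B hB =>
    OrthAt.sum (fun j hj => (hF j hj).orth i hi) (fun j hj => (hF j hj).memLp) hGm hd
      (memLp_four_of_bound hGm B hB)

end PullBack

/-! ### Vertices and pairs as coordinates, and the action of injections of vertices. -/

section Index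

variable {k n : ℕ}

/-- The coordinates of a kernel: the `n` vertices and the pairs of vertices. -/
abbrev Idx (n : ℕ) : Type := Fin n ⊕ Edge (Fin n)

/-- The vertices involved in a coordinate. -/
def ends : Idx n → Finset (Fin n)
  | Sum.inl i => {i}
  | Sum.inr e => e.1.toFinset

theorem mem_ends_inl {i j : Fin n} : i ∈ ends (Sum.inl j : Idx n) ↔ i = j := by simp [ends]

theorem mem_ends_inr {i : Fin n} {e : Edge (Fin n)} : i ∈ ends (Sum.inr e : Idx n) ↔ i ∈ e.1 := by
  simp [ends]

theorem isNodeMap_ends : IsNodeMap (ends : Idx n → Finset (Fin n)) where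
  nonempty := by
    rintro (i | e)
    · exact ⟨i, by simp [ends]⟩
    · exact ⟨(Quot.out e.1).1, mem_ends_inr.2 (Sym2.out_fst_mem e.1)⟩
  card_le := fun U => by
    -- The pairs are counted with the diagonal included: `u * (u + 1) / 2 ≤ u ^ 2`.
    calc _ ≤ #(U.disjSum U.sym2) := by
          refine Finset.card_le_card_of_injOn (Sum.map id Subtype.val) (fun i hi => ?_)
            ((Function.injective_id.sumMap Subtype.val_injective).injOn)
          simp only [Finset.coe_filter, Finset.mem_univ, true_and, Set.mem_ofPred_eq] at hi
          rcases i with i | e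
          · simpa [ends] using hi
          · simp only [Sum.map_inr, Finset.mem_coe, Finset.inr_mem_disjSum, Finset.mem_sym2_iff]
            exact fun a ha => hi (mem_ends_inr.2 ha)
      _ ≤ _ := by
          rw [Finset.card_disjSum, Finset.card_sym2, Nat.choose_two_right]
          refine Nat.add_le_add_left (Nat.div_le_of_le_mul ?_) _
          simp only [Nat.add_sub_cancel]
          nlinarith [Nat.zero_le #U, Nat.le_mul_self #U]

theorem edge_map_injective (φ : Fin k ↪ Fin n) : Function.Injective (Edge.map φ) := fun _ _ h =>
  Subtype.ext (Sym2.map.injective φ.injective (congrArg Subtype.val h))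

/-- The map of the coordinates that an injection of the vertices induces. -/
def idxMap (φ : Fin k ↪ Fin n) : Idx k ↪ Idx n :=
  ⟨Sum.map φ (Edge.map φ), φ.injective.sumMap (edge_map_injective φ)⟩

theorem idxMap_inl (φ : Fin k ↪ Fin n) (i : Fin k) : idxMap φ (Sum.inl i) = Sum.inl (φ i) := rfl

theorem idxMap_inr (φ : Fin k ↪ Fin n) (e : Edge (Fin k)) :
    idxMap φ (Sum.inr e) = Sum.inr (e.map φ) := rfl

theorem ends_idxMap (φ : Fin k ↪ Fin n) (j : Idx k) : ends (idxMap φ j) = (ends j).map φ := by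
  ext a
  rcases j with i | e
  · simp [idxMap_inl, ends]
  · simp [idxMap_inr, ends, Edge.map, Sym2.mem_map]

theorem nodes_map (φ : Fin k ↪ Fin n) (S : Finset (Idx k)) :
    nodes ends (S.map (idxMap φ)) = (nodes ends S).map φ := by
  ext a
  simp only [mem_nodes, Finset.mem_map]
  constructor
  · rintro ⟨_, ⟨j, hj, rfl⟩, ha⟩
    rw [ends_idxMap, Finset.mem_map] at ha
    obtain ⟨b, hb, rfl⟩ := ha
    exact ⟨b, ⟨j, hj, hb⟩, rfl⟩
  · rintro ⟨b, ⟨j, hj, hb⟩, rfl⟩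
    exact ⟨_, ⟨j, hj, rfl⟩, by rw [ends_idxMap]; exact Finset.mem_map_of_mem _ hb⟩

theorem idxMap_trans {l : ℕ} (φ : Fin k ↪ Fin n) (ψ : Fin n ↪ Fin l) (j : Idx k) :
    idxMap ψ (idxMap φ j) = idxMap (φ.trans ψ) j := by
  rcases j with i | e
  · rfl
  · simp [idxMap_inr, Edge.map, Sym2.map_map]

theorem idxMap_congr {φ ψ : Fin k ↪ Fin n} {S : Finset (Idx k)}
    (h : ∀ i ∈ nodes ends S, φ i = ψ i) {j : Idx k} (hj : j ∈ S) : idxMap φ j = idxMap ψ j := by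
  rcases j with i | e
  · rw [idxMap_inl, idxMap_inl, h i (mem_nodes.2 ⟨_, hj, mem_ends_inl.2 rfl⟩)]
  · rw [idxMap_inr, idxMap_inr]
    congr 1
    exact Subtype.ext (Sym2.map_congr fun i hi => h i (mem_nodes.2 ⟨_, hj, mem_ends_inr.2 hi⟩))

theorem map_idxMap_congr {φ ψ : Fin k ↪ Fin n} {S : Finset (Idx k)}
    (h : ∀ i ∈ nodes ends S, φ i = ψ i) : S.map (idxMap φ) = S.map (idxMap ψ) := by
  ext j
  simp only [Finset.mem_map]
  exact ⟨fun ⟨a, ha, e⟩ => ⟨a, ha, (idxMap_congr h ha).symm.trans e⟩,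
    fun ⟨a, ha, e⟩ => ⟨a, ha, (idxMap_congr h ha).trans e⟩⟩

/-- The permutation of the coordinates induced by a permutation of the vertices. -/
noncomputable def idxPerm (π : Equiv.Perm (Fin k)) : Idx k ≃ Idx k :=
  Equiv.ofBijective (idxMap π.toEmbedding)
    (Finite.injective_iff_bijective.1 (idxMap π.toEmbedding).injective)

theorem idxPerm_toEmbedding (π : Equiv.Perm (Fin k)) :
    (idxPerm π).toEmbedding = idxMap π.toEmbedding := rfl

/-- Reduces an arbitrary injection to a prescribed one followed by nothing but a relabelling of the
kernel's vertices, where the symmetry of the kernel can be used. -/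
theorem exists_perm_of_subset (α β : Fin k ↪ Fin n) {U : Finset (Fin k)}
    (h : U.map α ⊆ Finset.univ.map β) : ∃ π : Equiv.Perm (Fin k), ∀ i ∈ U, β (π i) = α i := by
  obtain ⟨e, he⟩ := Finset.exists_equiv_extend_of_card_eq (t := Finset.univ.map β) (s := U)
    (f := α) (by simp) (by rwa [← Finset.map_eq_image]) α.injective.injOn
  have hb : ∀ i, ∃ j, β j = (e i : Fin n) := fun i => by
    obtain ⟨j, -, hj⟩ := Finset.mem_map.1 (e i).2
    exact ⟨j, hj⟩
  choose p hp using hb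
  have hinj : Function.Injective p := fun i i' hii => e.injective (Subtype.ext (by
    rw [← hp, ← hp, hii]))
  exact ⟨Equiv.ofBijective p (Finite.injective_iff_bijective.1 hinj),
    fun i hi => (hp i).trans (he i hi)⟩

theorem exists_embedding_map_eq {U : Finset (Fin k)} {V : Finset (Fin n)} (h : #U = #V)
    (hkn : k ≤ n) : ∃ γ : Fin k ↪ Fin n, U.map γ = V := by
  have hUk : #V ≤ k := h ▸ (Finset.card_le_univ U).trans_eq (Fintype.card_fin k)
  obtain ⟨t, hVt, ht⟩ := Finset.exists_superset_card_eq hUk (by simpa using hkn)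
  -- The bijection of `U` with `V` is extended by a default value, which requires an element of `U`.
  rcases U.eq_empty_or_nonempty with rfl | ⟨i0, hi0⟩
  · refine ⟨(Fin.castLEOrderEmb hkn).toEmbedding, ?_⟩
    rw [Finset.card_empty] at h
    rw [Finset.map_empty, Finset.card_eq_zero.1 h.symm]
  have e0 : U ≃ V := Finset.equivOfCardEq h
  let f : Fin k → Fin n := fun i => if hi : i ∈ U then e0 ⟨i, hi⟩ else e0 ⟨i0, hi0⟩
  have hf : ∀ i (hi : i ∈ U), f i = e0 ⟨i, hi⟩ := fun i hi => dif_pos hi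
  have himg : U.image f = V := by
    ext v
    rw [Finset.mem_image]
    constructor
    · rintro ⟨i, hi, rfl⟩
      rw [hf i hi]
      exact (e0 _).2
    · intro hv
      refine ⟨(e0.symm ⟨v, hv⟩ : U), (e0.symm ⟨v, hv⟩).2, ?_⟩
      rw [hf _ (e0.symm ⟨v, hv⟩).2]
      simp
  obtain ⟨e, he⟩ := Finset.exists_equiv_extend_of_card_eq (t := t) (s := U) (f := f)
    (by simp [ht]) (himg.symm ▸ hVt) (fun i hi j hj hij => by
      rw [hf i hi, hf j hj] at hij
      simpa using e0.injective (Subtype.ext hij))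
  refine ⟨e.toEmbedding.trans (Function.Embedding.subtype _), ?_⟩
  rw [← himg, Finset.map_eq_image]
  exact Finset.image_congr fun i hi => he i hi

theorem CutConnected.map {S : Finset (Idx k)} (h : CutConnected ends S) (φ : Fin k ↪ Fin n) :
    CutConnected ends (S.map (idxMap φ)) := by
  intro U hU hne hne'
  rw [nodes_map] at hU hne'
  obtain ⟨U, hU', rfl⟩ := Finset.subset_map_iff.1 hU
  obtain ⟨t, ht, ⟨a, ha, haU⟩, b, hb, hbU⟩ := h U hU' (by simpa using hne)
    (fun e => hne' (by rw [e]))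
  refine ⟨_, Finset.mem_map_of_mem _ ht, ⟨φ a, ?_, by simpa using haU⟩, φ b, ?_, by simpa using hbU⟩
  · rw [ends_idxMap]; exact Finset.mem_map_of_mem _ ha
  · rw [ends_idxMap]; exact Finset.mem_map_of_mem _ hb

end Index

/-! ### Counting increasing maps, and binomial coefficients against powers. -/

section Counting

variable {k n : ℕ}

/-- The number of the increasing maps whose range contains `V`. -/
noncomputable def numSupersets (k : ℕ) (V : Finset (Fin n)) : ℕ :=
  #(Finset.univ.filter fun α : Fin k ↪o Fin n => V ⊆ Finset.univ.map α.toEmbedding)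

theorem orderEmb_eq_of_map_univ_eq {α β : Fin k ↪o Fin n}
    (h : Finset.univ.map α.toEmbedding = Finset.univ.map β.toEmbedding) : α = β := by
  have h' : Set.range α = Set.range β := by
    have := congrArg (fun s : Finset (Fin n) => (s : Set (Fin n))) h
    simpa using this
  exact DFunLike.coe_injective ((StrictMono.range_inj α.strictMono β.strictMono).1 h')

/-- An increasing map is determined by its range, hence by the `k - #V` points of its range outside
`V`. -/
theorem numSupersets_le (V : Finset (Fin n)) : numSupersets k V ≤ n ^ (k - #V) := by
  calc numSupersets k V ≤ #(Finset.powersetCard (k - #V) (Finset.univ : Finset (Fin n))) := by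
        refine Finset.card_le_card_of_injOn (fun α => Finset.univ.map α.toEmbedding \ V)
          (fun α hα => ?_) fun α hα β hβ h => ?_
        · have hα : V ⊆ Finset.univ.map α.toEmbedding := by simpa using hα
          simp [Finset.mem_powersetCard, Finset.card_sdiff_of_subset hα]
        · have hα : V ⊆ Finset.univ.map α.toEmbedding := by simpa using hα
          have hβ : V ⊆ Finset.univ.map β.toEmbedding := by simpa using hβ
          refine orderEmb_eq_of_map_univ_eq ?_
          rw [← Finset.sdiff_union_of_subset hα, ← Finset.sdiff_union_of_subset hβ]
          simp only at h
          rw [h]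
    _ = n.choose (k - #V) := by simp
    _ ≤ _ := Nat.choose_le_pow _ _

theorem choose_le_numSupersets {V : Finset (Fin n)} (hV : #V ≤ k) :
    (n - #V).choose (k - #V) ≤ numSupersets k V := by
  have hc : #(Vᶜ) = n - #V := by simp [Finset.card_compl]
  have hW : ∀ W ∈ Finset.powersetCard (k - #V) Vᶜ, #(V ∪ W) = k := fun W hW => by
    rw [Finset.mem_powersetCard] at hW
    rw [Finset.card_union_of_disjoint
      (Finset.disjoint_left.2 fun a ha ha' => Finset.mem_compl.1 (hW.1 ha') ha), hW.2]
    omega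
  rw [← hc, ← Finset.card_powersetCard]
  refine Finset.card_le_card_of_surjOn (fun α => Finset.univ.map α.toEmbedding \ V) fun W hWmem => ?_
  have hu := hW W (Finset.mem_coe.1 hWmem)
  have hWc := (Finset.mem_powersetCard.1 (Finset.mem_coe.1 hWmem)).1
  have hr : Finset.univ.map ((V ∪ W).orderEmbOfFin hu).toEmbedding = V ∪ W := by
    ext a
    simp
  refine ⟨(V ∪ W).orderEmbOfFin hu, ?_, ?_⟩
  · simp only [Finset.coe_filter, Finset.mem_univ, true_and, Set.mem_ofPred_eq, hr]
    exact Finset.subset_union_left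
  · simp only [hr]
    rw [Finset.union_sdiff_left, Finset.sdiff_eq_self_iff_disjoint]
    exact Finset.disjoint_left.2 fun a ha ha' => Finset.mem_compl.1 (hWc ha) ha'

/-- The constant in the comparison of binomial coefficients with powers. -/
def chooseConst (k : ℕ) : ℕ := k ^ k * k.factorial

theorem pow_le_chooseConst_mul_choose {n N r : ℕ} (hrk : r ≤ k) (hn : n ≤ k * (N + 1 - r)) :
    n ^ r ≤ chooseConst k * N.choose r := by
  rcases Nat.eq_zero_or_pos k with rfl | hk
  · have : r = 0 := by omega
    subst this
    simp [chooseConst]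
  calc n ^ r ≤ (k * (N + 1 - r)) ^ r := Nat.pow_le_pow_left hn r
    _ = k ^ r * (N + 1 - r) ^ r := mul_pow _ _ _
    _ ≤ k ^ k * (k.factorial * N.choose r) := by
        refine Nat.mul_le_mul (Nat.pow_le_pow_right hk hrk) ?_
        have h := Nat.pow_sub_le_descFactorial N r
        rw [Nat.descFactorial_eq_factorial_mul_choose] at h
        exact h.trans (Nat.mul_le_mul_right _ (Nat.factorial_le hrk))
    _ = _ := (mul_assoc _ _ _).symm

theorem le_mul_succ_sub (hk : 1 ≤ k) (hkn : k ≤ n) : n ≤ k * (n + 1 - k) := by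
  obtain ⟨j, rfl⟩ := Nat.exists_eq_add_of_le hkn
  rw [show k + j + 1 - k = j + 1 by omega]
  nlinarith

/-- The order of growth of the variance of the principal part. -/
theorem pow_le_choose_mul_sq {d : ℕ} (hk : 1 ≤ k) (hdk : d ≤ k) (hkn : k ≤ n) :
    n ^ (2 * k - d) ≤ chooseConst k ^ 3 * (n.choose d * ((n - d).choose (k - d)) ^ 2) := by
  have h1 : n ^ d ≤ chooseConst k * n.choose d := pow_le_chooseConst_mul_choose hdk
    ((le_mul_succ_sub hk hkn).trans (Nat.mul_le_mul_left _ (by omega)))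
  have h2 : n ^ (k - d) ≤ chooseConst k * (n - d).choose (k - d) :=
    pow_le_chooseConst_mul_choose (by omega)
      ((le_mul_succ_sub hk hkn).trans (Nat.mul_le_mul_left _ (by omega)))
  -- One factor counts the sets of `d` vertices, the square comes from the multiplicity of a
  -- component; each of the three factors costs one `chooseConst`.
  calc n ^ (2 * k - d) = n ^ d * (n ^ (k - d)) ^ 2 := by
        rw [← pow_mul, ← pow_add]
        congr 1
        omega
    _ ≤ (chooseConst k * n.choose d) * (chooseConst k * (n - d).choose (k - d)) ^ 2 :=
        Nat.mul_le_mul h1 (Nat.pow_le_pow_left h2 2)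
    _ = _ := by ring

end Counting

/-! ### The Hoeffding components of the U-statistic. -/

section Kernel

variable {k n : ℕ} {Z : Type*} [MeasurableSpace Z] {m : Measure Z} [IsProbabilityMeasure m]
  {g : (Idx k → Z) → ℝ}

/-- Invariance of a function of the coordinates under relabelling of the vertices. -/
def VertexSymmetric (g : (Idx k → Z) → ℝ) : Prop :=
  ∀ (π : Equiv.Perm (Fin k)) (z : Idx k → Z), g (fun j => z (idxMap π.toEmbedding j)) = g z

/-- On the nodes of `S` the map `α` is `β` after a permutation `π` of the vertices, so `S'` is the
image of `S` under `π`, and the symmetry of the kernel identifies the components. -/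
theorem hcomp_comp_eq (hgm : Measurable g) (hs : VertexSymmetric g) {α β : Fin k ↪ Fin n}
    {S S' : Finset (Idx k)} (h : S.map (idxMap α) = S'.map (idxMap β)) (z : Idx n → Z) :
    hcomp m g S (fun j => z (idxMap α j)) = hcomp m g S' (fun j => z (idxMap β j)) := by
  have hdep : DependsOn (hcomp m g S) (S : Set (Idx k)) :=
    dependsOn_finset_sum fun R hR => fun x y h => by
      simp only [(dependsOn_hcond (m := m) (g := g) R).mono
        (Finset.coe_subset.2 (Finset.mem_powerset.1 hR)) h]
  have hn : (nodes ends S).map α ⊆ Finset.univ.map β := by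
    rw [← nodes_map, h, nodes_map]
    exact Finset.map_subset_map.2 (Finset.subset_univ _)
  obtain ⟨π, hπ⟩ := exists_perm_of_subset α β hn
  have he : (idxMap π.toEmbedding).trans (idxMap β) = idxMap (π.toEmbedding.trans β) := by
    ext1 j
    exact idxMap_trans _ _ j
  have hc : ∀ i ∈ nodes ends S, (π.toEmbedding.trans β) i = α i := hπ
  have hS' : S' = S.map (idxPerm π).toEmbedding := by
    refine Finset.map_injective (idxMap β) ?_
    rw [← h, idxPerm_toEmbedding, Finset.map_map, he, map_idxMap_congr hc]
  rw [hS', hcomp_map hgm (idxPerm π) (fun z => hs π z)]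
  refine hdep fun j hj => ?_
  change z (idxMap α j) = z (idxMap β (idxMap π.toEmbedding j))
  rw [idxMap_trans, idxMap_congr hc hj]

/-- The increasing maps and the sets of coordinates of the kernel that contribute to the set `T` of
coordinates. -/
noncomputable def preimages (k : ℕ) (T : Finset (Idx n)) :
    Finset ((Fin k ↪o Fin n) × Finset (Idx k)) :=
  Finset.univ.filter fun p => p.2.map (idxMap p.1.toEmbedding) = T

theorem mem_preimages {T : Finset (Idx n)} {p : (Fin k ↪o Fin n) × Finset (Idx k)} :
    p ∈ preimages k T ↔ p.2.map (idxMap p.1.toEmbedding) = T := by simp [preimages]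

/-- The range of the increasing map has to contain the nodes of `T`, and the map then determines the
set upstairs. -/
theorem card_preimages_le (T : Finset (Idx n)) :
    #(preimages k T) ≤ numSupersets k (nodes ends T) := by
  refine Finset.card_le_card_of_injOn Prod.fst (fun p hp => ?_) fun p hp q hq hpq => ?_
  · rw [Finset.mem_coe, mem_preimages] at hp
    simp only [Finset.coe_filter, Finset.mem_univ, true_and, Set.mem_ofPred_eq, ← hp, nodes_map]
    exact Finset.map_subset_map.2 (Finset.subset_univ _)
  · rw [Finset.mem_coe, mem_preimages] at hp hq
    refine Prod.ext hpq (Finset.map_injective (idxMap p.1.toEmbedding) ?_)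
    rw [hp, ← hq, hpq]

/-- An increasing map that covers the nodes need not carry `S` itself onto the target, but it
carries a permuted copy of `S` there. -/
theorem numSupersets_le_card_preimages (S : Finset (Idx k)) (γ : Fin k ↪ Fin n) :
    numSupersets k ((nodes ends S).map γ) ≤ #(preimages k (S.map (idxMap γ))) := by
  refine Finset.card_le_card_of_surjOn Prod.fst fun α hα => ?_
  have hα : (nodes ends S).map γ ⊆ Finset.univ.map α.toEmbedding := by simpa using hα
  obtain ⟨π, hπ⟩ := exists_perm_of_subset γ α.toEmbedding hα
  refine ⟨(α, S.map (idxMap π.toEmbedding)), ?_, rfl⟩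
  rw [Finset.mem_coe, mem_preimages, Finset.map_map]
  have he : (idxMap π.toEmbedding).trans (idxMap α.toEmbedding) =
      idxMap (π.toEmbedding.trans α.toEmbedding) := by
    ext1 j
    exact idxMap_trans _ _ j
  rw [he]
  exact map_idxMap_congr hπ

/-- The Hoeffding component, for the set `T` of coordinates, of the U-statistic with kernel `g`. -/
noncomputable def statComp (m : Measure Z) (g : (Idx k → Z) → ℝ) (T : Finset (Idx n))
    (z : Idx n → Z) : ℝ :=
  ∑ p ∈ preimages k T, hcomp m g p.2 fun j => z (idxMap p.1.toEmbedding j)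

/-- The U-statistic with kernel `g`, as a function of all the coordinates. -/
noncomputable def uStat (n : ℕ) (g : (Idx k → Z) → ℝ) (z : Idx n → Z) : ℝ :=
  ∑ α : Fin k ↪o Fin n, g fun j => z (idxMap α.toEmbedding j)

theorem pure_statComp (hgm : Measurable g) (hg : MemLp g 4 (piLaw m (Idx k)))
    (T : Finset (Idx n)) : Pure m T (statComp m g T) :=
  Pure.sum fun p hp => by
    have := (pure_hcomp hgm hg p.2).comp_embedding (idxMap p.1.toEmbedding)
    rwa [mem_preimages.1 hp] at this

theorem sum_statComp (z : Idx n → Z) : ∑ T, statComp m g T z = uStat n g z := by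
  simp only [statComp, preimages]
  rw [Finset.sum_fiberwise, Fintype.sum_prod_type]
  exact Finset.sum_congr rfl fun α _ =>
    sum_hcomp (m := m) (g := g) fun j => z (idxMap α.toEmbedding j)

theorem sqNorm4_comp_embedding {F : (Idx k → Z) → ℝ} (hF : MemLp F 4 (piLaw m (Idx k)))
    (φ : Idx k ↪ Idx n) :
    sqNorm4 (piLaw m (Idx n)) (fun z => F fun j => z (φ j)) = sqNorm4 (piLaw m (Idx k)) F := by
  rw [sqNorm4, sqNorm4, integral_comp_measurePreserving (measurePreserving_comp_embedding φ)
    (F := fun z => F z ^ 4) (integrable_pow_four hF).1]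

theorem sqNorm4_statComp_le (hg : MemLp g 4 (piLaw m (Idx k))) (T : Finset (Idx n)) :
    sqNorm4 (piLaw m (Idx n)) (statComp m g T) ≤ ((n : ℝ) ^ (k - #(nodes ends T))) ^ 2 *
      (4 ^ Fintype.card (Idx k) * sqNorm4 (piLaw m (Idx k)) g) := by
  have hB : 0 ≤ 4 ^ Fintype.card (Idx k) * sqNorm4 (piLaw m (Idx k)) g :=
    mul_nonneg (by positivity) (sqNorm4_nonneg _)
  have h := sqNorm4_sum_le_card (μ := piLaw m (Idx n)) (preimages k T)
    (F := fun p z => hcomp m g p.2 fun j => z (idxMap p.1.toEmbedding j)) hB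
    (fun p _ => (memLp_hcomp hg p.2).comp_measurePreserving (measurePreserving_comp_embedding _))
    (fun p _ => by
      rw [sqNorm4_comp_embedding (memLp_hcomp hg p.2)]
      exact sqNorm4_hcomp_le hg p.2)
  refine h.trans (mul_le_mul_of_nonneg_right (pow_le_pow_left₀ (by positivity) ?_ 2) hB)
  exact_mod_cast (card_preimages_le T).trans (numSupersets_le _)

/-- Through this the lower bound on the number of nodes and the connectedness pass from the kernel
to the U-statistic. -/
theorem exists_of_statComp_ne {T : Finset (Idx n)}
    (hT : ¬ statComp m g T =ᵐ[piLaw m (Idx n)] 0) :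
    ∃ (φ : Fin k ↪ Fin n) (S : Finset (Idx k)), S.map (idxMap φ) = T ∧
      ¬ hcomp m g S =ᵐ[piLaw m (Idx k)] 0 := by
  by_contra hc
  push Not at hc
  refine hT ?_
  have : ∀ p ∈ preimages k T, ∀ᵐ z ∂(piLaw m (Idx n)),
      hcomp m g p.2 (fun j => z (idxMap p.1.toEmbedding j)) = 0 := fun p hp =>
    (measurePreserving_comp_embedding (m := m) (idxMap p.1.toEmbedding)).quasiMeasurePreserving.ae
      (hc _ _ (mem_preimages.1 hp))
  filter_upwards [(Finset.eventually_all (preimages k T)).2 this] with z hz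
  exact Finset.sum_eq_zero hz

/-- All contributions to one set of coordinates are equal, so there is no cancellation; the lower
bound on the variance depends on this. -/
theorem statComp_map (hgm : Measurable g) (hs : VertexSymmetric g) (S : Finset (Idx k))
    (γ : Fin k ↪ Fin n) (z : Idx n → Z) :
    statComp m g (S.map (idxMap γ)) z =
      #(preimages k (S.map (idxMap γ))) * hcomp m g S fun j => z (idxMap γ j) := by
  rw [statComp, Finset.sum_congr rfl fun p hp => hcomp_comp_eq hgm hs (mem_preimages.1 hp) z,
    Finset.sum_const, nsmul_eq_mul]

end Kernel

/-! ### Second moments of degenerate functions. -/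

section

variable {I Z : Type*} [Fintype I] [DecidableEq I] [MeasurableSpace Z] {m : Measure Z}
  [IsProbabilityMeasure m]

theorem integral_sq_sum_of_pure {P : Finset (Finset I)} {w : Finset I → (I → Z) → ℝ}
    (hw : ∀ T ∈ P, Pure m T (w T)) :
    ∫ z, (∑ T ∈ P, w T z) ^ 2 ∂(piLaw m I) = ∑ T ∈ P, ∫ z, w T z ^ 2 ∂(piLaw m I) := by
  have hint : ∀ T ∈ P, ∀ T' ∈ P, Integrable (fun z => w T z * w T' z) (piLaw m I) :=
    fun T hT T' hT' => integrable_mul_two (hw T hT).memLp (hw T' hT').memLp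
  simp only [sq (∑ T ∈ P, w T _), Finset.sum_mul_sum]
  rw [integral_finsetSum _ fun T hT => integrable_finsetSum _ (hint T hT)]
  refine Finset.sum_congr rfl fun T hT => ?_
  rw [integral_finsetSum _ (hint T hT), Finset.sum_eq_single_of_mem T hT]
  · simp only [sq]
  · exact fun T' hT' hne => (hw T hT).integral_mul_of_ne (hw T' hT') hne.symm

theorem Pure.integral_eq_zero {T : Finset I} {F : (I → Z) → ℝ} (hF : Pure m T F)
    (hT : T.Nonempty) : ∫ z, F z ∂(piLaw m I) = 0 := by
  obtain ⟨i, hi⟩ := hT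
  simpa using hF.integral_mul_eq_zero hi (G := fun _ => 1) measurable_const fun _ _ _ => rfl

theorem Pure.integral_empty {F : (I → Z) → ℝ} (hF : Pure m ∅ F) (z : I → Z) :
    ∫ z', F z' ∂(piLaw m I) = F z := by
  have : ∀ z', F z' = F z := fun z' => hF.dep fun i hi => by simp at hi
  simp [this]

theorem Pure.integral_sq_pos {T : Finset I} {F : (I → Z) → ℝ} (hF : Pure m T F)
    (h : ¬ F =ᵐ[piLaw m I] 0) : 0 < ∫ z, F z ^ 2 ∂(piLaw m I) := by
  refine lt_of_le_of_ne (integral_nonneg fun z => sq_nonneg _) fun h0 => h ?_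
  have h1 := (integral_eq_zero_iff_of_nonneg (fun z => sq_nonneg (F z))
    (integrable_sq_of_four hF.memLp)).1 h0.symm
  filter_upwards [h1] with z hz
  simpa using hz

end

/-! ### Variance lower bound and normal approximation on the product space. -/

section Kernel

variable {k d n : ℕ} {Z : Type*} [MeasurableSpace Z] {m : Measure Z} [IsProbabilityMeasure m]
  {g : (Idx k → Z) → ℝ}

open Classical in
/-- The sets of coordinates with a nonvanishing Hoeffding component of the U-statistic. -/
noncomputable def active (m : Measure Z) [IsProbabilityMeasure m] (n : ℕ) (g : (Idx k → Z) → ℝ) :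
    Finset (Finset (Idx n)) :=
  Finset.univ.filter fun T => T.Nonempty ∧ ¬ statComp m g T =ᵐ[piLaw m (Idx n)] 0

theorem mem_active {T : Finset (Idx n)} :
    T ∈ active m n g ↔ T.Nonempty ∧ ¬ statComp m g T =ᵐ[piLaw m (Idx n)] 0 := by
  classical
  simp [active]

theorem integral_uStat (hgm : Measurable g) (hg : MemLp g 4 (piLaw m (Idx k))) (z : Idx n → Z) :
    ∫ z', uStat n g z' ∂(piLaw m (Idx n)) = statComp m g ∅ z := by
  have hp : ∀ T : Finset (Idx n), Pure m T (statComp m g T) := pure_statComp hgm hg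
  simp only [← sum_statComp (m := m) (g := g)]
  rw [integral_finsetSum _ fun T _ => (hp T).memLp.integrable (by norm_num),
    Finset.sum_eq_single ∅, (hp ∅).integral_empty z]
  · exact fun T _ hT => (hp T).integral_eq_zero (Finset.nonempty_iff_ne_empty.2 hT)
  · simp

/-- The mean is the component of the empty set. Null components are dropped, because the conditions
on graphs are known only for nonvanishing ones; hence the equality holds only almost everywhere. -/
theorem uStat_sub_mean (hgm : Measurable g) (hg : MemLp g 4 (piLaw m (Idx k))) :
    ∀ᵐ z ∂(piLaw m (Idx n)), uStat n g z - ∫ z', uStat n g z' ∂(piLaw m (Idx n)) =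
      ∑ T ∈ active m n g, statComp m g T z := by
  have h0 : ∀ᵐ z ∂(piLaw m (Idx n)), ∀ T : Finset (Idx n),
      T.Nonempty → T ∉ active m n g → statComp m g T z = 0 := by
    refine Filter.eventually_all.2 fun T => ?_
    by_cases hT : T.Nonempty ∧ T ∉ active m n g
    · have : statComp m g T =ᵐ[piLaw m (Idx n)] 0 := by
        by_contra hc
        exact hT.2 (mem_active.2 ⟨hT.1, hc⟩)
      filter_upwards [this] with z hz _ _
      exact hz
    · exact Filter.Eventually.of_forall fun z h1 h2 => (hT ⟨h1, h2⟩).elim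
  filter_upwards [h0] with z hz
  rw [integral_uStat hgm hg z, ← sum_statComp (m := m) (g := g) z,
    ← Finset.add_sum_erase _ _ (Finset.mem_univ ∅), add_sub_cancel_left]
  refine (Finset.sum_subset (fun T hT => ?_) fun T hT hT' => ?_).symm
  · exact Finset.mem_erase.2
      ⟨Finset.nonempty_iff_ne_empty.1 (mem_active.1 hT).1, Finset.mem_univ _⟩
  · exact hz T (Finset.nonempty_iff_ne_empty.2 (Finset.mem_erase.1 hT).1) hT'

/-- The principal part makes the variance of the U-statistic as large as `n ^ (2 * k - d)`. -/
theorem pow_mul_le_variance (hgm : Measurable g) (hg : MemLp g 4 (piLaw m (Idx k)))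
    (hs : VertexSymmetric g) (hd : 1 ≤ d) (hdk : d ≤ k) (hkn : k ≤ n) {S₀ : Finset (Idx k)}
    (hS₀ : #(nodes ends S₀) = d) {v : ℝ} (hv : 0 < v)
    (hvS : v ≤ ∫ z, hcomp m g S₀ z ^ 2 ∂(piLaw m (Idx k))) :
    (n : ℝ) ^ (2 * k - d) * v ≤ (chooseConst k : ℝ) ^ 3 *
      ∫ z, (∑ T ∈ active m n g, statComp m g T z) ^ 2 ∂(piLaw m (Idx n)) := by
  have hp : ∀ T : Finset (Idx n), Pure m T (statComp m g T) := pure_statComp hgm hg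
  rw [integral_sq_sum_of_pure fun T _ => hp T]
  set c : ℕ := (n - d).choose (k - d) with hc
  have hc0 : (0 : ℝ) < c := Nat.cast_pos.2 (Nat.choose_pos (by omega))
  -- Each placed copy of `S₀` carries one component with multiplicity at least `c`, the number of
  -- ways to complete `d` vertices to `k`.
  have key : ∀ γ : Fin k ↪ Fin n, (c : ℝ) ^ 2 * v ≤
      ∫ z, statComp m g (S₀.map (idxMap γ)) z ^ 2 ∂(piLaw m (Idx n)) := by
    intro γ
    simp only [statComp_map hgm hs, mul_pow]
    rw [integral_const_mul, integral_comp_measurePreserving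
      (measurePreserving_comp_embedding (m := m) (idxMap γ)) (F := fun z => hcomp m g S₀ z ^ 2)
      (integrable_sq_of_four (memLp_hcomp hg S₀)).1]
    refine mul_le_mul (pow_le_pow_left₀ hc0.le ?_ 2) hvS hv.le (by positivity)
    refine Nat.cast_le.2 (le_trans ?_ (numSupersets_le_card_preimages S₀ γ))
    have hV : #((nodes ends S₀).map γ) = d := by rw [Finset.card_map, hS₀]
    have := choose_le_numSupersets (k := k) (V := (nodes ends S₀).map γ) (by omega)
    rwa [hV] at this
  -- One placement of `S₀` for each set of `d` vertices; elsewhere the value is a dummy.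
  have hex : ∀ V : Finset (Fin n), ∃ γ : Fin k ↪ Fin n,
      V ∈ Finset.powersetCard d Finset.univ → (nodes ends S₀).map γ = V := fun V => by
    by_cases hV : #V = d
    · obtain ⟨γ, hγ⟩ := exists_embedding_map_eq (hS₀.trans hV.symm) hkn
      exact ⟨γ, fun _ => hγ⟩
    · exact ⟨(Fin.castLEOrderEmb hkn).toEmbedding,
        fun h => (hV (Finset.mem_powersetCard.1 h).2).elim⟩
  choose γ hγ using hex
  -- The vertex set is recovered as the nodes of the placed copy.
  have hinj : Set.InjOn (fun V => S₀.map (idxMap (γ V)))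
      (Finset.powersetCard d (Finset.univ : Finset (Fin n))) := fun V hV V' hV' h => by
    rw [← hγ V hV, ← hγ V' hV', ← nodes_map, ← nodes_map]
    exact congrArg _ h
  have hsub : (Finset.powersetCard d (Finset.univ : Finset (Fin n))).image
      (fun V => S₀.map (idxMap (γ V))) ⊆ active m n g := by
    intro T hT
    obtain ⟨V, -, rfl⟩ := Finset.mem_image.1 hT
    refine mem_active.2 ⟨?_, fun h0 => ?_⟩
    · rw [Finset.map_nonempty, Finset.nonempty_iff_ne_empty]
      rintro rfl
      simp [nodes] at hS₀
      omega
    · have h := key (γ V)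
      rw [integral_congr_ae (g := fun _ => (0 : ℝ)) (by
        filter_upwards [h0] with z hz
        simp [hz]), integral_zero] at h
      exact absurd h (not_le.2 (by positivity))
  have hsum : (n.choose d : ℝ) * ((c : ℝ) ^ 2 * v) ≤
      ∑ T ∈ active m n g, ∫ z, statComp m g T z ^ 2 ∂(piLaw m (Idx n)) := by
    refine le_trans ?_ (Finset.sum_le_sum_of_subset_of_nonneg hsub fun T _ _ =>
      integral_nonneg fun z => sq_nonneg _)
    rw [Finset.sum_image hinj]
    refine le_trans (le_of_eq ?_) (Finset.card_nsmul_le_sum _ _ _ fun V _ => key (γ V))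
    simp [nsmul_eq_mul]
  have hn : (n : ℝ) ^ (2 * k - d) ≤ (chooseConst k : ℝ) ^ 3 * (n.choose d * (c : ℝ) ^ 2) := by
    exact_mod_cast pow_le_choose_mul_sq (hd.trans hdk) hdk hkn
  calc (n : ℝ) ^ (2 * k - d) * v
      ≤ (chooseConst k : ℝ) ^ 3 * (n.choose d * (c : ℝ) ^ 2) * v :=
        mul_le_mul_of_nonneg_right hn hv.le
    _ = (chooseConst k : ℝ) ^ 3 * (n.choose d * ((c : ℝ) ^ 2 * v)) := by ring
    _ ≤ _ := mul_le_mul_of_nonneg_left hsum (by positivity)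

/-- The scale of the fourth moments of the components, relative to the variance. -/
noncomputable def normConst (k : ℕ) (v B : ℝ) : ℝ :=
  4 ^ Fintype.card (Idx k) * B * (chooseConst k : ℝ) ^ 3 / v

/-- The normal approximation of a U-statistic on the product space. -/
theorem berryEsseen_uStat (hgm : Measurable g) (hg : MemLp g 4 (piLaw m (Idx k)))
    (hs : VertexSymmetric g) (hd : 1 ≤ d) (hdk : d ≤ k) (hkn : k ≤ n)
    (hlow : ∀ S : Finset (Idx k), S.Nonempty → ¬ hcomp m g S =ᵐ[piLaw m (Idx k)] 0 →
      d ≤ #(nodes ends S))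
    (hcut : ∀ S : Finset (Idx k), ¬ hcomp m g S =ᵐ[piLaw m (Idx k)] 0 → #(nodes ends S) = d →
      CutConnected ends S)
    {S₀ : Finset (Idx k)} (hS₀ : #(nodes ends S₀) = d) {v : ℝ} (hv : 0 < v)
    (hvS : v ≤ ∫ z, hcomp m g S₀ z ^ 2 ∂(piLaw m (Idx k))) (t : ℝ) :
    |(piLaw m (Idx n)).real {z | (uStat n g z - ∫ z', uStat n g z' ∂(piLaw m (Idx n))) /
        √(∫ z, (uStat n g z - ∫ z', uStat n g z' ∂(piLaw m (Idx n))) ^ 2 ∂(piLaw m (Idx n))) ≤ t} -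
      ncdf t| ≤
      (boundConst k d (normConst k v (sqNorm4 (piLaw m (Idx k)) g)) + 2 +
        8 * (k + k ^ 2) * boundConst k d (normConst k v (sqNorm4 (piLaw m (Idx k)) g)) +
        64 * boundConst k d (normConst k v (sqNorm4 (piLaw m (Idx k)) g)) ^ 2 *
          (k + k ^ 2) ^ 2) / √n := by
  have hp : ∀ T : Finset (Idx n), Pure m T (statComp m g T) := pure_statComp hgm hg
  have hae := uStat_sub_mean (n := n) hgm hg
  set μ₁ := ∫ z', uStat n g z' ∂(piLaw m (Idx n)) with hμ₁
  set V := ∫ z, (∑ T ∈ active m n g, statComp m g T z) ^ 2 ∂(piLaw m (Idx n)) with hVdef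
  have hV : ∫ z, (uStat n g z - μ₁) ^ 2 ∂(piLaw m (Idx n)) = V :=
    integral_congr_ae (by filter_upwards [hae] with z hz; rw [hz])
  rw [hV]
  have hn : 1 ≤ n := hd.trans (hdk.trans hkn)
  have hn0 : (0 : ℝ) < n := Nat.cast_pos.2 hn
  have hlb := pow_mul_le_variance hgm hg hs hd hdk hkn hS₀ hv hvS
  rw [← hVdef] at hlb
  have hD : (0 : ℝ) ≤ (chooseConst k : ℝ) ^ 3 := by positivity
  have hV0 : 0 < V := by
    by_contra hc
    have h1 : (chooseConst k : ℝ) ^ 3 * V ≤ 0 := mul_nonpos_of_nonneg_of_nonpos hD (not_lt.1 hc)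
    have h2 : 0 < (n : ℝ) ^ (2 * k - d) * v := by positivity
    linarith
  set s := √V with hsdef
  have hs0 : 0 < s := Real.sqrt_pos.2 hV0
  have hs2 : s ^ 2 = V := Real.sq_sqrt hV0.le
  set B := 4 ^ Fintype.card (Idx k) * sqNorm4 (piLaw m (Idx k)) g with hB
  have hB0 : 0 ≤ B := mul_nonneg (by positivity) (sqNorm4_nonneg _)
  have hK : normConst k v (sqNorm4 (piLaw m (Idx k)) g) = B * (chooseConst k : ℝ) ^ 3 / v := rfl
  have hT : ∀ T ∈ active m n g, (d ≤ #(nodes ends T) ∧ #(nodes ends T) ≤ k) ∧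
      (#(nodes ends T) = d → CutConnected ends T) := by
    intro T hT
    obtain ⟨hT1, hT2⟩ := mem_active.1 hT
    obtain ⟨φ, S, rfl, hS⟩ := exists_of_statComp_ne hT2
    rw [nodes_map, Finset.card_map]
    refine ⟨⟨hlow S (by simpa using hT1) hS, ?_⟩, fun h => (hcut S hS h).map φ⟩
    exact (Finset.card_le_univ _).trans_eq (Fintype.card_fin k)
  have hmain := berryEsseen_of_graphs (P := active m n g)
    (w := fun T z => s⁻¹ * statComp m g T z) isNodeMap_ends (fun T _ => (hp T).const_mul _)
    hd (by simpa using hn) (fun T h => (hT T h).1) (fun T h => (hT T h).2)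
    (K := normConst k v (sqNorm4 (piLaw m (Idx k)) g)) (by rw [hK]; positivity) ?_ ?_ t
  · rw [Fintype.card_fin] at hmain
    refine le_trans (le_of_eq ?_) hmain
    congr 2
    refine measureReal_congr ?_
    filter_upwards [hae] with z hz
    apply propext
    change (uStat n g z - μ₁) / s ≤ t ↔ ∑ T ∈ active m n g, s⁻¹ * statComp m g T z ≤ t
    rw [hz, ← Finset.mul_sum, div_eq_inv_mul]
  -- Squared norms are at most `n ^ (2 * (k - r)) * B` and the variance is at least `n ^ (2 * k - d)
  -- * v / chooseConst k ^ 3`; the quotient has the order `n ^ (d - 2 * r)`.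
  · intro T h
    have hTk := (hT T h).1
    rw [sqNorm4_const_mul, Fintype.card_fin, hK, inv_pow, hs2]
    set r := #(nodes ends T) with hr
    have h1 := sqNorm4_statComp_le hg T
    rw [← hB, ← hr] at h1
    have hpow : (n : ℝ) ^ (2 * k - d) * (n : ℝ) ^ d = ((n : ℝ) ^ (k - r)) ^ 2 * (n : ℝ) ^ (2 * r) := by
      rw [← pow_mul, ← pow_add, ← pow_add]
      congr 1
      omega
    calc V⁻¹ * sqNorm4 (piLaw m (Idx n)) (statComp m g T)
        ≤ V⁻¹ * (((n : ℝ) ^ (k - r)) ^ 2 * B) :=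
          mul_le_mul_of_nonneg_left h1 (inv_nonneg.2 hV0.le)
      _ ≤ B * (chooseConst k : ℝ) ^ 3 / v * ((n : ℝ) ^ d / (n : ℝ) ^ (2 * r)) := by
          rw [inv_mul_eq_div, div_mul_div_comm, div_le_div_iff₀ hV0 (by positivity)]
          calc ((n : ℝ) ^ (k - r)) ^ 2 * B * (v * (n : ℝ) ^ (2 * r))
              = B * (n : ℝ) ^ d * ((n : ℝ) ^ (2 * k - d) * v) := by
                rw [show ((n : ℝ) ^ (k - r)) ^ 2 * B * (v * (n : ℝ) ^ (2 * r)) =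
                  B * v * (((n : ℝ) ^ (k - r)) ^ 2 * (n : ℝ) ^ (2 * r)) by ring, ← hpow]
                ring
            _ ≤ B * (n : ℝ) ^ d * ((chooseConst k : ℝ) ^ 3 * V) :=
                mul_le_mul_of_nonneg_left hlb (by positivity)
            _ = _ := by ring
  · simp only [← Finset.mul_sum, mul_pow]
    rw [integral_const_mul, ← hVdef, inv_pow, hs2, inv_mul_cancel₀ hV0.ne']

end Kernel

/-! ### Extended norms as integrals of powers. -/

section Norms

variable {α : Type*} [MeasurableSpace α] {μ : Measure α}

theorem sq_toReal_eLpNorm_two {F : α → ℝ} (hF : MemLp F 2 μ) :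
    (eLpNorm F 2 μ).toReal ^ 2 = ∫ a, F a ^ 2 ∂μ := by
  have h0 : 0 ≤ ∫ a, F a ^ 2 ∂μ := integral_nonneg fun a => sq_nonneg _
  rw [hF.eLpNorm_eq_integral_rpow_norm (by norm_num) (by norm_num)]
  have e : ∀ a, ‖F a‖ ^ (2 : ℝ≥0∞).toReal = F a ^ 2 := fun a => by
    rw [ENNReal.toReal_ofNat, Real.rpow_ofNat, Real.norm_eq_abs, sq_abs]
  simp only [e]
  rw [ENNReal.toReal_ofReal (by positivity), ENNReal.toReal_ofNat, ← Real.rpow_natCast,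
    ← Real.rpow_mul h0]
  norm_num

theorem sq_toReal_eLpNorm_four {F : α → ℝ} (hF : MemLp F 4 μ) :
    (eLpNorm F 4 μ).toReal ^ 2 = sqNorm4 μ F := by
  have h0 : 0 ≤ ∫ a, F a ^ 4 ∂μ := integral_nonneg fun a => by positivity
  rw [hF.eLpNorm_eq_integral_rpow_norm (by norm_num) (by norm_num)]
  have e : ∀ a, ‖F a‖ ^ (4 : ℝ≥0∞).toReal = F a ^ 4 := fun a => by
    rw [ENNReal.toReal_ofNat, Real.rpow_ofNat, Real.norm_eq_abs, Even.pow_abs (by decide)]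
  simp only [e]
  rw [ENNReal.toReal_ofReal (by positivity), ENNReal.toReal_ofNat, ← Real.rpow_natCast,
    ← Real.rpow_mul h0, sqNorm4, Real.sqrt_eq_rpow]
  norm_num

end Norms

/-! ### Transfer from the two families of variables to one product space. -/

section Transfer

variable {𝒳 : Type u} {𝒴 : Type v} [MeasurableSpace 𝒳] [MeasurableSpace 𝒴] {k d n : ℕ}
  {μ : Measure 𝒳} {ν : Measure 𝒴} [IsProbabilityMeasure μ] [IsProbabilityMeasure ν]
  {f : Args 𝒳 𝒴 k → ℝ}

/-- The arguments of a kernel, read off from a family of pairs indexed by all the coordinates. -/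
def toArgs (z : Idx n → 𝒳 × 𝒴) : Args 𝒳 𝒴 n :=
  (fun i => (z (Sum.inl i)).1, fun e => (z (Sum.inr e)).2)

/-- Every coordinate receives an independent pair with law `μ.prod ν`, of which a vertex reads the
first entry and an edge the second. The two families thus become identically distributed coordinates
over a single space. -/
theorem measurePreserving_toArgs :
    MeasurePreserving (toArgs (𝒳 := 𝒳) (𝒴 := 𝒴) (n := n)) (piLaw (μ.prod ν) (Idx n))
      (law μ ν n) := by
  have h1 := measurePreserving_sumPiEquivProdPi (fun _ : Idx n => μ.prod ν)
  have h2 : MeasurePreserving (fun (a : Fin n → 𝒳 × 𝒴) i => (a i).1)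
      (Measure.pi fun _ => μ.prod ν) (Measure.pi fun _ => μ) :=
    measurePreserving_pi (fun _ : Fin n => μ.prod ν) (fun _ => μ)
      (f := fun _ => Prod.fst) fun _ => measurePreserving_fst
  have h3 : MeasurePreserving (fun (a : Edge (Fin n) → 𝒳 × 𝒴) i => (a i).2)
      (Measure.pi fun _ => μ.prod ν) (Measure.pi fun _ => ν) :=
    measurePreserving_pi (fun _ : Edge (Fin n) => μ.prod ν) (fun _ => ν)
      (f := fun _ => Prod.snd) fun _ => measurePreserving_snd
  exact (h2.prod h3).comp h1

theorem measurable_args_piecewise (A : Finset (Fin k)) (B : Finset (Edge (Fin k))) :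
    Measurable fun r : Args 𝒳 𝒴 k × Args 𝒳 𝒴 k =>
      ((A.piecewise r.1.1 r.2.1, B.piecewise r.1.2 r.2.2) : Args 𝒳 𝒴 k) := by
  refine Measurable.prodMk (measurable_pi_lambda _ fun i => ?_) (measurable_pi_lambda _ fun e => ?_)
  · by_cases hi : i ∈ A <;> simp only [Finset.piecewise, hi, if_true, if_false] <;> fun_prop
  · by_cases he : e ∈ B <;> simp only [Finset.piecewise, he, if_true, if_false] <;> fun_prop

theorem measurable_condMean (hf : Measurable f) (A : Finset (Fin k)) (B : Finset (Edge (Fin k))) :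
    Measurable (condMean μ ν f A B) := by
  have : IsProbabilityMeasure (law μ ν k) := by unfold law; infer_instance
  exact ((hf.comp (measurable_args_piecewise A B)).stronglyMeasurable.integral_prod_right'
    (ν := law μ ν k)).measurable

theorem measurable_component (hf : Measurable f) (A : Finset (Fin k))
    (B : Finset (Edge (Fin k))) : Measurable (component μ ν f A B) :=
  Finset.measurable_sum _ fun A' _ => Finset.measurable_sum _ fun B' _ =>
    (measurable_condMean hf A' B').const_mul _

theorem condMean_toArgs (hf : Measurable f) (A : Finset (Fin k)) (B : Finset (Edge (Fin k)))
    (z : Idx k → 𝒳 × 𝒴) :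
    condMean μ ν f A B (toArgs z) =
      hcond (μ.prod ν) (fun z => f (toArgs z)) (A.disjSum B) z := by
  have hm : Measurable fun q : Args 𝒳 𝒴 k =>
      f (A.piecewise (toArgs z).1 q.1, B.piecewise (toArgs z).2 q.2) :=
    hf.comp ((measurable_args_piecewise A B).comp (measurable_prodMk_left (x := toArgs z)))
  rw [condMean, hcond, ← integral_comp_measurePreserving measurePreserving_toArgs
    hm.aestronglyMeasurable]
  refine integral_congr_ae (Filter.Eventually.of_forall fun z' => ?_)
  simp only
  congr 1
  refine Prod.ext (funext fun i => ?_) (funext fun e => ?_)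
  · by_cases hi : i ∈ A <;> simp [toArgs, Finset.piecewise, hi]
  · by_cases he : e ∈ B <;> simp [toArgs, Finset.piecewise, he]

theorem component_toArgs (hf : Measurable f) (A : Finset (Fin k)) (B : Finset (Edge (Fin k)))
    (z : Idx k → 𝒳 × 𝒴) :
    component μ ν f A B (toArgs z) =
      hcomp (μ.prod ν) (fun z => f (toArgs z)) (A.disjSum B) z := by
  rw [component, hcomp, ← Finset.sum_product']
  refine Finset.sum_bij' (fun p _ => p.1.disjSum p.2) (fun S _ => (S.toLeft, S.toRight))
    (fun p hp => ?_) (fun S hS => ?_) (fun p _ => by simp)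
    (fun S _ => Finset.toLeft_disjSum_toRight) fun p hp => ?_
  · rw [Finset.mem_product, Finset.mem_powerset, Finset.mem_powerset] at hp
    exact Finset.mem_powerset.2 (Finset.disjSum_mono hp.1 hp.2)
  · rw [Finset.mem_powerset, Finset.subset_disjSum] at hS
    exact Finset.mem_product.2 ⟨Finset.mem_powerset.2 hS.1, Finset.mem_powerset.2 hS.2⟩
  · rw [Finset.mem_product, Finset.mem_powerset, Finset.mem_powerset] at hp
    have h1 := Finset.card_le_card hp.1
    have h2 := Finset.card_le_card hp.2
    rw [condMean_toArgs hf, Finset.card_disjSum, Finset.card_disjSum]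
    -- The truncated differences of cardinalities add up because `A' ⊆ A` and `B' ⊆ B`.
    congr 2
    omega

theorem nodes_disjSum (A : Finset (Fin k)) (B : Finset (Edge (Fin k))) :
    (graph A B).verts = nodes ends (A.disjSum B) := by
  ext i
  simp only [graph, Set.mem_ofPred_eq, Finset.mem_coe, mem_nodes]
  constructor
  · rintro (hi | ⟨e, he, hi⟩)
    · exact ⟨Sum.inl i, by simpa using hi, mem_ends_inl.2 rfl⟩
    · exact ⟨Sum.inr e, by simpa using he, mem_ends_inr.2 hi⟩
  · rintro ⟨i' | e, ht, hi⟩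
    · rw [mem_ends_inl.1 hi]
      exact Or.inl (by simpa using ht)
    · exact Or.inr ⟨e, by simpa using ht, mem_ends_inr.1 hi⟩

theorem numNodes_eq (A : Finset (Fin k)) (B : Finset (Edge (Fin k))) :
    numNodes A B = #(nodes ends (A.disjSum B)) := by
  rw [numNodes, nodes_disjSum, Set.ncard_coe_finset]

/-- A walk from a vertex inside the cut to one outside has a dart leaving it, and the edge of this
dart is the crossing coordinate. -/
theorem cutConnected_of_connected {A : Finset (Fin k)} {B : Finset (Edge (Fin k))}
    (h : (graph A B).Connected) : CutConnected ends (A.disjSum B) := by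
  rintro U hU ⟨a, ha⟩ hne
  obtain ⟨b, hb, hbU⟩ : ∃ b ∈ nodes ends (A.disjSum B), b ∉ U := by
    by_contra hc
    push Not at hc
    exact hne (Finset.Subset.antisymm hU hc)
  have ha' : a ∈ (graph A B).verts := by rw [nodes_disjSum]; exact hU ha
  have hb' : b ∈ (graph A B).verts := by rw [nodes_disjSum]; exact hb
  obtain ⟨p⟩ := h.preconnected.coe ⟨a, ha'⟩ ⟨b, hb'⟩
  obtain ⟨e, -, h1, h2⟩ := p.exists_boundary_dart {x | x.1 ∈ U} ha hbU
  obtain ⟨e', he', hs⟩ : (graph A B).Adj e.fst.1 e.snd.1 := e.adj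
  refine ⟨Sum.inr e', by simpa using he', ⟨e.fst.1, mem_ends_inr.2 ?_, h1⟩,
    e.snd.1, mem_ends_inr.2 ?_, h2⟩ <;> rw [hs] <;> simp

theorem vertexSymmetric_toArgs (hs : IsSymmetric f) :
    VertexSymmetric fun z : Idx k → 𝒳 × 𝒴 => f (toArgs z) := fun π z =>
  hs π (toArgs z).1 (toArgs z).2

theorem sq_sigma (hf : Measurable f) (hL : MemLp f 4 (law μ ν k)) (A : Finset (Fin k))
    (B : Finset (Edge (Fin k))) :
    sigma μ ν f A B ^ 2 = ∫ z, hcomp (μ.prod ν) (fun z => f (toArgs z)) (A.disjSum B) z ^ 2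
      ∂(piLaw (μ.prod ν) (Idx k)) := by
  have hc : component μ ν f A B ∘ toArgs =
      hcomp (μ.prod ν) (fun z => f (toArgs z)) (A.disjSum B) :=
    funext (component_toArgs hf A B)
  rw [sigma, ← eLpNorm_comp_measurePreserving (measurable_component hf A B).aestronglyMeasurable
    (measurePreserving_toArgs (μ := μ) (ν := ν)), hc, sq_toReal_eLpNorm_two]
  exact memLp_two_of_four (memLp_hcomp (hL.comp_measurePreserving measurePreserving_toArgs) _)

theorem levelPart_toArgs (hf : Measurable f) (ℓ : ℕ) (z : Idx k → 𝒳 × 𝒴) :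
    levelPart μ ν f ℓ (toArgs z) = ∑ S : Finset (Idx k) with #(nodes ends S) = ℓ,
      hcomp (μ.prod ν) (fun z => f (toArgs z)) S z := by
  rw [levelPart]
  refine Finset.sum_bij' (fun p _ => p.1.disjSum p.2) (fun S _ => (S.toLeft, S.toRight))
    (fun p hp => ?_) (fun S hS => ?_) (fun p _ => by simp)
    (fun S _ => Finset.toLeft_disjSum_toRight) fun p _ => component_toArgs hf _ _ z
  · simpa [numNodes_eq] using hp
  · simpa [numNodes_eq, Finset.toLeft_disjSum_toRight] using hS

/-- The components of one level are orthogonal, so they cannot cancel: a null level part would make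
each of them null. A nonnull component therefore makes its level a candidate for the principal
degree. -/
theorem le_card_nodes (hf : Measurable f) (hL : MemLp f 4 (law μ ν k))
    (hd : IsPrincipalDegree μ ν f d) (S : Finset (Idx k)) (hS : S.Nonempty)
    (h : ¬ hcomp (μ.prod ν) (fun z => f (toArgs z)) S =ᵐ[piLaw (μ.prod ν) (Idx k)] 0) :
    d ≤ #(nodes ends S) := by
  have hg : MemLp (fun z : Idx k → 𝒳 × 𝒴 => f (toArgs z)) 4 (piLaw (μ.prod ν) (Idx k)) :=
    hL.comp_measurePreserving measurePreserving_toArgs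
  have hgm : Measurable fun z : Idx k → 𝒳 × 𝒴 => f (toArgs z) :=
    hf.comp (measurePreserving_toArgs (μ := μ) (ν := ν)).measurable
  obtain ⟨t, ht⟩ := hS
  obtain ⟨i, hi⟩ := isNodeMap_ends.nonempty t
  refine hd.2 ⟨Finset.card_pos.2 ⟨i, mem_nodes.2 ⟨t, ht, hi⟩⟩, fun h0 => ?_⟩
  have h1 := (measurePreserving_toArgs (μ := μ) (ν := ν) (n := k)).quasiMeasurePreserving.ae h0
  have h2 : ∫ z, (∑ R : Finset (Idx k) with #(nodes ends R) = #(nodes ends S),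
      hcomp (μ.prod ν) (fun z => f (toArgs z)) R z) ^ 2 ∂(piLaw (μ.prod ν) (Idx k)) = 0 := by
    refine integral_eq_zero_of_ae ?_
    filter_upwards [h1] with z hz
    rw [← levelPart_toArgs hf, hz]
    simp
  rw [integral_sq_sum_of_pure fun R _ => pure_hcomp hgm hg R] at h2
  have h3 := (Finset.sum_eq_zero_iff_of_nonneg fun R _ =>
    integral_nonneg fun z => sq_nonneg _).1 h2 S (by simp)
  exact ((pure_hcomp hgm hg S).integral_sq_pos h).ne' h3

theorem hasLaw_joint {Ω : Type w} [MeasurableSpace Ω] {P : Measure Ω} [IsProbabilityMeasure P]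
    {X : Fin n → Ω → 𝒳} {Y : Edge (Fin n) → Ω → 𝒴} (hX : ∀ i, HasLaw (X i) μ P)
    (hY : ∀ e, HasLaw (Y e) ν P) (hXi : iIndepFun X P) (hYi : iIndepFun Y P)
    (hXY : IndepFun (fun ω i => X i ω) (fun ω e => Y e ω) P) :
    HasLaw (fun ω => ((fun i => X i ω, fun e => Y e ω) : Args 𝒳 𝒴 n)) (law μ ν n) P := by
  have hXm : AEMeasurable (fun ω i => X i ω) P := aemeasurable_pi_lambda _ fun i => (hX i).aemeasurable
  have hYm : AEMeasurable (fun ω e => Y e ω) P := aemeasurable_pi_lambda _ fun e => (hY e).aemeasurable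
  refine ⟨hXm.prodMk hYm, ?_⟩
  rw [(indepFun_iff_map_prod_eq_prod_map_map hXm hYm).1 hXY,
    (iIndepFun_iff_map_fun_eq_pi_map fun i => (hX i).aemeasurable).1 hXi,
    (iIndepFun_iff_map_fun_eq_pi_map fun e => (hY e).aemeasurable).1 hYi]
  simp only [(hX _).map_eq, (hY _).map_eq, law]

/-- The U-statistic as a function of the family of all the variables. -/
noncomputable def argStat (n : ℕ) (f : Args 𝒳 𝒴 k → ℝ) (q : Args 𝒳 𝒴 n) : ℝ :=
  ∑ α : Fin k ↪o Fin n, f (fun i => q.1 (α i), fun e => q.2 (e.map α.toEmbedding))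

theorem measurable_argStat (hf : Measurable f) : Measurable (argStat n f) :=
  Finset.measurable_sum _ fun α _ => hf.comp
    (Measurable.prodMk (measurable_pi_lambda _ fun i => by fun_prop)
      (measurable_pi_lambda _ fun e => by fun_prop))

/-- The normal approximation of the U-statistic with the constant in terms of the second moment of
one principal component and of the fourth moment of the kernel. -/
theorem berryEsseen_stat (hd : 1 ≤ d) (hdk : d ≤ k) (hf : Measurable f) (hs : IsSymmetric f)
    (hL : MemLp f 4 (law μ ν k)) (hpd : IsPrincipalDegree μ ν f d)
    {A : Finset (Fin k)} {B : Finset (Edge (Fin k))} (hAB : (A, B) ∈ principalSupport μ ν f d)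
    (hconn : ∀ AB ∈ principalSupport μ ν f d, (graph AB.1 AB.2).Connected) (hkn : k ≤ n)
    {Ω : Type w} [MeasurableSpace Ω] {P : Measure Ω} [IsProbabilityMeasure P]
    {X : Fin n → Ω → 𝒳} {Y : Edge (Fin n) → Ω → 𝒴} (hX : ∀ i, HasLaw (X i) μ P)
    (hY : ∀ e, HasLaw (Y e) ν P) (hXi : iIndepFun X P) (hYi : iIndepFun Y P)
    (hXY : IndepFun (fun ω i => X i ω) (fun ω e => Y e ω) P) (t : ℝ) {K : ℝ}
    (hK : K = normConst k (sigma μ ν f A B ^ 2) ((eLpNorm f 4 (law μ ν k)).toReal ^ 2)) :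
    |P.real {ω | (stat f X Y ω - P[stat f X Y]) / √(Var[stat f X Y; P]) ≤ t} -
        cdf (gaussianReal 0 1) t| ≤
      (boundConst k d K + 2 + 8 * (k + k ^ 2) * boundConst k d K +
        64 * boundConst k d K ^ 2 * (k + k ^ 2) ^ 2) / √n := by
  have hmp := measurePreserving_toArgs (μ := μ) (ν := ν) (n := n)
  have hmpk := measurePreserving_toArgs (μ := μ) (ν := ν) (n := k)
  have hlaw := hasLaw_joint hX hY hXi hYi hXY
  have hH : Measurable (argStat n f) := measurable_argStat hf
  have hgm : Measurable fun z : Idx k → 𝒳 × 𝒴 => f (toArgs z) := hf.comp hmpk.measurable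
  have hsm : AEMeasurable (stat f X Y) P := hH.comp_aemeasurable hlaw.aemeasurable
  have hmean : P[stat f X Y] = ∫ z, uStat n (fun z => f (toArgs z)) z
      ∂(piLaw (μ.prod ν) (Idx n)) :=
    (hlaw.integral_comp hH.aestronglyMeasurable).trans
      (integral_comp_measurePreserving hmp hH.aestronglyMeasurable).symm
  have hvar : Var[stat f X Y; P] = ∫ z, (uStat n (fun z => f (toArgs z)) z -
      ∫ z', uStat n (fun z => f (toArgs z)) z' ∂(piLaw (μ.prod ν) (Idx n))) ^ 2
      ∂(piLaw (μ.prod ν) (Idx n)) := by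
    have hsq : Measurable fun q => (argStat n f q - P[stat f X Y]) ^ 2 :=
      (hH.sub_const _).pow_const 2
    rw [variance_eq_integral hsm, ← hmean]
    exact (hlaw.integral_comp hsq.aestronglyMeasurable).trans
      (integral_comp_measurePreserving hmp hsq.aestronglyMeasurable).symm
  have hprob : ∀ c s : ℝ, P.real {ω | (stat f X Y ω - c) / s ≤ t} =
      (piLaw (μ.prod ν) (Idx n)).real
        {z | (uStat n (fun z => f (toArgs z)) z - c) / s ≤ t} := fun c s => by
    have hset : MeasurableSet {q | (argStat n f q - c) / s ≤ t} :=
      measurableSet_le ((hH.sub_const c).div_const s) measurable_const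
    exact (hlaw.measureReal_eq hset).trans (hmp.hasLaw.measureReal_eq hset).symm
  have hsg : MemLp (fun z : Idx k → 𝒳 × 𝒴 => f (toArgs z)) 4 (piLaw (μ.prod ν) (Idx k)) :=
    hL.comp_measurePreserving hmpk
  have hτ : (eLpNorm f 4 (law μ ν k)).toReal ^ 2 =
      sqNorm4 (piLaw (μ.prod ν) (Idx k)) fun z => f (toArgs z) := by
    rw [← eLpNorm_comp_measurePreserving hL.1 hmpk]
    exact sq_toReal_eLpNorm_four hsg
  rw [hprob, hmean, hvar, hK, hτ]
  refine berryEsseen_uStat (S₀ := A.disjSum B) hgm hsg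
    (vertexSymmetric_toArgs hs) hd hdk hkn (le_card_nodes hf hL hpd) (fun S hS hSd => ?_)
    ((numNodes_eq A B).symm.trans hAB.2) (by have := hAB.1; positivity) (sq_sigma hf hL A B).le t
  have hpos := (pure_hcomp hgm hsg S).integral_sq_pos hS
  have e : S.toLeft.disjSum S.toRight = S := Finset.toLeft_disjSum_toRight
  rw [← e] at hpos hSd ⊢
  refine cutConnected_of_connected (hconn (S.toLeft, S.toRight) ⟨fun h0 => ?_, ?_⟩)
  · have h0 : sigma μ ν f S.toLeft S.toRight = 0 := h0
    rw [← sq_sigma hf hL, h0] at hpos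
    simp at hpos
  · exact (numNodes_eq _ _).trans hSd

end Transfer

end GenUStat

theorem theorem2p2 (k d : ℕ) (hd : 2 ≤ d) (hdk : d ≤ k) (σmin τ : ℝ) :
    ∃ C : ℝ, 0 < C ∧
      ∀ (𝒳 : Type u) (𝒴 : Type v) [MeasurableSpace 𝒳] [MeasurableSpace 𝒴]
        (μ : Measure 𝒳) (ν : Measure 𝒴) [IsProbabilityMeasure μ] [IsProbabilityMeasure ν]
        (f : GenUStat.Args 𝒳 𝒴 k → ℝ),
        Measurable f →
        GenUStat.IsSymmetric f →
        MemLp f 4 (GenUStat.law μ ν k) →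
        (eLpNorm f 4 (GenUStat.law μ ν k)).toReal = τ →
        GenUStat.IsPrincipalDegree μ ν f d →
        IsLeast ((fun AB => GenUStat.sigma μ ν f AB.1 AB.2) ''
          GenUStat.principalSupport μ ν f d) σmin →
        (∀ AB ∈ GenUStat.principalSupport μ ν f d, (GenUStat.graph AB.1 AB.2).Connected) →
        ∀ (n : ℕ), k ≤ n →
        ∀ (Ω : Type w) [MeasurableSpace Ω] (P : Measure Ω) [IsProbabilityMeasure P]
          (X : Fin n → Ω → 𝒳) (Y : GenUStat.Edge (Fin n) → Ω → 𝒴),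
          (∀ i, HasLaw (X i) μ P) → (∀ e, HasLaw (Y e) ν P) →
          iIndepFun X P → iIndepFun Y P →
          IndepFun (fun ω i => X i ω) (fun ω e => Y e ω) P →
          ∀ z : ℝ,
            |P.real {ω | (GenUStat.stat f X Y ω - P[GenUStat.stat f X Y]) /
                √(Var[GenUStat.stat f X Y; P]) ≤ z} - cdf (gaussianReal 0 1) z|
              ≤ C * (n : ℝ) ^ (-(1 / 2) : ℝ) := by
  set K := GenUStat.normConst k (σmin ^ 2) (τ ^ 2) with hK
  -- The absolute value and the added `1` give positivity for arbitrary real parameters.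
  refine ⟨|GenUStat.boundConst k d K + 2 + 8 * (k + k ^ 2) * GenUStat.boundConst k d K +
    64 * GenUStat.boundConst k d K ^ 2 * (k + k ^ 2) ^ 2| + 1, by positivity, ?_⟩
  intro 𝒳 𝒴 _ _ μ ν _ _ f hf hs hL hτ hpd hσ hconn n hkn Ω _ P _ X Y hX hY hXi hYi hXY z
  -- A pair that attains `σmin` serves as the principal component in the variance bound.
  obtain ⟨⟨A, B⟩, hAB, rfl⟩ := hσ.1
  subst hτ
  refine (GenUStat.berryEsseen_stat (one_le_two.trans hd) hdk hf hs hL hpd hAB hconn hkn hX hY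
    hXi hYi hXY z hK).trans ?_
  rw [Real.rpow_neg (Nat.cast_nonneg n), ← Real.sqrt_eq_rpow, div_eq_mul_inv]
  exact mul_le_mul_of_nonneg_right ((le_abs_self _).trans (le_add_of_nonneg_right zero_le_one))
    (by positivity)
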